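/- Let $R=(V,A)$ be a finite digraph with $n\ge 1$ vertices, called the request graph. A walk of $R$ is a sequence of vertices in which consecutive vertices are joined by arcs; it is closed if its first and last vertices coincide. The digraph $R$ is connected if its underlying undirected graph is connected. It is walk-Helly if every family of vertex sets of closed walks of $R$ that pairwise intersect has a common vertex. A tree representation of $R$ is a tree $T$ on $V$ such that, for the vertex set $S$ of every closed walk of $R$, the induced subgraph $T[S]$ is connected. A temporal graph on $V$ is a finite set of temporal edges $(\{u,v\},t)$ with $u\neq v$ in $V$ and $t\in\{1,2,\dots\}$; its footprint is the graph on $V$ whose edges are the pairs $\{u,v\}$ that occur in a temporal edge. A journey from $u$ to $v$ is a walk along temporal edges with strictly increasing times. A tree solution for $R$ is a temporal graph on $V$ that contains a journey from $u$ to $v$ for every arc $(u,v)\in A$, has exactly $n-1$ temporal edges, and has a tree as its footprint. (a) If $R$ is connected, then $R$ is walk-Helly if and only if $R$ has a tree representation. (b) If $R$ is strongly connected, then the following are equivalent: (1) $R$ is walk-Helly; (2) $R$ has a tree representation; (3) $R$ has a tree solution. (c) For distinct vertices $u,v$, the arc $(u,v)$, in $R$ or not, is called authorized if there is no vertex $x$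 such that some closed walk contains $u$ and $x$ but not $v$ and some closed walk contains $v$ and $x$ but not $u$. The forced edges of a digraph are the pairs $\{u,v\}$, $u\ne v$, for which both $(u,v)$ and $(v,u)$ are arcs. Consider the following algorithm. While some authorized arc $(u,v)$ of the current digraph is not an arc of it, add $(u,v)$ and $(v,u)$ to the digraph. When there is no such arc left, let $R'$ be the digraph obtained. If the forced edges of $R'$ form a tree on $V$ and can be given one appearance time each so that the resulting temporal graph has a journey from $u$ to $v$ for every arc $(u,v)$ of $R'$, output such a temporal graph; otherwise output NO. If $R$ is strongly connected, then, whatever choices are made, the output is a tree solution for $R$ if one exists, and NO otherwise. Moreover, the algorithm runs in polynomial time: there are a single program of a random access machine (unit cost, with addition and subtraction) and a polynomial $p$ such that, for every $n\ge 1$ and every strongly connected $R$ on $\{0,\dots,n-1\}$, given by its adjacency matrix, the program halts after at most $p(n)$ steps with an output of this algorithm on $R$. In particular a tree solution can be computed in polynomial time whenever one exists. -/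

import Mathlib

universe u

namespace CRS

section Walks

variable {V : Type*}

/-- A nonempty sequence of vertices in which consecutive vertices are joined by arcs of `R`
(a single vertex is a walk of length `0`). -/
def IsWalk (R : Digraph V) (l : List V) : Prop :=
  l ≠ [] ∧ l.IsChain R.Adj

/-- A walk whose first and last vertices coincide. -/
def IsClosedWalk (R : Digraph V) (l : List V) : Prop :=
  IsWalk R l ∧ l.head? = l.getLast?

/-- The vertex sets of the closed walks of `R`, that is, the hyperedges of the closed walk
hypergraph of `R`. -/
def closedWalkSets (R : Digraph V) : Set (Set V) :=
  {S | ∃ l : List V, IsClosedWalk R l ∧ S = {v | v ∈ l}}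

/-- The underlying undirected graph is connected. -/
def IsConnected (R : Digraph V) : Prop :=
  R.toSimpleGraphInclusive.Connected

/-- Every vertex can be reached from every vertex along arcs of `R`. -/
def IsStronglyConnected (R : Digraph V) : Prop :=
  ∀ s t : V, Relation.ReflTransGen R.Adj s t

/-- Helly property of a family of subsets of the ground set `V`. -/
def HasHellyProperty (F : Set (Set V)) : Prop :=
  ∀ F' ⊆ F, (∀ S ∈ F', ∀ S' ∈ F', (S ∩ S').Nonempty) → (⋂₀ F').Nonempty

/-- `R` is walk-Helly. -/
def IsWalkHelly (R : Digraph V) : Prop :=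
  HasHellyProperty (closedWalkSets R)

/-- `T` is a tree on the vertex set of `R` in which the vertex set of every closed walk of `R`
induces a connected subgraph. -/
def IsTreeRepresentation (R : Digraph V) (T : SimpleGraph V) : Prop :=
  T.IsTree ∧ ∀ S ∈ closedWalkSets R, (T.induce S).Connected

end Walks

/-- A temporal graph on `V`: a finite set of temporal edges `({u, v}, t)` with `u ≠ v` and
`t ≥ 1`. -/
structure TemporalGraph (V : Type*) where
  /-- The temporal edges. -/
  edges : Finset (Sym2 V × ℕ)
  not_isDiag : ∀ e ∈ edges, ¬ e.1.IsDiag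
  time_pos : ∀ e ∈ edges, 0 < e.2

section Temporal

variable {V : Type*}

/-- `IsJourney G u v l`: the list `l` of triples `(uᵢ, uᵢ₊₁, tᵢ)` is a (strict) journey of `G`
from `u` to `v`. -/
inductive IsJourney (G : TemporalGraph V) : V → V → List (V × V × ℕ) → Prop
  | nil (u : V) : IsJourney G u u []
  | cons {u w v : V} {t : ℕ} {l : List (V × V × ℕ)} :
      (s(u, w), t) ∈ G.edges → IsJourney G w v l → (∀ a ∈ l.head?, t < a.2.2) →
      IsJourney G u v ((u, w, t) :: l)

/-- `v` is reachable from `u` in `G`. -/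
def TemporalGraph.Reach (G : TemporalGraph V) (u v : V) : Prop :=
  ∃ l, IsJourney G u v l

/-- The static graph of all pairs that occur as endpoints of a temporal edge. -/
def TemporalGraph.footprint (G : TemporalGraph V) : SimpleGraph V :=
  SimpleGraph.fromEdgeSet {e | ∃ t, (e, t) ∈ G.edges}

/-- All requests (arcs of `R`) are satisfied by journeys of `G`. -/
def Satisfies (G : TemporalGraph V) (R : Digraph V) : Prop :=
  ∀ u v : V, R.Adj u v → G.Reach u v

/-- A tree solution for the request graph `R`: all requests are satisfied, there are exactly
`n - 1` temporal edges, and the footprint is a tree. -/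
def IsTreeSolution (R : Digraph V) (G : TemporalGraph V) : Prop :=
  Satisfies G R ∧ G.edges.card + 1 = Nat.card V ∧ G.footprint.IsTree

end Temporal

section GreedyAlgorithm

variable {V : Type*}

/-- Some closed walk of `R` contains `a` and `b` but not `c`. -/
def ClosedWalkAvoiding (R : Digraph V) (a b c : V) : Prop :=
  ∃ l : List V, IsClosedWalk R l ∧ a ∈ l ∧ b ∈ l ∧ c ∉ l

/-- The arc `(u, v)`, in `R` or not, is authorized. -/
def IsAuthorized (R : Digraph V) (u v : V) : Prop :=
  u ≠ v ∧ ∀ x : V, ¬ (ClosedWalkAvoiding R u x v ∧ ClosedWalkAvoiding R v x u)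

/-- `R` together with the arcs `(u, v)` and `(v, u)`. -/
def addArcs (R : Digraph V) (u v : V) : Digraph V where
  Adj a b := R.Adj a b ∨ (a = u ∧ b = v) ∨ (a = v ∧ b = u)

/-- One pass of the loop of the greedy algorithm: some authorized arc `(u, v)` that is missing
is added, together with `(v, u)`. -/
def GreedyStep (R R' : Digraph V) : Prop :=
  ∃ u v : V, IsAuthorized R u v ∧ ¬ R.Adj u v ∧ R' = addArcs R u v

/-- The graph of the forced edges of `R`: the pairs `{u, v}` with both arcs `(u, v)` and
`(v, u)` in `R`. -/
def forcedGraph (R : Digraph V) : SimpleGraph V :=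
  R.toSimpleGraphStrict

/-- `G` gives each forced edge of `R` exactly one appearance time, has no other temporal edge,
and satisfies `R` (used when the forced edges form a tree). -/
def IsLabelisation (R : Digraph V) (G : TemporalGraph V) : Prop :=
  IsTreeSolution R G ∧ G.footprint = forcedGraph R

/-- `out` (a temporal graph, or `none` for the answer NO) is a possible output of the greedy
algorithm on `R`. The loop runs until no authorized arc is missing; then, if the forced edges form
a tree, they are labelled if that is possible, and in all other cases the answer is NO. -/
def IsGreedyOutput (R : Digraph V) (out : Option (TemporalGraph V)) : Prop :=
  ∃ R' : Digraph V, Relation.ReflTransGen GreedyStep R R' ∧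
    (∀ u v : V, IsAuthorized R' u v → R'.Adj u v) ∧
    match out with
    | some G => (forcedGraph R').IsTree ∧ IsLabelisation R' G
    | none => ¬ ((forcedGraph R').IsTree ∧ ∃ G, IsLabelisation R' G)

/-- `out` is a correct answer for `R`: a tree solution, or `none` if there is no tree solution. -/
def IsCorrectAnswer (R : Digraph V) (out : Option (TemporalGraph V)) : Prop :=
  match out with
  | some G => IsTreeSolution R G
  | none => ¬ ∃ G, IsTreeSolution R G

end GreedyAlgorithm

/-! A random access machine with addition, truncated subtraction, indirect addressing and unit
cost, programmed with structured control flow. -/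

namespace RAM

/-- The memory: a natural number at every address. -/
abbrev Mem := ℕ → ℕ

/-- Expressions: constants, the content of the cell with a computed address, sums and (truncated)
differences. -/
inductive Expr
  | lit (c : ℕ)
  | cell (a : Expr)
  | add (a b : Expr)
  | sub (a b : Expr)

/-- The value of an expression. -/
def Expr.eval (M : Mem) : Expr → ℕ
  | lit c => c
  | cell a => M (a.eval M)
  | add a b => a.eval M + b.eval M
  | sub a b => a.eval M - b.eval M

/-- The number of elementary operations in the evaluation of an expression. -/
def Expr.cost : Expr → ℕ
  | lit _ => 1
  | cell a => a.cost + 1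
  | add a b => a.cost + b.cost + 1
  | sub a b => a.cost + b.cost + 1

/-- Programs. `assign a e` writes the value of `e` into the cell whose address is the value of
`a`; a condition holds if its value is not `0`. -/
inductive Prog
  | skip
  | assign (a e : Expr)
  | seq (p q : Prog)
  | ite (c : Expr) (p q : Prog)
  | loop (c : Expr) (p : Prog)

/-- `Exec p M M' t`: the program `p`, started in memory `M`, halts in memory `M'` after `t`
elementary steps. -/
inductive Exec : Prog → Mem → Mem → ℕ → Prop
  | skip (M : Mem) : Exec .skip M M 1
  | assign (a e : Expr) (M : Mem) :
      Exec (.assign a e) M (Function.update M (a.eval M) (e.eval M)) (a.cost + e.cost + 1)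
  | seq {p q : Prog} {M M' M'' : Mem} {t t' : ℕ} :
      Exec p M M' t → Exec q M' M'' t' → Exec (.seq p q) M M'' (t + t')
  | ite_true {c : Expr} {p q : Prog} {M M' : Mem} {t : ℕ} :
      c.eval M ≠ 0 → Exec p M M' t → Exec (.ite c p q) M M' (c.cost + 1 + t)
  | ite_false {c : Expr} {p q : Prog} {M M' : Mem} {t : ℕ} :
      c.eval M = 0 → Exec q M M' t → Exec (.ite c p q) M M' (c.cost + 1 + t)
  | loop_stop {c : Expr} {p : Prog} {M : Mem} :
      c.eval M = 0 → Exec (.loop c p) M M (c.cost + 1)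
  | loop_step {c : Expr} {p : Prog} {M M' M'' : Mem} {t t' : ℕ} :
      c.eval M ≠ 0 → Exec p M M' t → Exec (.loop c p) M' M'' t' →
      Exec (.loop c p) M M'' (c.cost + 1 + t + t')

/-- Programs are deterministic: final memory and running time are determined by the start. -/
theorem Exec.det {p : Prog} {M M₁ M₂ : Mem} {t₁ t₂ : ℕ} (h₁ : Exec p M M₁ t₁)
    (h₂ : Exec p M M₂ t₂) : M₁ = M₂ ∧ t₁ = t₂ := by
  induction h₁ generalizing M₂ t₂ with
  | skip => cases h₂; simp
  | assign => cases h₂; simp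
  | seq _ _ i j => cases h₂ with | seq a b => obtain ⟨rfl, rfl⟩ := i a; obtain ⟨rfl, rfl⟩ := j b; simp
  | ite_true hc _ i => cases h₂ with
    | ite_true _ a => obtain ⟨rfl, rfl⟩ := i a; simp
    | ite_false h _ => exact absurd h hc
  | ite_false hc _ i => cases h₂ with
    | ite_false _ a => obtain ⟨rfl, rfl⟩ := i a; simp
    | ite_true h _ => exact absurd hc h
  | loop_stop hc => cases h₂ with
    | loop_stop => simp
    | loop_step h _ _ => exact absurd hc h
  | loop_step hc _ _ i j => cases h₂ with
    | loop_stop h => exact absurd h hc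
    | loop_step _ a b => obtain ⟨rfl, rfl⟩ := i a; obtain ⟨rfl, rfl⟩ := j b; simp

open Classical in
/-- The input for a request graph on `{0, …, n - 1}`: cell `0` holds `n`, cell `1 + n * u + v`
holds `1` if `(u, v)` is an arc, and all other cells hold `0`. -/
noncomputable def input {n : ℕ} (R : Digraph (Fin n)) : Mem := fun a =>
  if a = 0 then n
  else if ∃ u v : Fin n, a = 1 + n * u + v ∧ R.Adj u v then 1 else 0

/-- The memory `M` holds the answer `out`: NO is `0` in cell `0`; a temporal graph is `1` in cell
`0`, the number of temporal edges in cell `1`, and then the temporal edges without repetition,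
as consecutive triples (endpoint, endpoint, appearance time). -/
def HoldsOutput {n : ℕ} (M : Mem) (out : Option (TemporalGraph (Fin n))) : Prop :=
  match out with
  | none => M 0 = 0
  | some G => M 0 = 1 ∧ ∃ L : List (Fin n × Fin n × ℕ),
      M 1 = L.length ∧
      (∀ (i : ℕ) (h : i < L.length),
        M (2 + 3 * i) = L[i].1 ∧ M (3 + 3 * i) = L[i].2.1 ∧ M (4 + 3 * i) = L[i].2.2) ∧
      (L.map fun e => (s(e.1, e.2.1), e.2.2)).Nodup ∧
      (∀ e, e ∈ G.edges ↔ e ∈ L.map fun e => (s(e.1, e.2.1), e.2.2))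

end RAM

end CRS

/-! A vertex set is the vertex set of a closed walk exactly when it induces a strongly connected
subgraph (`mem_closedWalkSets_iff`). These sets form a family that contains the singletons and is
closed under unions of intersecting members, and the link between walk-Helly and tree
representations is proved for arbitrary such families `H`.

If `H` is Helly and a pair is authorized, joining the members through `u` with the members through
`v` destroys neither property (`HasHellyProperty.joinPair`), so a maximal Helly extension of `H` has
every authorized pair as a member. In such a saturated family the two-element members form a tree in
which all nonempty members are connected (`pairGraph_isTree_of_closed`): an unauthorized pair is
separated by two members with a common vertex, Helly puts a vertex of the hull of the pair into
both, and induction splits the hull there; a cycle would give three pairwise intersecting members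
without a common vertex. Conversely, subtrees of a tree are Helly (`hasHellyProperty_of_subtrees`).

The footprint of a tree solution is a tree representation (`IsTreeSolution.isTreeRepresentation`): a
request between two branches at `x` passes through `x` and leaves it along a later edge than it
entered by, so a closed walk of requests that avoids `x` stays in one branch.

For the opposite direction, a strongly connected walk-Helly digraph stays walk-Helly when both arcs
of an authorized pair are added (`IsWalkHelly.addArcs`). This is subtler than `joinPair`, because
the new strongly connected sets need not be unions of two old ones: they may contain walks from `u`
to `v` but not back. Strong connectivity supplies a return path that turns these sets into old ones.
In the greedy closure the forced edges form a tree representation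
(`forcedGraph_isTreeRepresentation`). Reachability without `x` then partially orders the forced
neighbours of `x`, and ranks in this order label the edges at `x`. The two ends of an edge may
disagree, but on a tree a vertex potential reconciles them (`IsLocallyAcyclic.isLabelisation`).

For the running time, the algorithm is written in a small language with loops over the vertices and
compiled to the machine with a polynomial bound (`HProg.exec_compile`). Reachability is computed by
Warshall's method, which also adds up the potential differences. One sweep over all pairs yields the
greedy closure, because authorization can only be lost when arcs are added (`IsAuthorized.anti`). -/

namespace CRS

/-! ### Reachability inside a vertex set -/

section Reach

variable {V : Type*} {R R' : Digraph V} {X Y S S' : Set V} {a b c : V}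

/-- `b` can be reached from `a` along arcs of `R` with both ends in `X`. -/
def ReachIn (R : Digraph V) (X : Set V) : V → V → Prop :=
  Relation.ReflTransGen fun a b => R.Adj a b ∧ a ∈ X ∧ b ∈ X

/-- `S` is nonempty and induces a strongly connected subgraph of `R`. -/
def StronglyConnectedOn (R : Digraph V) (S : Set V) : Prop :=
  S.Nonempty ∧ ∀ a ∈ S, ∀ b ∈ S, ReachIn R S a b

theorem ReachIn.refl : ReachIn R X a a := Relation.ReflTransGen.refl

theorem ReachIn.trans (h : ReachIn R X a b) (h' : ReachIn R X b c) : ReachIn R X a c :=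
  Relation.ReflTransGen.trans h h'

theorem ReachIn.single (h : R.Adj a b) (ha : a ∈ X) (hb : b ∈ X) : ReachIn R X a b :=
  Relation.ReflTransGen.single ⟨h, ha, hb⟩

theorem ReachIn.mono (h : ReachIn R X a b) (hXY : X ⊆ Y) : ReachIn R Y a b :=
  Relation.ReflTransGen.mono (fun _ _ h => ⟨h.1, hXY h.2.1, hXY h.2.2⟩) _ _ h

theorem ReachIn.mono_digraph (h : ReachIn R X a b) (hR : ∀ a b, R.Adj a b → R'.Adj a b) :
    ReachIn R' X a b :=
  Relation.ReflTransGen.mono (fun _ _ h => ⟨hR _ _ h.1, h.2⟩) _ _ h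

theorem ReachIn.mem_right (h : ReachIn R X a b) (ha : a ∈ X) : b ∈ X := by
  induction h with
  | refl => exact ha
  | tail _ h _ => exact h.2.2

theorem ReachIn.mem_left (h : ReachIn R X a b) (hb : b ∈ X) : a ∈ X := by
  induction h using Relation.ReflTransGen.head_induction_on with
  | refl => exact hb
  | head h _ _ => exact h.2.1

theorem reachIn_univ : ReachIn R Set.univ a b ↔ Relation.ReflTransGen R.Adj a b := by
  simp [ReachIn]

/-- Either the walk avoids `c`, or its part before the first visit of `c` does. -/
theorem ReachIn.avoid_or (h : ReachIn R X a b) (c : V) :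
    ReachIn R (X \ {c}) a b ∨ ReachIn R X a c ∧ ReachIn R X c b := by
  induction h with
  | refl => exact .inl .refl
  | @tail y z hy hz ih =>
    rcases ih with ih | ih
    · by_cases h1 : y = c
      · subst h1; exact .inr ⟨hy, .single hz.1 hz.2.1 hz.2.2⟩
      by_cases h2 : z = c
      · subst h2; exact .inr ⟨hy.tail hz, .refl⟩
      · exact .inl (ih.tail ⟨hz.1, ⟨hz.2.1, h1⟩, hz.2.2, h2⟩)
    · exact .inr ⟨ih.1, ih.2.tail hz⟩

theorem StronglyConnectedOn.singleton (R : Digraph V) (a : V) : StronglyConnectedOn R {a} :=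
  ⟨⟨a, rfl⟩, by rintro x rfl y rfl; exact .refl⟩

theorem StronglyConnectedOn.mono_digraph (h : StronglyConnectedOn R S)
    (hR : ∀ a b, R.Adj a b → R'.Adj a b) : StronglyConnectedOn R' S :=
  ⟨h.1, fun a ha b hb => (h.2 a ha b hb).mono_digraph hR⟩

theorem stronglyConnectedOn_of_center (c : V) (hc : c ∈ S)
    (h1 : ∀ a ∈ S, ReachIn R S c a) (h2 : ∀ a ∈ S, ReachIn R S a c) :
    StronglyConnectedOn R S :=
  ⟨⟨c, hc⟩, fun a ha b hb => (h2 a ha).trans (h1 b hb)⟩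

theorem StronglyConnectedOn.union (h : StronglyConnectedOn R S) (h' : StronglyConnectedOn R S')
    (hi : (S ∩ S').Nonempty) : StronglyConnectedOn R (S ∪ S') := by
  obtain ⟨c, hc, hc'⟩ := hi
  refine stronglyConnectedOn_of_center c (.inl hc) ?_ ?_
  · rintro a (ha | ha)
    · exact (h.2 c hc a ha).mono Set.subset_union_left
    · exact (h'.2 c hc' a ha).mono Set.subset_union_right
  · rintro a (ha | ha)
    · exact (h.2 a ha c hc).mono Set.subset_union_left
    · exact (h'.2 a ha c hc').mono Set.subset_union_right

/-- The strongly connected component of `a` in `R[X]`. -/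
def component (R : Digraph V) (X : Set V) (a : V) : Set V :=
  {b | ReachIn R X a b ∧ ReachIn R X b a}

theorem mem_component_self : a ∈ component R X a := ⟨.refl, .refl⟩

theorem component_subset (ha : a ∈ X) : component R X a ⊆ X := fun _ hb => hb.1.mem_right ha

/-- Every vertex on a walk in `X` from `a` to a member of the component, or back, can itself be
reached from `a` and reaches `a`. So these walks never leave the component. -/
theorem stronglyConnectedOn_component : StronglyConnectedOn R (component R X a) := by
  refine stronglyConnectedOn_of_center a mem_component_self ?_ ?_
  · rintro b ⟨h1, h2⟩
    induction h1 with
    | refl => exact .refl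
    | @tail y z hy hz ih =>
      have hya : ReachIn R X y a := (ReachIn.single hz.1 hz.2.1 hz.2.2).trans h2
      exact (ih hya).tail ⟨hz.1, ⟨hy, hya⟩, hy.tail hz, h2⟩
  · rintro b ⟨h1, h2⟩
    induction h2 using Relation.ReflTransGen.head_induction_on with
    | refl => exact .refl
    | @head y z hy hz ih =>
      have hz' : ReachIn R X a z := h1.tail hy
      exact .head ⟨hy.1, ⟨h1, .head hy hz⟩, hz', hz⟩ (ih hz')

end Reach

/-! ### Closed walks and strongly connected sets -/

section ClosedWalks

variable {V : Type*} {R : Digraph V} {S : Set V}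

theorem reachIn_of_isChain {X : Set V} {l : List V} (hl : l.IsChain R.Adj) (hX : ∀ v ∈ l, v ∈ X)
    {b x y : V} (hx : l.head? = some x) (hy : l.getLast? = some y) (hb : b ∈ l) :
    ReachIn R X x b ∧ ReachIn R X b y := by
  induction l generalizing b x with
  | nil => simp at hx
  | cons c l ih =>
    obtain rfl : c = x := by simpa using hx
    cases l with
    | nil =>
      obtain rfl : c = y := by simpa using hy
      obtain rfl : b = c := by simpa using hb
      exact ⟨.refl, .refl⟩
    | cons d l =>
      simp only [List.isChain_cons_cons] at hl
      have hd : ReachIn R X c d := .single hl.1 (hX _ (by simp)) (hX _ (by simp))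
      have key := fun b hb => ih hl.2 (fun v hv => hX v (List.mem_cons_of_mem _ hv))
        (x := d) (b := b) rfl (by simpa using hy) hb
      rcases List.mem_cons.1 hb with rfl | hb
      · exact ⟨.refl, hd.trans (key d (by simp)).2⟩
      · exact ⟨hd.trans (key b hb).1, (key b hb).2⟩

/-- The endpoint `b` is kept out of `l` so that walks can be concatenated without repeating the
vertex they share. -/
theorem ReachIn.exists_walk {X : Set V} {a b : V} (h : ReachIn R X a b) :
    ∃ l : List V, (l ++ [b]).IsChain R.Adj ∧ (∀ v ∈ l, v ∈ X) ∧ (l ++ [b]).head? = some a := by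
  induction h using Relation.ReflTransGen.head_induction_on with
  | refl => exact ⟨[], by simp, by simp, by simp⟩
  | @head x y hxy _ ih =>
    obtain ⟨l, h1, h2, h3⟩ := ih
    refine ⟨x :: l, ?_, ?_, by simp⟩
    · rw [List.cons_append, List.isChain_cons]
      refine ⟨fun z hz => ?_, h1⟩
      rw [h3] at hz
      obtain rfl : y = z := by simpa using hz
      exact hxy.1
    · rintro v hv
      rcases List.mem_cons.1 hv with rfl | hv
      exacts [hxy.2.1, h2 v hv]

theorem isChain_glue {l l' : List V} {a b : V} (h1 : (l ++ [a]).IsChain R.Adj)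
    (h2 : (l' ++ [b]).IsChain R.Adj) (h3 : (l' ++ [b]).head? = some a) :
    (l ++ (l' ++ [b])).IsChain R.Adj := by
  rw [List.isChain_append] at h1 ⊢
  refine ⟨h1.1, h2, fun x hx y hy => h1.2.2 x hx y ?_⟩
  rw [h3] at hy
  simpa using hy

theorem head?_glue {l l' : List V} {a b c : V} (h1 : (l ++ [a]).head? = some c)
    (h3 : (l' ++ [b]).head? = some a) : (l ++ (l' ++ [b])).head? = some c := by
  cases l with
  | nil => simp at h1; subst h1; simpa using h3
  | cons d l => simpa using h1

/-- For a strongly connected `S`, a closed walk at `a` is extended by a detour `a → b → a` inside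
`S` for one vertex `b` after the other, by induction over the finite subsets of `S`. -/
theorem mem_closedWalkSets_iff [Finite V] :
    S ∈ closedWalkSets R ↔ StronglyConnectedOn R S := by
  constructor
  · rintro ⟨l, ⟨⟨hne, hc⟩, hl⟩, rfl⟩
    obtain ⟨x, hx⟩ : ∃ x, l.head? = some x := by
      cases l with
      | nil => exact absurd rfl hne
      | cons a l => exact ⟨a, rfl⟩
    have key := fun b => reachIn_of_isChain (X := {v | v ∈ l}) hc (fun _ hv => hv) (b := b) hx
      (hl ▸ hx)
    exact stronglyConnectedOn_of_center x (List.mem_of_mem_head? hx) (fun a ha => (key a ha).1)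
      (fun a ha => (key a ha).2)
  · rintro ⟨⟨a, ha⟩, hS⟩
    have key : ∀ s : Set V, s.Finite → s ⊆ S → ∃ l : List V, (l ++ [a]).IsChain R.Adj ∧
        (∀ v ∈ l, v ∈ S) ∧ (l ++ [a]).head? = some a ∧ ∀ v ∈ s, v ∈ l ++ [a] := by
      intro s hs
      induction s, hs using Set.Finite.induction_on with
      | empty => intro _; exact ⟨[], by simp⟩
      | @insert b s _ _ ih =>
        intro hsS
        obtain ⟨l, h1, h2, h3, h4⟩ := ih fun x hx => hsS (.inr hx)
        have hb : b ∈ S := hsS (.inl rfl)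
        obtain ⟨l1, k1, k2, k3⟩ := (hS a ha b hb).exists_walk
        obtain ⟨l2, m1, m2, m3⟩ := (hS b hb a ha).exists_walk
        refine ⟨l ++ (l1 ++ l2), ?_, ?_, ?_, ?_⟩
        · simpa only [List.append_assoc] using isChain_glue (l' := l1 ++ l2) h1
            (by simpa only [List.append_assoc] using isChain_glue k1 m1 m3)
            (by simpa only [List.append_assoc] using head?_glue k3 m3)
        · simp only [List.mem_append]
          rintro v (h | h | h)
          exacts [h2 v h, k2 v h, m2 v h]
        · simpa only [List.append_assoc] using head?_glue (l' := l1 ++ l2) h3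
            (by simpa only [List.append_assoc] using head?_glue k3 m3)
        · rintro v (rfl | hv)
          · have : v ∈ l2 ++ [a] := List.mem_of_mem_head? (by rw [m3]; rfl)
            simp only [List.mem_append] at this ⊢
            tauto
          · have := h4 v hv
            simp only [List.mem_append] at this ⊢
            tauto
    obtain ⟨l, h1, h2, h3, h4⟩ := key S S.toFinite le_rfl
    refine ⟨l ++ [a], ⟨⟨by simp, h1⟩, by rw [h3]; simp⟩, ?_⟩
    ext v
    refine ⟨h4 v, fun hv => ?_⟩
    rcases List.mem_append.1 hv with hv | hv
    · exact h2 v hv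
    · simp only [List.mem_singleton] at hv; exact hv ▸ ha

theorem closedWalkAvoiding_iff_exists [Finite V] {a b c : V} : ClosedWalkAvoiding R a b c ↔
    ∃ S, StronglyConnectedOn R S ∧ a ∈ S ∧ b ∈ S ∧ c ∉ S := by
  constructor
  · rintro ⟨l, hl, h⟩
    exact ⟨{v | v ∈ l}, mem_closedWalkSets_iff.1 ⟨l, hl, rfl⟩, h⟩
  · rintro ⟨S, hS, h⟩
    obtain ⟨l, hl, rfl⟩ := mem_closedWalkSets_iff.2 hS
    exact ⟨l, hl, h⟩

/-- The component of `a` in the digraph without `c` is the largest candidate; `a ≠ c` ensures that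
it avoids `c`. -/
theorem closedWalkAvoiding_iff [Finite V] {a b c : V} (hac : a ≠ c) : ClosedWalkAvoiding R a b c ↔
    ReachIn R {c}ᶜ a b ∧ ReachIn R {c}ᶜ b a := by
  rw [closedWalkAvoiding_iff_exists]
  constructor
  · rintro ⟨S, hS, ha, hb, hc⟩
    have : S ⊆ {c}ᶜ := by rintro x hx rfl; exact hc hx
    exact ⟨(hS.2 a ha b hb).mono this, (hS.2 b hb a ha).mono this⟩
  · rintro h
    exact ⟨component R {c}ᶜ a, stronglyConnectedOn_component, mem_component_self, h,
      fun hc => component_subset hac hc rfl⟩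

theorem closedWalkAvoiding_mono [Finite V] {R' : Digraph V} (hR : ∀ a b, R.Adj a b → R'.Adj a b)
    {a b c : V} (h : ClosedWalkAvoiding R a b c) : ClosedWalkAvoiding R' a b c := by
  rw [closedWalkAvoiding_iff_exists] at h ⊢
  obtain ⟨S, hS, h⟩ := h
  exact ⟨S, hS.mono_digraph hR, h⟩

theorem IsAuthorized.symm {u v : V} (h : IsAuthorized R u v) : IsAuthorized R v u :=
  ⟨h.1.symm, fun x hx => h.2 x hx.symm⟩

/-- More arcs give more closed walks and hence more obstructions, so authorization is never gained
during the algorithm. -/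
theorem IsAuthorized.anti [Finite V] {R' : Digraph V} (hR : ∀ a b, R.Adj a b → R'.Adj a b)
    {u v : V} (h : IsAuthorized R' u v) : IsAuthorized R u v :=
  ⟨h.1, fun x hx => h.2 x ⟨closedWalkAvoiding_mono hR hx.1, closedWalkAvoiding_mono hR hx.2⟩⟩

theorem closedWalkSets_eq [Finite V] : closedWalkSets R = {S | StronglyConnectedOn R S} :=
  Set.ext fun _ => mem_closedWalkSets_iff

theorem stronglyConnectedOn_pair {u v : V} (hne : u ≠ v) :
    StronglyConnectedOn R {u, v} ↔ R.Adj u v ∧ R.Adj v u := by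
  constructor
  · have key : ∀ {u v : V}, u ≠ v → StronglyConnectedOn R {u, v} → R.Adj u v := by
      intro u v hne h
      have := h.2 u (by simp) v (by simp)
      rcases Relation.ReflTransGen.cases_tail this with h | ⟨c, h1, h2⟩
      · exact absurd h hne.symm
      · clear this
        generalize hw : v = w at h1 h2
        have : ∀ c, ReachIn R {u, v} u c → c = u ∨ c = v ∧ R.Adj u v := by
          intro c hc
          induction hc with
          | refl => exact .inl rfl
          | @tail y z hy hz ih =>
            rcases hz.2.2 with h | h
            · exact .inl h
            · rcases ih with hy | ih
              · exact .inr ⟨h, hy ▸ Set.mem_singleton_iff.1 h ▸ hz.1⟩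
              · exact .inr ⟨h, ih.2⟩
        subst hw
        rcases this c h1 with rfl | h
        exacts [h2.1, h.2]
    intro h
    exact ⟨key hne h, key hne.symm (Set.pair_comm u v ▸ h)⟩
  · rintro ⟨h1, h2⟩
    refine ⟨⟨u, by simp⟩, ?_⟩
    rintro a (rfl | rfl) b (rfl | rfl)
    · exact .refl
    · exact .single h1 (by simp) (by simp)
    · exact .single h2 (by simp) (by simp)
    · exact .refl

end ClosedWalks

end CRS

namespace CRS

/-! ### Union-closed Helly families and their trees -/

section Hypergraph

variable {V : Type*} {H F₁ F₂ : Set (Set V)} {u v : V}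

/-- The union of two intersecting members belongs to the family. -/
def IsUnionClosed (H : Set (Set V)) : Prop :=
  ∀ A ∈ H, ∀ B ∈ H, (A ∩ B).Nonempty → A ∪ B ∈ H

/-- No vertex `x` lies both in a member that separates `u` from `v` and in one that separates `v`
from `u`. -/
def PairAuthorized (H : Set (Set V)) (u v : V) : Prop :=
  ∀ x, ¬ ((∃ A ∈ H, u ∈ A ∧ x ∈ A ∧ v ∉ A) ∧ ∃ B ∈ H, v ∈ B ∧ x ∈ B ∧ u ∉ B)

/-- `S` meets every member of `F`. -/
def MeetsAll (F : Set (Set V)) (S : Set V) : Prop :=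
  ∀ A ∈ F, (A ∩ S).Nonempty

/-- The map `f` replaces sets `S` that may lie outside `H` by members of `H`. These share `v` and
meet every set in `F₁`, so the Helly property applies to all of them together. -/
theorem HasHellyProperty.exists_common (hH : HasHellyProperty H) (h₁ : F₁ ⊆ H)
    (pw : ∀ S ∈ F₁, ∀ S' ∈ F₁, (S ∩ S').Nonempty) (f : Set V → Set V)
    (hf : ∀ S ∈ F₂, f S ∈ H ∧ v ∈ f S ∧ MeetsAll F₁ (f S)) :
    ∃ y, (∀ A ∈ F₁, y ∈ A) ∧ ∀ S ∈ F₂, y ∈ f S := by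
  obtain ⟨y, hy⟩ := hH (F₁ ∪ f '' F₂)
    (Set.union_subset h₁ (by rintro _ ⟨S, hS, rfl⟩; exact (hf S hS).1)) (by
      rintro A (hA | ⟨S, hS, rfl⟩) B (hB | ⟨S', hS', rfl⟩)
      · exact pw A hA B hB
      · exact (hf S' hS').2.2 A hA
      · rw [Set.inter_comm]; exact (hf S hS).2.2 B hB
      · exact ⟨v, (hf S hS).2.1, (hf S' hS').2.1⟩)
  exact ⟨y, fun A hA => hy A (.inl hA), fun S hS => hy _ (.inr ⟨S, hS, rfl⟩)⟩

theorem HasHellyProperty.exists_common_mem (hH : HasHellyProperty H) (h₁ : F₁ ⊆ H)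
    (pw : ∀ S ∈ F₁, ∀ S' ∈ F₁, (S ∩ S').Nonempty) {S : Set V} (hS : S ∈ H) (hv : v ∈ S)
    (hm : MeetsAll F₁ S) : ∃ y, (∀ A ∈ F₁, y ∈ A) ∧ y ∈ S := by
  obtain ⟨y, hy, hy'⟩ := hH.exists_common (F₂ := {S}) (v := v) h₁ pw id (by rintro _ rfl; exact ⟨hS, hv, hm⟩)
  exact ⟨y, hy, hy' S rfl⟩

/-- The common core of `HasHellyProperty.joinPair` and `IsWalkHelly.addArcs`. A new set `S` has an
old part `P S` at `u` and an old part `Q S` at `v`; call a part good if it meets all of `F₁`. If `u`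
is not common to `F₁`, a good `P S` and a good `Q S'` cannot coexist by authorization. So all good
parts are at the same terminal, and each `S` can be replaced by its part there, or by the
enlargement `T S` if neither of its parts is good. The replacements share that terminal. -/
theorem exists_common_of_pairAuthorized (hU : IsUnionClosed H) (hH : HasHellyProperty H)
    (auth : PairAuthorized H u v) (h₁ : F₁ ⊆ H)
    (pw : ∀ S ∈ F₁, ∀ S' ∈ F₁, (S ∩ S').Nonempty) (pw' : ∀ S ∈ F₂, MeetsAll F₁ S)
    (P Q T : Set V → Set V)
    (hP : ∀ S ∈ F₂, P S ∈ H ∧ P S ⊆ S ∧ u ∈ P S ∧ v ∉ P S)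
    (hQ : ∀ S ∈ F₂, Q S ∈ H ∧ Q S ⊆ S ∧ v ∈ Q S ∧ u ∉ Q S)
    (hT : ∀ S ∈ F₂, ¬ MeetsAll F₁ (P S) → ¬ MeetsAll F₁ (Q S) → T S ∈ H ∧ S ⊆ T S) :
    ∃ y, (∀ A ∈ F₁, y ∈ A) ∧
      ∀ S ∈ F₂, y ∈ S ∨ ¬ MeetsAll F₁ (P S) ∧ ¬ MeetsAll F₁ (Q S) ∧ y ∈ T S := by
  classical
  by_cases hu : ∀ A ∈ F₁, u ∈ A
  · exact ⟨u, hu, fun S hS => .inl ((hP S hS).2.1 (hP S hS).2.2.1)⟩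
  push Not at hu
  obtain ⟨A, hA, huA⟩ := hu
  have meets_T : ∀ S ∈ F₂, S ⊆ T S → MeetsAll F₁ (T S) := fun S hS h B hB =>
    (pw' S hS B hB).mono (Set.inter_subset_inter_right _ h)
  by_cases good_u : ∃ S ∈ F₂, MeetsAll F₁ (P S)
  · by_cases good_v : ∃ S ∈ F₂, MeetsAll F₁ (Q S)
    · exfalso
      obtain ⟨S, hS, hm⟩ := good_u
      obtain ⟨S', hS', hm'⟩ := good_v
      obtain ⟨hS1, -, hS3, hS4⟩ := hP S hS
      obtain ⟨hS'1, -, hS'3, hS'4⟩ := hQ S' hS'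
      obtain ⟨z, hz, hzP⟩ := hH.exists_common_mem h₁ pw hS1 hS3 hm
      -- The vertex `z` is common to `F₁` and lies in `P S`. The member `A` of `F₁` misses `u`, so
      -- `A ∪ Q S'` is a member through `v` and `z` that avoids `u`.
      refine auth z ⟨⟨P S, hS1, hS3, hzP, hS4⟩, A ∪ Q S', hU A (h₁ hA) _ hS'1 (hm' A hA),
        .inr hS'3, .inl (hz A hA), ?_⟩
      rintro (h | h)
      exacts [huA h, hS'4 h]
    · push Not at good_v
      obtain ⟨y, hy, hy'⟩ := hH.exists_common (F₂ := F₂) (v := u) h₁ pw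
        (fun S => if MeetsAll F₁ (P S) then P S else T S) (fun S hS => by
          obtain ⟨k1, k2, k3, -⟩ := hP S hS
          split_ifs with h
          · exact ⟨k1, k3, h⟩
          · obtain ⟨h1, h2⟩ := hT S hS h (good_v S hS)
            exact ⟨h1, h2 (k2 k3), meets_T S hS h2⟩)
      refine ⟨y, hy, fun S hS => ?_⟩
      have := hy' S hS
      split_ifs at this with h
      exacts [.inl ((hP S hS).2.1 this), .inr ⟨h, good_v S hS, this⟩]
  · push Not at good_u
    obtain ⟨y, hy, hy'⟩ := hH.exists_common (F₂ := F₂) (v := v) h₁ pw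
      (fun S => if MeetsAll F₁ (Q S) then Q S else T S) (fun S hS => by
        obtain ⟨k1, k2, k3, -⟩ := hQ S hS
        split_ifs with h
        · exact ⟨k1, k3, h⟩
        · obtain ⟨h1, h2⟩ := hT S hS (good_u S hS) h
          exact ⟨h1, h2 (k2 k3), meets_T S hS h2⟩)
    refine ⟨y, hy, fun S hS => ?_⟩
    have := hy' S hS
    split_ifs at this with h
    exacts [.inl ((hQ S hS).2.1 this), .inr ⟨good_u S hS, h, this⟩]

/-- The graph whose edges are the two-element members. -/
def pairGraph (H : Set (Set V)) : SimpleGraph V where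
  Adj u v := u ≠ v ∧ {u, v} ∈ H
  symm := ⟨fun u v h => ⟨h.1.symm, Set.pair_comm u v ▸ h.2⟩⟩
  loopless := ⟨fun _ h => h.1 rfl⟩

theorem reachable_induce_of_reachIn {G : SimpleGraph V} {S : Set V} {a b : V}
    (h : ReachIn ⟨G.Adj⟩ S a b) (ha : a ∈ S) (hb : b ∈ S) :
    (G.induce S).Reachable ⟨a, ha⟩ ⟨b, hb⟩ := by
  induction h with
  | refl => exact .refl _
  | @tail y z hy hz ih =>
    exact (ih hz.2.1).trans (SimpleGraph.Adj.reachable (by simpa using hz.1))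

theorem ReachIn.reverse_graph {G : SimpleGraph V} {S : Set V} {a b : V}
    (h : ReachIn ⟨G.Adj⟩ S a b) : ReachIn ⟨G.Adj⟩ S b a := by
  induction h with
  | refl => exact .refl
  | tail _ hz ih => exact .head ⟨hz.1.symm, hz.2.2, hz.2.1⟩ ih

theorem induce_connected_of_reachIn {G : SimpleGraph V} {S : Set V} (hS : S.Nonempty)
    (h : ∀ a ∈ S, ∀ b ∈ S, ReachIn ⟨G.Adj⟩ S a b) : (G.induce S).Connected := by
  have : Nonempty S := hS.to_subtype
  exact ⟨fun a b => reachable_induce_of_reachIn (h a a.2 b b.2) a.2 b.2⟩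

/-- The intersection of the members that contain both `u` and `v`. -/
def hull (H : Set (Set V)) (u v : V) : Set V :=
  ⋂₀ {S ∈ H | u ∈ S ∧ v ∈ S}

theorem left_mem_hull : u ∈ hull H u v := fun _ h => h.2.1

theorem right_mem_hull : v ∈ hull H u v := fun _ h => h.2.2

/-- Induction on the size of the hull. If the pair is not a member, it is not authorized, so there
are intersecting members `A ∋ u` and `B ∋ v` that avoid `v` and `u`. Helly gives a vertex `y` of the
hull in `A ∩ B`. The hull of `u, y` lies in `A` and misses `v`, that of `y, v` lies in `B` and
misses `u`, so both are smaller. -/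
theorem reachIn_hull [Finite V] (hH : HasHellyProperty H)
    (closed : ∀ u v, u ≠ v → PairAuthorized H u v → {u, v} ∈ H) (u v : V) :
    ReachIn ⟨(pairGraph H).Adj⟩ (hull H u v) u v := by
  induction hn : (hull H u v).ncard using Nat.strong_induction_on generalizing u v with
  | _ n ih =>
  by_cases huv : u = v
  · subst huv; exact .refl
  by_cases hp : {u, v} ∈ H
  · exact .single ⟨huv, hp⟩ left_mem_hull right_mem_hull
  have : ¬ PairAuthorized H u v := fun h => hp (closed u v huv h)
  simp only [PairAuthorized, not_forall, not_not] at this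
  obtain ⟨x, ⟨A, hA, huA, hxA, hvA⟩, B, hB, hvB, hxB, huB⟩ := this
  obtain ⟨y, hy⟩ := hH ({S ∈ H | u ∈ S ∧ v ∈ S} ∪ {A, B})
    (Set.union_subset (fun _ h => h.1) (by rintro _ (rfl | rfl) <;> assumption)) (by
      rintro S (hS | rfl | rfl) S' (hS' | rfl | rfl)
      exacts [⟨u, hS.2.1, hS'.2.1⟩, ⟨u, hS.2.1, huA⟩, ⟨v, hS.2.2, hvB⟩, ⟨u, huA, hS'.2.1⟩,
        ⟨u, huA, huA⟩, ⟨x, hxA, hxB⟩, ⟨v, hvB, hS'.2.2⟩, ⟨x, hxB, hxA⟩, ⟨v, hvB, hvB⟩])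
  have hyA : y ∈ A := hy A (.inr (.inl rfl))
  have hyB : y ∈ B := hy B (.inr (.inr rfl))
  have hyI : y ∈ hull H u v := fun S hS => hy S (.inl hS)
  have h1 : hull H u y ⊆ hull H u v := fun z hz S hS => hz S ⟨hS.1, hS.2.1, hyI S hS⟩
  have h2 : hull H y v ⊆ hull H u v := fun z hz S hS => hz S ⟨hS.1, hyI S hS, hS.2.2⟩
  have l1 : (hull H u y).ncard < n := hn ▸ Set.ncard_lt_ncard
    (h1.ssubset_of_mem_notMem right_mem_hull fun h => hvA (h A ⟨hA, huA, hyA⟩)) (Set.toFinite _)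
  have l2 : (hull H y v).ncard < n := hn ▸ Set.ncard_lt_ncard
    (h2.ssubset_of_mem_notMem left_mem_hull fun h => huB (h B ⟨hB, hyB, hvB⟩)) (Set.toFinite _)
  exact ((ih _ l1 u y rfl).mono h1).trans ((ih _ l2 y v rfl).mono h2)

theorem support_mem_of_walk (hU : IsUnionClosed H) (hs : ∀ v, {v} ∈ H) {u v : V}
    (p : (pairGraph H).Walk u v) : {x | x ∈ p.support} ∈ H := by
  induction p with
  | @nil u => simpa using hs u
  | @cons u w v h p ih =>
    have := hU _ h.2 _ ih ⟨w, by simp, by simp⟩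
    convert this using 1
    ext x
    simp only [SimpleGraph.Walk.support_cons, List.mem_cons, Set.mem_ofPred_eq, Set.mem_union,
      Set.mem_insert_iff, Set.mem_singleton_iff]
    constructor
    · tauto
    · rintro ((h | rfl) | h)
      exacts [.inl h, .inr p.start_mem_support, .inr h]

/-- A cycle through the edge `uv` continues from `u` to some `w ≠ v` and returns to `v` by a path
`q` without `u`. Then `{u, v}`, `{u, w}` and the support of `q` are members that intersect pairwise,
but no vertex is common to all three. -/
theorem pairGraph_isAcyclic (hU : IsUnionClosed H) (hs : ∀ v, {v} ∈ H)
    (hH : HasHellyProperty H) : (pairGraph H).IsAcyclic := by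
  classical
  rw [SimpleGraph.isAcyclic_iff_forall_adj_isBridge]
  intro u v huv
  rw [SimpleGraph.isBridge_iff]
  rintro ⟨p⟩
  obtain ⟨p, hp⟩ := p.toPath
  cases p with
  | nil => exact huv.1 rfl
  | @cons _ w _ h q =>
    rw [SimpleGraph.Walk.cons_isPath_iff] at hp
    rw [SimpleGraph.deleteEdges_adj] at h
    have hwv : w ≠ v := by rintro rfl; exact h.2 rfl
    have hq := support_mem_of_walk hU hs (q.mapLe (SimpleGraph.deleteEdges_le _))
    simp only [SimpleGraph.Walk.support_mapLe_eq_support] at hq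
    have hw : w ∈ q.support := q.start_mem_support
    have hv : v ∈ q.support := q.end_mem_support
    obtain ⟨y, hy⟩ := hH {{u, v}, {u, w}, {x | x ∈ q.support}}
      (by rintro _ (rfl | rfl | rfl); exacts [huv.2, h.1.2, hq]) (by
        rintro _ (rfl | rfl | rfl) _ (rfl | rfl | rfl)
        exacts [⟨u, by simp⟩, ⟨u, by simp⟩, ⟨v, by simp⟩, ⟨u, by simp⟩, ⟨u, by simp⟩,
          ⟨w, by simp⟩, ⟨v, by simp⟩, ⟨w, by simp⟩, ⟨w, by simp⟩])
    have h1 : y ∈ ({u, v} : Set V) := hy _ (by simp)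
    have h2 : y ∈ ({u, w} : Set V) := hy _ (by simp)
    have h3 : y ∈ {x | x ∈ q.support} := hy _ (by simp)
    rcases h1 with rfl | rfl
    · exact hp.2 h3
    · rcases h2 with rfl | h2
      exacts [hp.2 h3, hwv h2.symm]

theorem pairGraph_isTree_of_closed [Finite V] [Nonempty V] (hU : IsUnionClosed H)
    (hs : ∀ v, {v} ∈ H) (hH : HasHellyProperty H)
    (closed : ∀ u v, u ≠ v → PairAuthorized H u v → {u, v} ∈ H) :
    (pairGraph H).IsTree ∧ ∀ S ∈ H, S.Nonempty → ((pairGraph H).induce S).Connected := by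
  refine ⟨⟨⟨fun u v => ?_⟩, pairGraph_isAcyclic hU hs hH⟩, fun S hS hne =>
    induce_connected_of_reachIn hne fun a ha b hb =>
      (reachIn_hull hH closed a b).mono fun x hx => hx S ⟨hS, ha, hb⟩⟩
  have := ((reachIn_hull hH closed u v).mono (Set.subset_univ _))
  rw [reachIn_univ] at this
  exact (SimpleGraph.reachable_iff_reflTransGen _ _).2 this

/-- `H` together with the unions of a member containing `u` and one containing `v`. -/
def joinPair (H : Set (Set V)) (u v : V) : Set (Set V) :=
  H ∪ {S | ∃ A ∈ H, ∃ B ∈ H, u ∈ A ∧ v ∈ B ∧ S = A ∪ B}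

theorem IsUnionClosed.joinPair (hU : IsUnionClosed H) : IsUnionClosed (joinPair H u v) := by
  have key : ∀ S ∈ H, ∀ A ∈ H, ∀ B ∈ H, u ∈ A → v ∈ B → (S ∩ (A ∪ B)).Nonempty →
      S ∪ (A ∪ B) ∈ CRS.joinPair H u v := by
    rintro S hS A hA B hB hu hv ⟨x, hx, hx' | hx'⟩
    · exact .inr ⟨S ∪ A, hU _ hS _ hA ⟨x, hx, hx'⟩, B, hB, .inr hu, hv, (Set.union_assoc ..).symm⟩
    · exact .inr ⟨A, hA, S ∪ B, hU _ hS _ hB ⟨x, hx, hx'⟩, hu, .inr hv, Set.union_left_comm ..⟩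
  rintro S (hS | ⟨A, hA, B, hB, hu, hv, rfl⟩) S' (hS' | ⟨A', hA', B', hB', hu', hv', rfl⟩) hne
  · exact .inl (hU S hS S' hS' hne)
  · exact key S hS A' hA' B' hB' hu' hv' hne
  · rw [Set.union_comm]
    exact key S' hS' A hA B hB hu hv (Set.inter_comm S' _ ▸ hne)
  · exact .inr ⟨A ∪ A', hU _ hA _ hA' ⟨u, hu, hu'⟩, B ∪ B', hU _ hB _ hB' ⟨v, hv, hv'⟩, .inl hu,
      .inl hv, Set.union_union_union_comm ..⟩

/-- A new member is `P ∪ Q` with `u ∈ P` and `v ∈ Q`, and `v ∉ P`, `u ∉ Q`, since otherwise the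
union is old. One of the parts meets all old sets of the family: if `A` misses `P` and `B` misses
`Q`, then `A` meets `Q`, `B` meets `P`, and a vertex of `A ∩ B` contradicts authorization through `B
∪ P` and `A ∪ Q`. So the enlargement `T` is never needed, and `id` is a placeholder. -/
theorem HasHellyProperty.joinPair (hU : IsUnionClosed H) (hH : HasHellyProperty H)
    (auth : PairAuthorized H u v) : HasHellyProperty (joinPair H u v) := by
  intro F hF pw
  have h2 : ∀ S, ∃ A B, S ∈ F \ H → A ∈ H ∧ B ∈ H ∧ u ∈ A ∧ v ∉ A ∧ v ∈ B ∧ u ∉ B ∧ S = A ∪ B := by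
    intro S
    by_cases hS : S ∈ F \ H
    · rcases hF hS.1 with h | ⟨A, hA, B, hB, hu, hv, rfl⟩
      · exact absurd h hS.2
      · exact ⟨A, B, fun _ => ⟨hA, hB, hu, fun h => hS.2 (hU A hA B hB ⟨v, h, hv⟩), hv,
          fun h => hS.2 (hU A hA B hB ⟨u, hu, h⟩), rfl⟩⟩
    · exact ⟨∅, ∅, fun h => absurd h hS⟩
  choose P Q hPQ using h2
  obtain ⟨y, hy, hy'⟩ := exists_common_of_pairAuthorized (F₁ := F ∩ H) (F₂ := F \ H) hU hH auth
    Set.inter_subset_right (fun S hS S' hS' => pw S hS.1 S' hS'.1)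
    (fun S hS A hA => pw A hA.1 S hS.1) P Q id
    (fun S hS => by
      obtain ⟨h1, -, h3, h4, -, -, h⟩ := hPQ S hS
      -- Only the right-hand side is rewritten, since `S` also occurs as the argument of `P`.
      exact ⟨h1, by conv_rhs => rw [h]
                    exact Set.subset_union_left, h3, h4⟩)
    (fun S hS => by
      obtain ⟨-, h1, -, -, h3, h4, h⟩ := hPQ S hS
      exact ⟨h1, by conv_rhs => rw [h]
                    exact Set.subset_union_right, h3, h4⟩)
    (fun S hS n1 n2 => by
      exfalso
      simp only [MeetsAll, not_forall] at n1 n2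
      obtain ⟨A, hA, hAP⟩ := n1
      obtain ⟨B, hB, hBQ⟩ := n2
      obtain ⟨h1, h2, h3, h4, h5, h6, h7⟩ := hPQ S hS
      have hAQ : (A ∩ Q S).Nonempty := by
        have := pw A hA.1 S hS.1
        rw [h7, Set.inter_union_distrib_left] at this
        exact (Set.union_nonempty.1 this).resolve_left hAP
      have hBP : (B ∩ P S).Nonempty := by
        have := pw B hB.1 S hS.1
        rw [h7, Set.inter_union_distrib_left] at this
        exact (Set.union_nonempty.1 this).resolve_right hBQ
      obtain ⟨y, hyA, hyB⟩ := pw A hA.1 B hB.1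
      refine auth y ⟨⟨_, hU _ hB.2 _ h1 hBP, .inr h3, .inl hyB, ?_⟩, _, hU _ hA.2 _ h2 hAQ,
        .inr h5, .inl hyA, ?_⟩
      · rintro (h | h)
        exacts [hBQ ⟨v, h, h5⟩, h4 h]
      · rintro (h | h)
        exacts [hAP ⟨u, h, h3⟩, h6 h])
  refine ⟨y, fun S hS => ?_⟩
  by_cases hSH : S ∈ H
  · exact hy S ⟨hS, hSH⟩
  · rcases hy' S ⟨hS, hSH⟩ with h | h
    exacts [h, h.2.2]

/-- A Helly family that is closed under unions of intersecting members has a tree in which all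
its nonempty members are connected. -/
theorem exists_tree_of_helly [Finite V] [Nonempty V] (hU : IsUnionClosed H) (hs : ∀ v, {v} ∈ H)
    (hH : HasHellyProperty H) :
    ∃ T : SimpleGraph V, T.IsTree ∧ ∀ S ∈ H, S.Nonempty → (T.induce S).Connected := by
  -- A maximal family absorbs `joinPair` for every authorized pair and therefore contains the pair
  -- as `{u} ∪ {v}`.
  obtain ⟨M, hHM, ⟨hMU, hMH⟩, hmax⟩ := Set.Finite.exists_le_maximal
    (s := {M : Set (Set V) | IsUnionClosed M ∧ HasHellyProperty M}) (Set.toFinite _) ⟨hU, hH⟩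
  have hMs : ∀ v, {v} ∈ M := fun v => hHM (hs v)
  obtain ⟨h1, h2⟩ := pairGraph_isTree_of_closed hMU hMs hMH fun u v _ auth =>
    hmax ⟨hMU.joinPair (u := u) (v := v), hMH.joinPair hMU auth⟩ Set.subset_union_left
      (.inr ⟨{u}, hMs u, {v}, hMs v, rfl, rfl, rfl⟩)
  exact ⟨_, h1, fun S hS => h2 S (hHM hS)⟩

end Hypergraph

/-! ### The Helly property of subtrees -/

section Subtrees

variable {V : Type*} {T : SimpleGraph V}

theorem reachable_of_induce_connected {S : Set V} (hS : (T.induce S).Connected) {x y a b : V}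
    (hx : x ∉ S) (ha : a ∈ S) (hb : b ∈ S) : (T.deleteEdges {s(x, y)}).Reachable a b := by
  have := hS.preconnected ⟨a, ha⟩ ⟨b, hb⟩
  rw [SimpleGraph.reachable_iff_reflTransGen] at this
  have h := Relation.ReflTransGen.lift (p := (T.deleteEdges {s(x, y)}).Adj) Subtype.val ?_ _ _ this
  · exact (SimpleGraph.reachable_iff_reflTransGen _ _).2 h
  rintro ⟨c, hc⟩ ⟨d, hd⟩ h
  change (T.deleteEdges {s(x, y)}).Adj c d
  rw [SimpleGraph.deleteEdges_adj]
  refine ⟨by simpa using h, fun h => ?_⟩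
  rcases Sym2.eq_iff.1 (Set.mem_singleton_iff.1 h) with h | h
  exacts [hx (h.1 ▸ hc), hx (h.2 ▸ hd)]

/-- Without a common vertex, each vertex `x` is missed by some set `S x`, which lies entirely beyond
one edge from `x` to `f x`. There are more vertices than edges, so two vertices `x ≠ y` choose the
same edge. Then `S x` and `S y` lie on different sides of a bridge, yet they intersect. -/
theorem hasHellyProperty_of_subtrees [Finite V] (hT : T.IsTree) {F : Set (Set V)}
    (hF : ∀ S ∈ F, (T.induce S).Connected) : HasHellyProperty F := by
  classical
  intro F' hF' pw
  by_contra hno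
  rw [Set.not_nonempty_iff_eq_empty, Set.eq_empty_iff_forall_notMem] at hno
  simp only [Set.mem_sInter, not_forall] at hno
  have key : ∀ x, ∃ y, ∃ S ∈ F', T.Adj x y ∧ ∀ a ∈ S, (T.deleteEdges {s(x, y)}).Reachable y a := by
    intro x
    obtain ⟨S, hS, hx⟩ := hno x
    obtain ⟨⟨s, hs⟩⟩ := (hF S (hF' hS)).nonempty
    obtain ⟨p⟩ := hT.connected.preconnected x s
    obtain ⟨p, hp⟩ := p.toPath
    cases p with
    | nil => exact absurd hs hx
    | @cons _ y _ h q =>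
      refine ⟨y, S, hS, h, fun a ha => .trans ?_
        (reachable_of_induce_connected (hF S (hF' hS)) hx hs ha)⟩
      rw [SimpleGraph.Walk.cons_isPath_iff] at hp
      exact SimpleGraph.reachable_deleteEdges_iff_exists_walk.2
        ⟨q, fun h => hp.2 (q.fst_mem_support_of_mem_edges h)⟩
  choose f S hS hadj hreach using key
  have := Fintype.ofFinite V
  have hlt : T.edgeFinset.card < (Finset.univ : Finset V).card := by
    rw [Finset.card_univ, ← hT.card_edgeFinset]; exact Nat.lt_succ_self _
  obtain ⟨x, -, y, -, hne, heq⟩ := Finset.exists_ne_map_eq_of_card_lt_of_maps_to hlt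
    (f := fun x => s(x, f x)) (fun x _ => by simpa using hadj x)
  have hxy : f x = y ∧ f y = x := by
    rcases Sym2.eq_iff.1 heq with h | h
    · exact absurd h.1 hne
    · exact ⟨h.2, h.1.symm⟩
  obtain ⟨z, hzx, hzy⟩ := pw _ (hS x) _ (hS y)
  have h1 := hreach x z hzx
  have h2 := hreach y z hzy
  rw [hxy.1] at h1
  rw [hxy.2, Sym2.eq_swap] at h2
  have hb := SimpleGraph.isAcyclic_iff_forall_adj_isBridge.1 hT.isAcyclic (hxy.1 ▸ hadj x)
  exact SimpleGraph.isBridge_iff.1 hb (h2.trans h1.symm)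

end Subtrees

/-! ### Walk-Helly digraphs and tree representations -/

section WalkHelly

variable {V : Type*} [Finite V] {R : Digraph V}

theorem isUnionClosed_closedWalkSets : IsUnionClosed (closedWalkSets R) := by
  rw [closedWalkSets_eq]
  exact fun A hA B hB h => hA.union hB h

theorem singleton_mem_closedWalkSets (v : V) : {v} ∈ closedWalkSets R :=
  mem_closedWalkSets_iff.2 (.singleton R v)

theorem isWalkHelly_iff_exists_isTreeRepresentation [Nonempty V] :
    IsWalkHelly R ↔ ∃ T : SimpleGraph V, IsTreeRepresentation R T := by
  constructor
  · intro h
    obtain ⟨T, hT, h⟩ := exists_tree_of_helly isUnionClosed_closedWalkSets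
      singleton_mem_closedWalkSets h
    exact ⟨T, hT, fun S hS => h S hS (mem_closedWalkSets_iff.1 hS).1⟩
  · rintro ⟨T, hT, h⟩
    exact hasHellyProperty_of_subtrees hT h

theorem pairAuthorized_closedWalkSets {u v : V} (huv : u ≠ v) :
    PairAuthorized (closedWalkSets R) u v ↔ IsAuthorized R u v := by
  simp only [PairAuthorized, IsAuthorized, closedWalkAvoiding_iff_exists, closedWalkSets_eq,
    Set.mem_ofPred_eq, huv, ne_eq, not_false_eq_true, true_and]

theorem pairGraph_closedWalkSets : pairGraph (closedWalkSets R) = forcedGraph R := by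
  ext u v
  simp only [pairGraph, forcedGraph, Digraph.toSimpleGraphStrict, closedWalkSets_eq,
    Set.mem_ofPred_eq]
  exact and_congr_right fun h => stronglyConnectedOn_pair h

/-- The two-element closed walk sets are the forced edges. Authorization is symmetric, so closure
under authorized arcs makes every authorized pair such a set, and no extension of the family is
needed. -/
theorem forcedGraph_isTreeRepresentation [Nonempty V] (hR : IsWalkHelly R)
    (closed : ∀ u v, IsAuthorized R u v → R.Adj u v) :
    IsTreeRepresentation R (forcedGraph R) := by
  obtain ⟨h1, h2⟩ := pairGraph_isTree_of_closed isUnionClosed_closedWalkSets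
    (singleton_mem_closedWalkSets (R := R)) hR fun u v huv h => by
      rw [pairAuthorized_closedWalkSets huv] at h
      rw [closedWalkSets_eq]
      exact (stronglyConnectedOn_pair huv).2 ⟨closed u v h, closed v u h.symm⟩
  rw [pairGraph_closedWalkSets] at h1 h2
  exact ⟨h1, fun S hS => h2 S hS (mem_closedWalkSets_iff.1 hS).1⟩

end WalkHelly

end CRS

namespace CRS

/-! ### Adding authorized arcs keeps a strongly connected digraph walk-Helly -/

section GreedyStep

variable {V : Type*} {R : Digraph V} {F₁ F₂ : Set (Set V)} {X S : Set V} {a b c u v x y : V}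

theorem ReachIn.exists_last_step (h : ReachIn R X a b) (hne : a ≠ b) :
    ∃ c ∈ X \ {b}, ReachIn R (X \ {b}) a c ∧ R.Adj c b := by
  induction h using Relation.ReflTransGen.head_induction_on with
  | refl => exact absurd rfl hne
  | @head x y hxy _ ih =>
    have hx : x ∈ X \ {b} := ⟨hxy.2.1, hne⟩
    by_cases hyb : y = b
    · subst hyb; exact ⟨x, hx, .refl, hxy.1⟩
    · obtain ⟨c, hc, h1, h2⟩ := ih hyb
      exact ⟨c, hc, .head ⟨hxy.1, hx, hxy.2.2, hyb⟩ h1, h2⟩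

theorem ReachIn.exists_first_step (h : ReachIn R X a b) (hne : a ≠ b) :
    ∃ c ∈ X \ {a}, R.Adj a c ∧ ReachIn R (X \ {a}) c b := by
  induction h with
  | refl => exact absurd rfl hne
  | @tail x y _ hxy ih =>
    have hy : y ∈ X \ {a} := ⟨hxy.2.2, hne.symm⟩
    by_cases hxa : a = x
    · subst hxa; exact ⟨y, hy, hxy.1, .refl⟩
    · obtain ⟨c, hc, h1, h2⟩ := ih hxa
      exact ⟨c, hc, h1, h2.tail ⟨hxy.1, ⟨hxy.2.1, Ne.symm hxa⟩, hy⟩⟩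

/-- The vertex set of a path from `a` to `b`. -/
theorem ReachIn.exists_path [Finite V] (h : ReachIn R Set.univ a b) :
    ∃ P : Set V, a ∈ P ∧ b ∈ P ∧ (∀ z ∈ P, ReachIn R P a z ∧ ReachIn R P z b) ∧
      ∀ z ∈ P, z ≠ a → z ≠ b → ReachIn R {b}ᶜ a z ∧ ReachIn R {a}ᶜ z b := by
  -- An inclusion-minimal set in which `b` can be reached from `a` serves as the path: deleting any
  -- inner vertex destroys all such walks.
  obtain ⟨P, -, ⟨ha, hb, hP⟩, hmin⟩ := Set.Finite.exists_le_minimal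
    (s := {P : Set V | a ∈ P ∧ b ∈ P ∧ ReachIn R P a b}) (Set.toFinite _) ⟨Set.mem_univ a, Set.mem_univ b, h⟩
  have hdel : ∀ z ∈ P, z ≠ a → z ≠ b → ¬ ReachIn R (P \ {z}) a b := fun z hz hza hzb h =>
    (hmin (y := P \ {z}) ⟨⟨ha, hza.symm⟩, ⟨hb, hzb.symm⟩, h⟩ Set.sdiff_subset hz).2 rfl
  refine ⟨P, ha, hb, fun z hz => ?_, fun z hz hza hzb => ?_⟩
  · by_cases hza : z = a
    · subst hza; exact ⟨.refl, hP⟩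
    by_cases hzb : z = b
    · subst hzb; exact ⟨hP, .refl⟩
    exact (hP.avoid_or z).resolve_left (hdel z hz hza hzb)
  · have hab : a ≠ b := by
      rintro rfl
      exact hdel z hz hza hzb .refl
    constructor
    · obtain ⟨c, hc, h1, h2⟩ := hP.exists_last_step hab
      rcases h1.avoid_or z with h | h
      · have hc' := h.mem_right ⟨⟨ha, hab⟩, hza.symm⟩
        exact absurd ((h.mono (Set.sdiff_subset_sdiff_left Set.sdiff_subset)).tail
          ⟨h2, ⟨hc.1, hc'.2⟩, hb, Ne.symm hzb⟩) (hdel z hz hza hzb)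
      · exact h.1.mono fun x hx => hx.2
    · obtain ⟨c, hc, h1, h2⟩ := hP.exists_first_step hab
      rcases h2.avoid_or z with h | h
      · have hc' := h.mem_left ⟨⟨hb, hab.symm⟩, Ne.symm hzb⟩
        exact absurd (Relation.ReflTransGen.head ⟨h1, ⟨ha, hza.symm⟩, hc.1, hc'.2⟩
          (h.mono (Set.sdiff_subset_sdiff_left Set.sdiff_subset))) (hdel z hz hza hzb)
      · exact h.2.mono fun x hx => hx.2

/-- Every vertex of `S` lies, in `R[S]`, on a walk between the terminals `u` and `v`, but `u` and
`v` are not in the same component. -/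
structure IsSplit (R : Digraph V) (u v : V) (S : Set V) : Prop where
  left : u ∈ S
  right : v ∈ S
  source : ∀ x ∈ S, ReachIn R S u x ∨ ReachIn R S v x
  target : ∀ x ∈ S, ReachIn R S x u ∨ ReachIn R S x v
  not_both : ¬ (ReachIn R S u v ∧ ReachIn R S v u)

theorem IsSplit.symm (h : IsSplit R u v S) : IsSplit R v u S :=
  ⟨h.right, h.left, fun x hx => (h.source x hx).symm, fun x hx => (h.target x hx).symm,
    fun k => h.not_both k.symm⟩

/-- Such a set must contain both ends of the new arcs. The part of a walk after its last new arc, or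
before its first one, uses old arcs only and starts or ends at a terminal. Old walks in both
directions between the terminals would make `S` strongly connected in `R`. -/
theorem isSplit_of_addArcs (h : StronglyConnectedOn (addArcs R u v) S)
    (hS : ¬ StronglyConnectedOn R S) : IsSplit R u v S := by
  have huv : u ∈ S ∧ v ∈ S := by
    by_contra hno
    refine hS ⟨h.1, fun a ha b hb => ?_⟩
    refine Relation.ReflTransGen.mono (fun x y hxy => ?_) _ _ (h.2 a ha b hb)
    obtain ⟨h1 | ⟨rfl, rfl⟩ | ⟨rfl, rfl⟩, h2, h3⟩ := hxy
    exacts [⟨h1, h2, h3⟩, absurd ⟨h2, h3⟩ hno, absurd ⟨h3, h2⟩ hno]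
  obtain ⟨hu, hv⟩ := huv
  have source : ∀ x ∈ S, ReachIn R S u x ∨ ReachIn R S v x := by
    intro x hx
    have := h.2 u hu x hx
    clear hx
    induction this with
    | refl => exact .inl .refl
    | tail _ hyz ih =>
      obtain ⟨h1 | ⟨rfl, rfl⟩ | ⟨rfl, rfl⟩, h2, h3⟩ := hyz
      · exact ih.imp (·.tail ⟨h1, h2, h3⟩) (·.tail ⟨h1, h2, h3⟩)
      · exact .inr .refl
      · exact .inl .refl
  have target : ∀ x ∈ S, ReachIn R S x u ∨ ReachIn R S x v := by
    intro x hx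
    have := h.2 x hx u hu
    clear hx
    induction this using Relation.ReflTransGen.head_induction_on with
    | refl => exact .inl .refl
    | head hyz _ ih =>
      obtain ⟨h1 | ⟨rfl, rfl⟩ | ⟨rfl, rfl⟩, h2, h3⟩ := hyz
      · exact ih.imp (.head ⟨h1, h2, h3⟩) (.head ⟨h1, h2, h3⟩)
      · exact .inl .refl
      · exact .inr .refl
  refine ⟨hu, hv, source, target, fun ⟨h1, h2⟩ => hS (stronglyConnectedOn_of_center u hu ?_ ?_)⟩
  · exact fun x hx => (source x hx).elim id h1.trans
  · exact fun x hx => (target x hx).elim id fun h => h.trans h2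

/-- A pair of walks from `u` to `y` without `v` and from `y` to `v` without `u`. -/
def Between (R : Digraph V) (u v y : V) : Prop :=
  ReachIn R {v}ᶜ u y ∧ ReachIn R {u}ᶜ y v

/-- The four walks combine to a closed walk through `u` and `y` without `v` and one through `v` and
`y` without `u`. -/
theorem IsAuthorized.not_between [Finite V] (auth : IsAuthorized R u v) :
    ¬ (Between R u v y ∧ Between R v u y) := by
  rintro ⟨⟨h1, h2⟩, h3, h4⟩
  exact auth.2 y ⟨(closedWalkAvoiding_iff auth.1).2 ⟨h1, h4⟩,
    (closedWalkAvoiding_iff auth.1.symm).2 ⟨h3, h2⟩⟩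

/-- Let `B` in `F₁` miss the component of `v` in `S`, and let `b ∈ B ∩ S`. Then `b` is not reachable
from `v` in `S`: it would lead on to `u`, or back to `v` and thus lie in that component. So `u`
reaches `b` without `v`, and inside `B`, which does not contain `v`, the walk goes on to `y`. The
walk from `y` to `v` is found in the same way from a set that misses the component of `u`. -/
theorem IsSplit.between (hS : IsSplit R u v S) (h₁ : F₁ ⊆ {S | StronglyConnectedOn R S})
    (pw : MeetsAll F₁ S) (hu : ¬ MeetsAll F₁ (component R S u))
    (hv : ¬ MeetsAll F₁ (component R S v)) (hvu : ¬ ReachIn R S v u)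
    (hy : ∀ A ∈ F₁, y ∈ A) : Between R u v y := by
  simp only [MeetsAll, not_forall] at hu hv
  obtain ⟨A, hA, hAu⟩ := hu
  obtain ⟨B, hB, hBv⟩ := hv
  constructor
  · obtain ⟨b, hb, hbS⟩ := pw B hB
    have hvB : B ⊆ {v}ᶜ := by
      rintro x hx rfl
      exact hBv ⟨x, hx, mem_component_self⟩
    have nvb : ¬ ReachIn R S v b := fun h =>
      (hS.target b hbS).elim (fun k => hvu (h.trans k)) fun k => hBv ⟨b, hb, h, k⟩
    have hub := (hS.source b hbS).resolve_right nvb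
    have hub' := (hub.avoid_or v).resolve_right fun h => nvb h.2
    exact (hub'.mono fun x hx => hx.2).trans (((h₁ hB).2 b hb y (hy B hB)).mono hvB)
  · obtain ⟨a, ha, haS⟩ := pw A hA
    have huA : A ⊆ {u}ᶜ := by
      rintro x hx rfl
      exact hAu ⟨x, hx, mem_component_self⟩
    have nau : ¬ ReachIn R S a u := fun h =>
      (hS.source a haS).elim (fun k => hAu ⟨a, ha, k, h⟩) fun k => hvu (k.trans h)
    have hav := (hS.target a haS).resolve_left nau
    have hav' := (hav.avoid_or u).resolve_right fun h => nau h.1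
    exact (((h₁ hA).2 y (hy A hA) a ha).mono huA).trans (hav'.mono fun x hx => hx.2)

/-- If all split sets without a good component contain walks from `u` to `v`, one fixed path `P`
from `v` back to `u` makes each of them strongly connected, and `S ∪ P` serves as the enlargement.
The common vertex cannot lie on `P` outside `S`: it would be between `v` and `u` along `P` and
between `u` and `v` by `IsSplit.between`, against authorization. -/
theorem exists_common_of_oriented [Finite V] (hR : IsWalkHelly R) (hs : IsStronglyConnected R)
    (auth : IsAuthorized R u v) (h₁ : F₁ ⊆ {S | StronglyConnectedOn R S})
    (pw : ∀ S ∈ F₁, ∀ S' ∈ F₁, (S ∩ S').Nonempty) (pw' : ∀ S ∈ F₂, MeetsAll F₁ S)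
    (hF₂ : ∀ S ∈ F₂, IsSplit R u v S)
    (hor : ∀ S ∈ F₂, ¬ MeetsAll F₁ (component R S u) → ¬ MeetsAll F₁ (component R S v) →
      ReachIn R S u v) :
    ∃ y, (∀ A ∈ F₁, y ∈ A) ∧ ∀ S ∈ F₂, y ∈ S := by
  obtain ⟨P, hvP, huP, hP, hP'⟩ := (reachIn_univ.2 (hs v u)).exists_path
  obtain ⟨y, hy, hy'⟩ := exists_common_of_pairAuthorized (H := closedWalkSets R)
    isUnionClosed_closedWalkSets hR ((pairAuthorized_closedWalkSets auth.1).2 auth)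
    (closedWalkSets_eq (R := R) ▸ h₁) pw pw' (fun S => component R S u)
    (fun S => component R S v) (fun S => S ∪ P)
    (fun S hS => ⟨mem_closedWalkSets_iff.2 stronglyConnectedOn_component,
      component_subset (hF₂ S hS).left, mem_component_self, fun h => (hF₂ S hS).not_both h⟩)
    (fun S hS => ⟨mem_closedWalkSets_iff.2 stronglyConnectedOn_component,
      component_subset (hF₂ S hS).right, mem_component_self, fun h => (hF₂ S hS).not_both h.symm⟩)
    (fun S hS hu hv => by
      refine ⟨mem_closedWalkSets_iff.2 (stronglyConnectedOn_of_center u (.inl (hF₂ S hS).left)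
        ?_ ?_), Set.subset_union_left⟩
      all_goals
        have huv := (hor S hS hu hv).mono (Set.subset_union_left (t := P))
        have hvu := (hP v hvP).2.mono (Set.subset_union_right (s := S))
        rintro x (hx | hx)
      · rcases (hF₂ S hS).source x hx with h | h
        · exact h.mono Set.subset_union_left
        · exact huv.trans (h.mono Set.subset_union_left)
      · exact huv.trans ((hP x hx).1.mono Set.subset_union_right)
      · rcases (hF₂ S hS).target x hx with h | h
        · exact h.mono Set.subset_union_left
        · exact (h.mono Set.subset_union_left).trans hvu
      · exact (hP x hx).2.mono Set.subset_union_right)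
  refine ⟨y, hy, fun S hS => ?_⟩
  rcases hy' S hS with h | ⟨hu, hv, h | h⟩
  · exact h
  · exact h
  · exfalso
    have hb := (hF₂ S hS).between h₁ (pw' S hS) hu hv
      (fun h => (hF₂ S hS).not_both ⟨hor S hS hu hv, h⟩) hy
    simp only [MeetsAll, not_forall] at hu hv
    obtain ⟨A, hA, hAu⟩ := hu
    obtain ⟨B, hB, hBv⟩ := hv
    have hyu : y ≠ u := by rintro rfl; exact hAu ⟨y, hy A hA, mem_component_self⟩
    have hyv : y ≠ v := by rintro rfl; exact hBv ⟨y, hy B hB, mem_component_self⟩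
    exact auth.not_between ⟨hb, hP' y h hyv hyu⟩

/-- The split sets without a good component can all be oriented alike. If one has no walk from `u`
to `v` and another has none from `v` to `u`, a vertex common to `F₁` is between the terminals in
both directions, which authorization forbids. So `exists_common_of_oriented` applies to `u, v` or to
`v, u`. -/
theorem IsWalkHelly.addArcs [Finite V] (hR : IsWalkHelly R) (hs : IsStronglyConnected R)
    (auth : IsAuthorized R u v) : IsWalkHelly (addArcs R u v) := by
  intro F hF pw
  rw [closedWalkSets_eq] at hF
  set F₁ := F ∩ {S | StronglyConnectedOn R S} with hF₁
  set F₂ := F \ {S | StronglyConnectedOn R S} with hF₂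
  have h₁ : F₁ ⊆ {S | StronglyConnectedOn R S} := Set.inter_subset_right
  have pw₁ : ∀ S ∈ F₁, ∀ S' ∈ F₁, (S ∩ S').Nonempty := fun S hS S' hS' => pw S hS.1 S' hS'.1
  have pw₂ : ∀ S ∈ F₂, MeetsAll F₁ S := fun S hS A hA => pw A hA.1 S hS.1
  have split : ∀ S ∈ F₂, IsSplit R u v S := fun S hS => isSplit_of_addArcs (hF hS.1) hS.2
  suffices ∃ y, (∀ A ∈ F₁, y ∈ A) ∧ ∀ S ∈ F₂, y ∈ S by
    obtain ⟨y, h1, h2⟩ := this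
    refine ⟨y, fun S hS => ?_⟩
    by_cases h : StronglyConnectedOn R S
    exacts [h1 S ⟨hS, h⟩, h2 S ⟨hS, h⟩]
  by_cases hor : ∀ S ∈ F₂, ¬ MeetsAll F₁ (component R S u) → ¬ MeetsAll F₁ (component R S v) →
      ReachIn R S u v
  · exact exists_common_of_oriented hR hs auth h₁ pw₁ pw₂ split hor
  · push Not at hor
    obtain ⟨S, hS, hu, hv, huv⟩ := hor
    obtain ⟨z, hz⟩ := hR F₁ (closedWalkSets_eq (R := R) ▸ h₁) pw₁
    have hz₂ : Between R v u z := (split S hS).symm.between h₁ (pw₂ S hS) hv hu huv hz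
    refine exists_common_of_oriented hR hs auth.symm h₁ pw₁ pw₂ (fun S hS => (split S hS).symm)
      fun S' hS' hv' hu' => ?_
    by_contra hvu
    exact auth.not_between ⟨(split S' hS').between h₁ (pw₂ S' hS') hu' hv' hvu hz, hz₂⟩

theorem le_of_greedySteps {R R' : Digraph V} (h : Relation.ReflTransGen GreedyStep R R') :
    ∀ a b, R.Adj a b → R'.Adj a b := by
  induction h with
  | refl => exact fun _ _ h => h
  | tail _ h ih =>
    obtain ⟨u, v, -, -, rfl⟩ := h
    exact fun a b hab => .inl (ih a b hab)

theorem IsStronglyConnected.mono {R R' : Digraph V} (hs : IsStronglyConnected R)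
    (h : ∀ a b, R.Adj a b → R'.Adj a b) : IsStronglyConnected R' :=
  fun s t => Relation.ReflTransGen.mono h _ _ (hs s t)

theorem IsWalkHelly.greedySteps [Finite V] {R R' : Digraph V} (hR : IsWalkHelly R)
    (hs : IsStronglyConnected R) (h : Relation.ReflTransGen GreedyStep R R') : IsWalkHelly R' := by
  induction h with
  | refl => exact hR
  | tail h' h ih =>
    obtain ⟨u, v, auth, -, rfl⟩ := h
    exact ih.addArcs (hs.mono (le_of_greedySteps h')) auth

/-- Every digraph has a greedy closure. -/
theorem exists_greedySteps_closed [Finite V] (R : Digraph V) :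
    ∃ R', Relation.ReflTransGen GreedyStep R R' ∧ ∀ u v, IsAuthorized R' u v → R'.Adj u v := by
  have : Finite (Digraph V) := Finite.of_injective _ Digraph.adj_injective
  obtain ⟨R', -, h, hmax⟩ := Set.Finite.exists_le_maximal
    (s := {R' : Digraph V | Relation.ReflTransGen GreedyStep R R'}) (Set.toFinite _) .refl
  refine ⟨R', h, fun u v auth => ?_⟩
  by_contra hno
  exact hno (hmax (y := CRS.addArcs R' u v) (h.tail ⟨u, v, auth, hno, rfl⟩)
    (fun _ _ hab => Or.inl hab) (Or.inr (.inl ⟨rfl, rfl⟩) : (CRS.addArcs R' u v).Adj u v))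

end GreedyStep

end CRS

namespace CRS

/-! ### Branches, paths and potentials on trees -/

section Trees

variable {V : Type*} {T : SimpleGraph V} {X S : Set V} {a b w w' x : V}

theorem ReachIn.exists_graph_walk (h : ReachIn ⟨T.Adj⟩ X a b) (ha : a ∈ X) :
    ∃ p : T.Walk a b, ∀ z ∈ p.support, z ∈ X := by
  induction h using Relation.ReflTransGen.head_induction_on with
  | refl => exact ⟨.nil, by simpa using ha⟩
  | head hxy _ ih =>
    obtain ⟨p, hp⟩ := ih hxy.2.2
    refine ⟨.cons hxy.1 p, fun z hz => ?_⟩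
    rcases List.mem_cons.1 (SimpleGraph.Walk.support_cons .. ▸ hz) with rfl | hz
    exacts [ha, hp z hz]

theorem reachIn_of_graph_walk (p : T.Walk a b) (hp : ∀ z ∈ p.support, z ∈ X) :
    ReachIn ⟨T.Adj⟩ X a b := by
  induction p with
  | nil => exact .refl
  | cons h p ih =>
    have := ih fun z hz => hp z (by simp [hz])
    exact .head ⟨h, hp _ (by simp), hp _ (by simp)⟩ this

theorem exists_adj_reachIn (hT : T.Connected) (hne : x ≠ a) :
    ∃ w, T.Adj x w ∧ ReachIn ⟨T.Adj⟩ {x}ᶜ w a := by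
  obtain ⟨p⟩ := hT.preconnected x a
  obtain ⟨w, -, h1, h2⟩ := (reachIn_of_graph_walk (X := Set.univ) p
    fun _ _ => trivial).exists_first_step hne
  exact ⟨w, h1, h2.mono fun y hy => hy.2⟩

/-- Two neighbours of `x` in the same branch would put the edge `xw` on a cycle, but in a forest
every edge is a bridge. -/
theorem eq_of_adj_of_reachIn (hT : T.IsAcyclic) (h : T.Adj x w) (h' : T.Adj x w')
    (hr : ReachIn ⟨T.Adj⟩ {x}ᶜ w w') : w = w' := by
  by_contra hne
  refine SimpleGraph.isBridge_iff.1 (SimpleGraph.isAcyclic_iff_forall_adj_isBridge.1 hT h) ?_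
  obtain ⟨p, hp⟩ := hr.reverse_graph.exists_graph_walk h'.ne.symm
  have h1 : (T.deleteEdges {s(x, w)}).Adj x w' := by
    rw [SimpleGraph.deleteEdges_adj]
    refine ⟨h', fun h => ?_⟩
    rcases Sym2.eq_iff.1 (Set.mem_singleton_iff.1 h) with h | h
    exacts [hne h.2.symm, h'.ne h.2.symm]
  refine h1.reachable.trans (SimpleGraph.reachable_deleteEdges_iff_exists_walk.2 ⟨p, fun he => ?_⟩)
  exact hp x (p.fst_mem_support_of_mem_edges he) rfl

/-- A walk from `a` to `b` without `x` contains the unique path, so no vertex outside `S` lies on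
that path. -/
theorem reachIn_of_forall_compl (hT : T.IsTree)
    (h : ∀ x ∉ S, ReachIn ⟨T.Adj⟩ {x}ᶜ a b) (ha : a ∈ S) : ReachIn ⟨T.Adj⟩ S a b := by
  classical
  obtain ⟨p, hp, huniq⟩ := hT.existsUnique_path a b
  refine reachIn_of_graph_walk p fun x hx => ?_
  by_contra hxS
  obtain ⟨q, hq⟩ := (h x hxS).exists_graph_walk (by rintro rfl; exact hxS ha)
  have := huniq _ q.toPath.2
  exact hq x (q.support_toPath_subset_support (this ▸ hx)) rfl

theorem reachIn_of_induce_connected (h : (T.induce S).Connected) (ha : a ∈ S) (hb : b ∈ S) :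
    ReachIn ⟨T.Adj⟩ S a b := by
  have := h.preconnected ⟨a, ha⟩ ⟨b, hb⟩
  rw [SimpleGraph.reachable_iff_reflTransGen] at this
  exact Relation.ReflTransGen.lift (p := fun a b => T.Adj a b ∧ a ∈ S ∧ b ∈ S) Subtype.val
    (fun c d hcd => ⟨by simpa using hcd, c.2, d.2⟩) _ _ this

/-- On a tree every antisymmetric weighting of the edges is the difference of a potential. -/
theorem exists_potential (hT : T.IsTree) (f : V → V → ℤ) (hf : ∀ x y, f y x = - f x y) :
    ∃ c : V → ℤ, ∀ x y, T.Adj x y → c y = c x + f x y := by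
  obtain ⟨r⟩ := hT.connected.nonempty
  choose p hp _ using hT.existsUnique_path r
  have key : ∀ x y (h : T.Adj x y), x ∈ (p y).support →
      ((p y).darts.map fun d => f d.fst d.snd).sum =
        ((p x).darts.map fun d => f d.fst d.snd).sum + f x y := by
    intro x y h hx
    rw [hT.isAcyclic.path_concat (hp x) (hp y) h hx]
    simp [SimpleGraph.Walk.darts_concat]
  refine ⟨fun v => ((p v).darts.map fun d => f d.fst d.snd).sum, fun x y h => ?_⟩
  -- Of two adjacent vertices, one lies on the path from the root to the other.
  by_cases hx : x ∈ (p y).support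
  · exact key x y h hx
  · have := key y x h.symm
      (hT.isAcyclic.mem_support_of_ne_mem_support_of_adj_of_isPath (hp x) (hp y) h hx)
    dsimp only
    rw [this, hf x y]; ring

/-- The integer potential for `f x y - f y x` is shifted to have minimum `0`. It changes by at most
`M` along an edge, and a path has fewer edges than there are vertices. The explicit bound later
allows the machine to compute with natural numbers only. -/
theorem exists_bounded_potential [Fintype V] (hT : T.IsTree) (f : V → V → ℕ) (M : ℕ)
    (hf : ∀ x y, f x y ≤ M) :
    ∃ c : V → ℕ, (∀ x, c x ≤ Fintype.card V * M) ∧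
      ∀ x y, T.Adj x y → c x + f x y = c y + f y x := by
  classical
  obtain ⟨c, hc⟩ := exists_potential hT (fun x y => (f x y : ℤ) - f y x) (by intros; ring)
  have := hT.connected.nonempty
  obtain ⟨r, -, hr⟩ := Finset.exists_min_image Finset.univ c Finset.univ_nonempty
  have step : ∀ x y, T.Adj x y → c y ≤ c x + M := fun x y h => by
    have := hc x y h
    have := hf x y
    omega
  have walk : ∀ x y (p : T.Walk x y), c y ≤ c x + p.length * M := by
    intro x y p
    induction p with
    | nil => simp
    | cons h p ih =>
      have := step _ _ h
      rw [SimpleGraph.Walk.length_cons]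
      push_cast
      linarith
  refine ⟨fun x => (c x - c r).toNat, fun x => ?_, fun x y h => ?_⟩
  · obtain ⟨p⟩ := hT.connected.preconnected r x
    have h1 := walk r x p.toPath
    have h2 : (p.toPath : T.Walk r x).length * M ≤ Fintype.card V * M :=
      Nat.mul_le_mul_right _ p.toPath.2.length_lt.le
    zify at h2
    have : ((c x - c r).toNat : ℤ) ≤ ((Fintype.card V * M : ℕ) : ℤ) := by
      rw [Int.toNat_of_nonneg (sub_nonneg.2 (hr x (Finset.mem_univ _)))]
      push_cast
      linarith
    exact_mod_cast this
  · have h1 := hr x (Finset.mem_univ _)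
    have h2 := hr y (Finset.mem_univ _)
    have h3 := hc x y h
    dsimp only
    omega

end Trees

/-! ### Footprints of tree solutions -/

section TreeSolutions

variable {V : Type*} {R : Digraph V} {G : TemporalGraph V} {u v w x : V} {t t' : ℕ}

theorem TemporalGraph.footprint_adj_of_mem (h : (s(u, v), t) ∈ G.edges) : G.footprint.Adj u v := by
  rw [TemporalGraph.footprint, SimpleGraph.fromEdgeSet_adj]
  exact ⟨⟨t, h⟩, fun huv => G.not_isDiag _ h (by simpa using huv)⟩

theorem TemporalGraph.edgeSet_footprint :
    G.footprint.edgeSet = Prod.fst '' (G.edges : Set (Sym2 V × ℕ)) := by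
  ext e
  rw [TemporalGraph.footprint, SimpleGraph.edgeSet_fromEdgeSet]
  constructor
  · rintro ⟨⟨t, h⟩, -⟩
    exact ⟨(e, t), h, rfl⟩
  · rintro ⟨⟨e, t⟩, h, rfl⟩
    exact ⟨⟨t, h⟩, G.not_isDiag _ h⟩

/-- The footprint, being a tree, has as many edges as there are temporal edges, so forgetting the
time is injective. -/
theorem IsTreeSolution.time_unique [Finite V] (hG : IsTreeSolution R G) {e : Sym2 V}
    (h : (e, t) ∈ G.edges) (h' : (e, t') ∈ G.edges) : t = t' := by
  obtain ⟨-, hcard, htree⟩ := hG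
  have h1 := (SimpleGraph.isTree_iff_connected_and_card.1 htree).2
  have h2 : (Prod.fst '' (G.edges : Set (Sym2 V × ℕ))).ncard = (G.edges : Set (Sym2 V × ℕ)).ncard := by
    rw [← TemporalGraph.edgeSet_footprint, Set.ncard_coe_finset, ← Nat.card_coe_set_eq]
    omega
  have h3 := Set.injOn_of_ncard_image_eq h2 (Set.toFinite _)
  exact congrArg Prod.snd (h3 h h' rfl)

/-- Here `g a` is the neighbour of `x` in the branch of `a`, and `lab` gives the times of the edges
at `x`. A journey that changes branches enters `x` by one of these edges and leaves it by a later
one. The second claim treats journeys that start at `x`; its inequality covers those that return to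
`x`. -/
theorem IsJourney.conn_or_lt [Finite V] (hG : IsTreeSolution R G) {g : V → V} {lab : V → ℕ}
    (hg : ∀ a, x ≠ a → G.footprint.Adj x (g a) ∧ ReachIn ⟨G.footprint.Adj⟩ {x}ᶜ (g a) a)
    (hlab : ∀ w, G.footprint.Adj x w → (s(x, w), lab w) ∈ G.edges)
    {l : List (V × V × ℕ)} (h : IsJourney G u v l) (hv : x ≠ v) :
    (x ≠ u → ReachIn ⟨G.footprint.Adj⟩ {x}ᶜ u v ∨ lab (g u) < lab (g v)) ∧
      (x = u → ∃ a ∈ l.head?, a.2.2 ≤ lab (g v)) := by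
  have hT := hG.2.2
  have eq_g : ∀ {a b}, x ≠ a → x ≠ b → ReachIn ⟨G.footprint.Adj⟩ {x}ᶜ a b → g a = g b :=
    fun ha hb h => eq_of_adj_of_reachIn hT.isAcyclic (hg _ ha).1 (hg _ hb).1
      (((hg _ ha).2.trans h).trans (hg _ hb).2.reverse_graph)
  have g_adj : ∀ {a}, G.footprint.Adj x a → g a = a := fun h =>
    eq_of_adj_of_reachIn hT.isAcyclic (hg _ h.ne).1 h (hg _ h.ne).2
  induction h with
  | nil u => exact ⟨fun _ => .inl .refl, fun h => absurd h hv⟩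
  | @cons u w v t l he _ hl ih =>
    have hadj := TemporalGraph.footprint_adj_of_mem he
    obtain ⟨ih1, ih2⟩ := ih hv
    constructor
    · intro hu
      by_cases hw : x = w
      · subst hw
        obtain ⟨a, ha, hat⟩ := ih2 rfl
        have hlt := hl a ha
        have : t = lab u := hG.time_unique he (Sym2.eq_swap ▸ hlab u hadj.symm)
        rw [g_adj hadj.symm, ← this]
        exact .inr (hlt.trans_le hat)
      · have huw : ReachIn ⟨G.footprint.Adj⟩ {x}ᶜ u w := .single hadj (Ne.symm hu) (Ne.symm hw)
        rw [eq_g hu hw huw]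
        exact (ih1 hw).imp huw.trans id
    · rintro rfl
      refine ⟨_, rfl, ?_⟩
      have : t = lab w := hG.time_unique he (hlab w hadj)
      have hw := hadj.ne
      rcases ih1 hw with h | h
      · rw [← eq_g hw hv h, g_adj hadj]; exact this.le
      · rw [g_adj hadj] at h
        exact this.le.trans h.le

/-- The footprint of a tree solution is a tree representation. -/
theorem IsTreeSolution.isTreeRepresentation [Finite V] (hG : IsTreeSolution R G) :
    IsTreeRepresentation R G.footprint := by
  have hT := hG.2.2
  refine ⟨hT, fun S hS => ?_⟩
  rw [mem_closedWalkSets_iff] at hS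
  refine induce_connected_of_reachIn hS.1 fun a ha b hb =>
    reachIn_of_forall_compl hT (fun x hx => ?_) ha
  have hne : ∀ {c}, c ∈ S → x ≠ c := by rintro c hc rfl; exact hx hc
  -- The value of `g` at `x` itself and the time of a non-edge are arbitrary defaults.
  have h1 : ∀ a, ∃ w, x ≠ a → G.footprint.Adj x w ∧ ReachIn ⟨G.footprint.Adj⟩ {x}ᶜ w a := by
    intro a
    by_cases h : x = a
    · exact ⟨a, fun h' => absurd h h'⟩
    · obtain ⟨w, hw⟩ := exists_adj_reachIn hT.connected h
      exact ⟨w, fun _ => hw⟩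
  have h2 : ∀ w, ∃ t, G.footprint.Adj x w → (s(x, w), t) ∈ G.edges := by
    intro w
    by_cases h : G.footprint.Adj x w
    · obtain ⟨⟨t, ht⟩, -⟩ := (SimpleGraph.fromEdgeSet_adj _).1 h
      exact ⟨t, fun _ => ht⟩
    · exact ⟨0, fun h' => absurd h' h⟩
  choose g hg using h1
  choose lab hlab using h2
  have eq_g : ∀ {a b}, x ≠ a → x ≠ b → ReachIn ⟨G.footprint.Adj⟩ {x}ᶜ a b → g a = g b :=
    fun ha hb h => eq_of_adj_of_reachIn hT.isAcyclic (hg _ ha).1 (hg _ hb).1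
      (((hg _ ha).2.trans h).trans (hg _ hb).2.reverse_graph)
  -- Along a walk of requests that avoids `x`, each change of branch strictly increases the time of
  -- the branch's edge at `x`. Going to `b` and back therefore cannot change it.
  have key : ∀ a ∈ S, ∀ b, ReachIn R S a b →
      ReachIn ⟨G.footprint.Adj⟩ {x}ᶜ a b ∨ lab (g a) < lab (g b) := by
    intro a ha b hab
    induction hab with
    | refl => exact .inl .refl
    | @tail y z hy hz ih =>
      obtain ⟨l, hl⟩ := hG.1 y z hz.1
      rcases (hl.conn_or_lt hG hg hlab (hne hz.2.2)).1 (hne hz.2.1) with h | h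
      · rcases ih with h' | h'
        · exact .inl (h'.trans h)
        · rw [eq_g (hne hz.2.1) (hne hz.2.2) h] at h'
          exact .inr h'
      · rcases ih with h' | h'
        · rw [← eq_g (hne ha) (hne hz.2.1) h'] at h
          exact .inr h
        · exact .inr (h'.trans h)
  rcases key a ha b (hS.2 a ha b hb) with h | h
  · exact h
  · rcases key b hb a (hS.2 b hb a ha) with h' | h'
    · exact h'.reverse_graph
    · exact absurd h h'.asymm

end TreeSolutions

end CRS

namespace CRS

/-! ### Labelling the tree of forced edges -/

section Labelisation

variable {V : Type*} [Finite V] {R : Digraph V} {T : SimpleGraph V} {L : V → V → ℕ} {u v x y z : V}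

open Classical in
/-- The temporal graph that gives each edge `{x, y}` of `T` the appearance time `L x y + 1`. -/
noncomputable def labelGraph (T : SimpleGraph V) (L : V → V → ℕ) : TemporalGraph V where
  edges := (Set.toFinite ((fun p : V × V => (s(p.1, p.2), L p.1 p.2 + 1)) ''
    {p | T.Adj p.1 p.2})).toFinset
  not_isDiag := by
    intro e he
    obtain ⟨p, hp, rfl⟩ := (Set.Finite.mem_toFinset _).1 he
    simpa using hp.ne
  time_pos := by
    intro e he
    obtain ⟨p, hp, rfl⟩ := (Set.Finite.mem_toFinset _).1 he
    exact Nat.succ_pos _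

theorem mem_labelGraph_edges {e : Sym2 V × ℕ} :
    e ∈ (labelGraph T L).edges ↔ ∃ x y, T.Adj x y ∧ (s(x, y), L x y + 1) = e := by
  simp only [labelGraph, Set.Finite.mem_toFinset, Set.mem_image, Prod.exists]
  rfl

theorem footprint_labelGraph : (labelGraph T L).footprint = T := by
  rw [TemporalGraph.footprint, ← SimpleGraph.fromEdgeSet_edgeSet T]
  congr 1
  ext e
  simp only [mem_labelGraph_edges, SimpleGraph.fromEdgeSet_edgeSet, Set.mem_ofPred_eq]
  constructor
  · rintro ⟨t, x, y, h, he⟩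
    rw [← (Prod.mk.inj he).1]
    exact h
  · induction e with
    | _ x y => exact fun h => ⟨_, x, y, h, rfl⟩

/-- Without symmetry an edge could receive two times; with it, temporal edges correspond to edges of
`T`. -/
theorem card_edges_labelGraph (hL : ∀ x y, T.Adj x y → L x y = L y x) :
    (labelGraph T L).edges.card = Nat.card T.edgeSet := by
  have h := TemporalGraph.edgeSet_footprint (G := labelGraph T L)
  rw [footprint_labelGraph] at h
  rw [Nat.card_coe_set_eq, h, Set.InjOn.ncard_image, Set.ncard_coe_finset]
  rintro e he e' he' heq
  obtain ⟨x, y, h, rfl⟩ := mem_labelGraph_edges.1 he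
  obtain ⟨x', y', h', rfl⟩ := mem_labelGraph_edges.1 he'
  rcases Sym2.eq_iff.1 heq with ⟨rfl, rfl⟩ | ⟨rfl, rfl⟩
  · rfl
  · exact Prod.ext heq (by simp [hL x y h])

/-- Along a path of `T` from `u` to `v` whose consecutive edges carry increasing labels there is
a journey. -/
theorem exists_journey_of_path
    (hL : ∀ x y z, T.Adj x y → T.Adj x z → y ≠ z → ReachIn R {x}ᶜ y z → L y x < L x z)
    (hTR : ∀ x y, T.Adj x y → R.Adj x y) (huv : R.Adj u v) (p : T.Walk x v) (hp : p.IsPath)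
    (hpre : ReachIn ⟨T.Adj⟩ {z | z ∉ p.support.tail} x u) :
    ∃ l, IsJourney (labelGraph T L) x v l ∧ ∀ e ∈ l.head?, x ≠ v ∧ e.2.2 = L x p.snd + 1 := by
  induction p with
  | nil => exact ⟨[], .nil _, by simp⟩
  | @cons a w v h q ih =>
    rw [SimpleGraph.Walk.cons_isPath_iff] at hp
    simp only [SimpleGraph.Walk.support_cons, List.tail_cons] at hpre
    have toR : ∀ {X : Set V} {b c}, ReachIn ⟨T.Adj⟩ X b c → ReachIn R X b c :=
      fun h => h.mono_digraph hTR
    -- The hypothesis `hpre` remembers the part of the path already traversed: the current vertex is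
    -- joined to `u` in the tree without the vertices still ahead.
    have hw : ReachIn ⟨T.Adj⟩ {z | z ∉ q.support.tail} w u := by
      refine .head ⟨h.symm, ?_, ?_⟩ (hpre.mono fun z hz hz' => hz (List.mem_of_mem_tail hz'))
      · have := hp.1.support_nodup
        rw [← SimpleGraph.Walk.cons_tail_support] at this
        exact (List.nodup_cons.1 this).1
      · exact fun h => hp.2 (List.mem_of_mem_tail h)
    obtain ⟨l, hl, hl'⟩ := ih huv hp.1 hw
    refine ⟨(a, w, L a w + 1) :: l, .cons (mem_labelGraph_edges.2 ⟨a, w, h, rfl⟩) hl ?_, ?_⟩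
    · intro e he
      obtain ⟨hwv, he⟩ := hl' e he
      rw [he]
      cases q with
      | nil => exact absurd rfl hwv
      | @cons _ z _ h' q =>
        rw [SimpleGraph.Walk.cons_isPath_iff] at hp
        simp only [SimpleGraph.Walk.support_cons, List.mem_cons, not_or] at hp hpre
        have haz : a ≠ z := by rintro rfl; exact hp.2.2 q.start_mem_support
        -- The neighbours `a` and `z` of `w` are joined in `R` without `w`: back along the tree to
        -- `u`, by the request to `v`, and back along the tree to `z`.
        have h1 : ReachIn R {w}ᶜ a u := toR (hpre.mono fun x hx => hx.1)
        have h2 : ReachIn R {w}ᶜ z v := toR (reachIn_of_graph_walk q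
          (by rintro x hx rfl; exact hp.1.2 hx))
        have h3 : ReachIn R {w}ᶜ v z := toR (reachIn_of_graph_walk q
          (by rintro x hx rfl; exact hp.1.2 hx)).reverse_graph
        rw [SimpleGraph.Walk.snd_cons]
        exact Nat.succ_lt_succ (hL w a z h.symm h' haz
          ((h1.tail ⟨huv, h1.mem_right h.ne, Ne.symm hwv⟩).trans h3))
    · rintro e he
      obtain rfl : (a, w, L a w + 1) = e := by simpa using he
      refine ⟨?_, by simp⟩
      rintro rfl
      exact hp.2 q.end_mem_support

/-- A labelling of the forced tree that is symmetric and increases along the requests. -/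
theorem isLabelisation_labelGraph (hT : (forcedGraph R).IsTree)
    (hsymm : ∀ x y, (forcedGraph R).Adj x y → L x y = L y x)
    (hL : ∀ x y z, (forcedGraph R).Adj x y → (forcedGraph R).Adj x z → y ≠ z →
      ReachIn R {x}ᶜ y z → L x y < L x z) :
    IsLabelisation R (labelGraph (forcedGraph R) L) := by
  refine ⟨⟨fun u v huv => ?_, ?_, ?_⟩, footprint_labelGraph⟩
  · obtain ⟨p, hp, -⟩ := hT.existsUnique_path u v
    obtain ⟨l, hl, -⟩ := exists_journey_of_path (R := R) (T := forcedGraph R) (L := L)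
      (fun x y z h1 h2 h3 h4 => hsymm x y h1 ▸ hL x y z h1 h2 h3 h4) (fun x y h => h.2.1) huv p hp .refl
    exact ⟨l, hl⟩
  · rw [card_edges_labelGraph hsymm]
    exact (SimpleGraph.isTree_iff_connected_and_card.1 hT).2
  · rwa [footprint_labelGraph]

/-- No two forced neighbours of a vertex `x` can be reached from each other without `x`. -/
def IsLocallyAcyclic (R : Digraph V) : Prop :=
  ∀ x y z, (forcedGraph R).Adj x y → (forcedGraph R).Adj x z → y ≠ z →
    ¬ (ReachIn R {x}ᶜ y z ∧ ReachIn R {x}ᶜ z y)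

/-- Mutually reachable neighbours lie in one component of the digraph without `x`. This component is
connected in the tree and avoids `x`, so it contains only one neighbour of `x`. -/
theorem IsTreeRepresentation.isLocallyAcyclic (h : IsTreeRepresentation R (forcedGraph R)) :
    IsLocallyAcyclic R := by
  intro x y z hy hz hne hyz
  refine hne (eq_of_adj_of_reachIn h.1.isAcyclic hy hz ?_)
  have := h.2 _ (mem_closedWalkSets_iff.2 (stronglyConnectedOn_component (R := R) (X := {x}ᶜ)
    (a := y)))
  exact (reachIn_of_induce_connected this mem_component_self hyz).mono
    (component_subset hy.ne.symm)

/-- The number of forced neighbours of `x` from which `y` can be reached without `x`. -/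
noncomputable def rank (R : Digraph V) (x y : V) : ℕ :=
  {z | (forcedGraph R).Adj x z ∧ z ≠ y ∧ ReachIn R {x}ᶜ z y}.ncard

/-- By transitivity whatever counts for `y` counts for `z`, and `y` counts for `z` only. Local
acyclicity excludes that `z` itself counts for `y`. -/
theorem IsLocallyAcyclic.rank_lt (h : IsLocallyAcyclic R) (hy : (forcedGraph R).Adj x y)
    (hz : (forcedGraph R).Adj x z) (hne : y ≠ z) (hr : ReachIn R {x}ᶜ y z) :
    rank R x y < rank R x z := by
  have hsub : {w | (forcedGraph R).Adj x w ∧ w ≠ y ∧ ReachIn R {x}ᶜ w y} ⊆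
      {w | (forcedGraph R).Adj x w ∧ w ≠ z ∧ ReachIn R {x}ᶜ w z} := by
    rintro w ⟨hw1, hw2, hw3⟩
    refine ⟨hw1, ?_, hw3.trans hr⟩
    rintro rfl
    exact h x y w hy hz hne ⟨hr, hw3⟩
  exact Set.ncard_lt_ncard ((Set.ssubset_iff_of_subset hsub).2
    ⟨y, ⟨hy, hne, hr⟩, fun h => h.2.1 rfl⟩) (Set.toFinite _)

/-- Adding `c x` to all ranks at `x` preserves their order, and `hc` says that the two ends of an
edge then assign it the same label. -/
theorem IsLocallyAcyclic.isLabelisation (h : IsLocallyAcyclic R) (hT : (forcedGraph R).IsTree)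
    (c : V → ℕ) (hc : ∀ x y, (forcedGraph R).Adj x y → c x + rank R x y = c y + rank R y x) :
    IsLabelisation R (labelGraph (forcedGraph R) fun x y => c x + rank R x y) :=
  isLabelisation_labelGraph hT hc fun _ _ _ hy hz hne hr =>
    Nat.add_lt_add_left (h.rank_lt hy hz hne hr) _

theorem rank_le [Fintype V] : rank R x y ≤ Fintype.card V := by
  rw [← Nat.card_eq_fintype_card]
  exact (Set.ncard_le_card _)

/-- This reduces the existence of a labelling to reachability questions, which the program can
decide. -/
theorem exists_isLabelisation_iff (hT : (forcedGraph R).IsTree) :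
    (∃ G, IsLabelisation R G) ↔ IsLocallyAcyclic R := by
  constructor
  · rintro ⟨G, hG, hf⟩
    exact (hf ▸ hG.isTreeRepresentation).isLocallyAcyclic
  · intro h
    have := Fintype.ofFinite V
    obtain ⟨c, -, hc⟩ := exists_bounded_potential hT (rank R) _ fun x y => rank_le
    exact ⟨_, h.isLabelisation hT c hc⟩

end Labelisation

/-! ### Correctness of the greedy algorithm -/

section Main

variable {V : Type*} {R R' : Digraph V}

theorem IsTreeSolution.anti {G : TemporalGraph V} (hR : ∀ a b, R.Adj a b → R'.Adj a b)
    (hG : IsTreeSolution R' G) : IsTreeSolution R G :=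
  ⟨fun u v huv => hG.1 u v (hR u v huv), hG.2⟩

variable [Finite V] [Nonempty V]

theorem IsWalkHelly.exists_isLabelisation (hR : IsWalkHelly R)
    (closed : ∀ u v, IsAuthorized R u v → R.Adj u v) :
    (forcedGraph R).IsTree ∧ ∃ G, IsLabelisation R G := by
  have h := forcedGraph_isTreeRepresentation hR closed
  exact ⟨h.1, (exists_isLabelisation_iff h.1).2 h.isLocallyAcyclic⟩

theorem IsTreeSolution.isWalkHelly {G : TemporalGraph V} (hG : IsTreeSolution R G) :
    IsWalkHelly R :=
  isWalkHelly_iff_exists_isTreeRepresentation.2 ⟨_, hG.isTreeRepresentation⟩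

theorem IsWalkHelly.exists_isTreeSolution (hR : IsWalkHelly R) (hs : IsStronglyConnected R) :
    ∃ G, IsTreeSolution R G := by
  obtain ⟨R', h, closed⟩ := exists_greedySteps_closed R
  obtain ⟨-, G, hG⟩ := (hR.greedySteps hs h).exists_isLabelisation closed
  exact ⟨G, hG.1.anti (le_of_greedySteps h)⟩

/-- A solution of the closure also solves `R`, which has fewer requests. If `R` has any solution, it
is walk-Helly, hence so is every greedy closure, and the labelling succeeds. -/
theorem IsGreedyOutput.isCorrectAnswer (hs : IsStronglyConnected R) {out : Option (TemporalGraph V)}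
    (h : IsGreedyOutput R out) : IsCorrectAnswer R out := by
  obtain ⟨R', h, closed, hout⟩ := h
  cases out with
  | some G => exact hout.2.1.anti (le_of_greedySteps h)
  | none =>
    rintro ⟨G, hG⟩
    exact hout ((hG.isWalkHelly.greedySteps hs h).exists_isLabelisation closed)

end Main

end CRS

/-! ### A structured language and its memory layout -/

namespace CRS
namespace RAM

/-- Expressions of a language with loop variables, scalars, square arrays and the input matrix. -/
inductive HExpr
  | lit (c : ℕ)
  | size
  | var (k : ℕ)
  | sc (i : ℕ)
  | inp (k l : ℕ)
  | arr (j k l : ℕ)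
  | add (a b : HExpr)
  | sub (a b : HExpr)

/-- Programs of the language. `loop k p` runs `p` for all values `0, …, n - 1` of the loop variable
`k`; `emit k l e` appends a triple to the output, which holds at most `n` triples. -/
inductive HProg
  | setSc (i : ℕ) (e : HExpr)
  | setArr (j k l : ℕ) (e : HExpr)
  | emit (k l : ℕ) (e : HExpr)
  | seq (p q : HProg)
  | cond (c : HExpr) (p : HProg)
  | loop (k : ℕ) (p : HProg)

/-- The values of scalars and arrays, and the output. -/
structure State (n : ℕ) where
  /-- The scalars. -/
  sc : ℕ → ℕ
  /-- The arrays. -/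
  arr : ℕ → Fin n → Fin n → ℕ
  /-- The output. -/
  out : List (Fin n × Fin n × ℕ)

variable {n : ℕ}

/-- Applies `f 0`, …, `f (k - 1)` one after the other. -/
def iterFin {α : Type*} (f : Fin n → α → α) (a : α) : ℕ → α
  | 0 => a
  -- The `else` branch only makes the function total: loops run `n` passes.
  | k + 1 => if h : k < n then f ⟨k, h⟩ (iterFin f a k) else iterFin f a k

/-- The value of an expression. -/
def HExpr.eval (I : Fin n → Fin n → ℕ) (env : ℕ → Fin n) (σ : State n) : HExpr → ℕ
  | lit c => c
  | size => n
  | var k => env k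
  | sc i => σ.sc i
  | inp k l => I (env k) (env l)
  | arr j k l => σ.arr j (env k) (env l)
  | add a b => a.eval I env σ + b.eval I env σ
  | sub a b => a.eval I env σ - b.eval I env σ

/-- Writes an entry of an array. -/
def State.setArr (σ : State n) (j : ℕ) (x y : Fin n) (v : ℕ) : State n :=
  { σ with arr := fun j' x' y' => if j' = j ∧ x' = x ∧ y' = y then v else σ.arr j' x' y' }

/-- The state after the execution of a program. -/
def HProg.eval (I : Fin n → Fin n → ℕ) : HProg → (ℕ → Fin n) → State n → State n
  | setSc i e, env, σ => { σ with sc := Function.update σ.sc i (e.eval I env σ) }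
  | setArr j k l e, env, σ => σ.setArr j (env k) (env l) (e.eval I env σ)
  | emit k l e, env, σ =>
    if σ.out.length < n then { σ with out := σ.out ++ [(env k, env l, e.eval I env σ)] } else σ
  | seq p q, env, σ => q.eval I env (p.eval I env σ)
  | cond c p, env, σ => if c.eval I env σ ≠ 0 then p.eval I env σ else σ
  | loop k p, env, σ => iterFin (fun x => p.eval I (Function.update env k x)) σ n

/-- The number of loop variables and of scalars. -/
def numVars : ℕ := 16

/-- The live loop variables are `Γ`, and the input may be used if `b` holds. -/
def HExpr.wf (b : Bool) (Γ : List ℕ) : HExpr → Bool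
  | lit _ => true
  | size => true
  | var k => decide (k ∈ Γ)
  | sc i => decide (i < numVars)
  | inp k l => b && decide (k ∈ Γ) && decide (l ∈ Γ)
  | arr _ k l => decide (k ∈ Γ) && decide (l ∈ Γ)
  | add a b' => a.wf b Γ && b'.wf b Γ
  | sub a b' => a.wf b Γ && b'.wf b Γ

/-- Only live variables are used, and there is no output as long as the input may be used. -/
def HProg.wf (b : Bool) : List ℕ → HProg → Bool
  | Γ, setSc i e => decide (i < numVars) && e.wf b Γ
  | Γ, setArr _ k l e => decide (k ∈ Γ) && decide (l ∈ Γ) && e.wf b Γ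
  | Γ, emit k l e => !b && decide (k ∈ Γ) && decide (l ∈ Γ) && e.wf b Γ
  | Γ, seq p q => p.wf b Γ && q.wf b Γ
  | Γ, cond c p => c.wf b Γ && p.wf b Γ
  | Γ, loop k p => decide (k < numVars) && decide (k ∉ Γ) && p.wf b (k :: Γ)

/-- The registers of the compiled program: the array base, the output length, the loop variables
with their multiples by `n`, and the scalars. -/
inductive Reg
  | base
  | count
  | var (k : ℕ)
  | mul (k : ℕ)
  | sc (i : ℕ)

/-- The number of a register. -/
def Reg.idx : Reg → ℕ
  | base => 3
  | count => 4
  | var k => 5 + 3 * k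
  | mul k => 6 + 3 * k
  | sc i => 7 + 3 * i

/-- The registers `0, …, r - 1` lie below `arrayBase n` for `r = 8 + 3 * numVars`. -/
def arrayBase (n : ℕ) : ℕ := 1 + (8 + 3 * numVars + n) * (n + 1)

/-- The memory cells in use. -/
inductive Loc (n : ℕ)
  | zero
  | reg (r : Reg)
  | arr (j : ℕ) (x y : Fin n)
  | inp (x y : Fin n)
  | out (i : ℕ) (c : Fin 3)

/-- The address of a cell. Registers occupy diagonal entries of the input matrix. -/
def Loc.addr : Loc n → ℕ
  | zero => 0
  | reg r => 1 + r.idx * (n + 1)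
  | arr j x y => (j + 1) * arrayBase n + (n * x + y)
  | inp x y => 1 + (n * x + y)
  | out i c => 2 + 3 * i + c

/-- The content of a register. -/
def Reg.val (env : ℕ → Fin n) (σ : State n) : Reg → ℕ
  | base => arrayBase n
  | count => σ.out.length
  | var k => env k
  | mul k => n * env k
  | sc i => σ.sc i

/-- The content of a cell. -/
def Loc.val (I : Fin n → Fin n → ℕ) (env : ℕ → Fin n) (σ : State n) : Loc n → ℕ
  | zero => n
  | reg r => r.val env σ
  | arr j x y => σ.arr j x y
  | inp x y => I x y
  | out i c => match σ.out[i]?, c with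
    | none, _ => 0
    | some e, 0 => e.1
    | some e, 1 => e.2.1
    | some e, 2 => e.2.2

/-- The registers whose content is determined. -/
def Reg.Valid (Γ : List ℕ) : Reg → Prop
  | base => True
  | count => True
  | var k => k ∈ Γ ∧ k < numVars
  | mul k => k ∈ Γ ∧ k < numVars
  | sc i => i < numVars

/-- The cells whose content is determined. -/
def Loc.Valid (b : Bool) (Γ : List ℕ) (m : ℕ) : Loc n → Prop
  | zero => True
  | reg r => r.Valid Γ
  | arr _ _ _ => True
  | inp x y => b = true ∧ x ≠ y
  | out i _ => b = false ∧ i < m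

theorem Reg.Valid.idx_lt {Γ : List ℕ} {r : Reg} (h : r.Valid Γ) :
    3 ≤ r.idx ∧ r.idx < 8 + 3 * numVars := by
  cases r <;> simp only [Reg.Valid, Reg.idx] at h ⊢ <;> omega

theorem Reg.idx_injective : Function.Injective Reg.idx := by
  intro r r' h
  cases r <;> cases r' <;> simp only [Reg.idx] at h <;> first | rfl | omega | (congr 1; omega)

theorem reg_addr_lt {Γ : List ℕ} {r : Reg} (h : r.Valid Γ) :
    1 + r.idx * (n + 1) < arrayBase n := by
  have := h.idx_lt.2
  unfold arrayBase
  have : r.idx * (n + 1) < (8 + 3 * numVars + n) * (n + 1) :=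
    Nat.mul_lt_mul_of_pos_right (by omega) (Nat.succ_pos n)
  omega

theorem pair_lt (x y : Fin n) : n * x + y < n * n :=
  calc n * x + y < n * x + n := by have := y.2; omega
    _ = n * (x + 1) := by ring
    _ ≤ n * n := Nat.mul_le_mul_left _ x.2

/-- Input addresses are at most `n * n` and output addresses at most `3 * n + 1`, so the arrays
begin beyond both. -/
theorem sq_lt_arrayBase : n * n + 3 * n + 4 < arrayBase n := by
  unfold arrayBase numVars
  nlinarith

theorem pair_inj {x y x' y' : Fin n} (h : n * x + y = n * x' + y') : x = x' ∧ y = y' := by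
  have h1 : (n * x + y) / n = (n * x' + y') / n := by rw [h]
  have h2 : (n * x + y) % n = (n * x' + y') % n := by rw [h]
  have hn : 0 < n := x.pos
  rw [Nat.mul_add_div hn, Nat.mul_add_div hn, Nat.div_eq_of_lt y.2, Nat.div_eq_of_lt y'.2] at h1
  rw [Nat.mul_add_mod, Nat.mul_add_mod, Nat.mod_eq_of_lt y.2, Nat.mod_eq_of_lt y'.2] at h2
  exact ⟨Fin.ext (by omega), Fin.ext h2⟩

/-- Address `1 + r * (n + 1)` is the diagonal entry `(r, r)` if `r < n` and lies beyond the matrix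
otherwise. Registers therefore overwrite only the record of loops, which the program ignores. -/
theorem inp_ne_diag {x y : Fin n} (hxy : x ≠ y) (r : ℕ) : 1 + r * (n + 1) ≠ 1 + (n * x + y) := by
  intro h
  by_cases hr : r < n
  · have : n * (⟨r, hr⟩ : Fin n) + (⟨r, hr⟩ : Fin n) = n * x + y := by
      dsimp only
      linarith
    obtain ⟨h1, h2⟩ := pair_inj this
    exact hxy (h1.symm.trans h2)
  · have h1 := pair_lt x y
    have h2 : n * n ≤ r * (n + 1) := Nat.mul_le_mul (by omega) (by omega)
    omega

/-- Input and output cells share addresses, but `b` makes at most one of the two kinds valid.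
Register numbers start at `3`, which places the registers beyond the `3 * n + 2` cells reserved for
the answer. -/
theorem Loc.addr_injective {b : Bool} {Γ : List ℕ} {m : ℕ} (hm : m ≤ n) {ℓ ℓ' : Loc n}
    (h : ℓ.Valid b Γ m) (h' : ℓ'.Valid b Γ m) (heq : ℓ.addr = ℓ'.addr) : ℓ = ℓ' := by
  have hB := sq_lt_arrayBase (n := n)
  have arr_ge : ∀ j (x y : Fin n), arrayBase n ≤ (j + 1) * arrayBase n + (n * x + y) :=
    fun j x y => (Nat.le_mul_of_pos_left _ j.succ_pos).trans (Nat.le_add_right _ _)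
  have reg_out : ∀ r : Reg, r.Valid Γ → ∀ i < m, ∀ c : Fin 3, 1 + r.idx * (n + 1) ≠ 2 + 3 * i + c := by
    intro r hr i hi c
    have h1 := hr.idx_lt.1
    have h2 : 3 * (n + 1) ≤ r.idx * (n + 1) := Nat.mul_le_mul_right _ h1
    have := c.2
    omega
  cases ℓ with
  | zero => cases ℓ' with
    | zero => rfl
    | reg r => simp only [addr] at heq; omega
    | arr j x y => simp only [addr] at heq; have := arr_ge j x y; omega
    | inp x y => simp only [addr] at heq; omega
    | out i c => simp only [addr] at heq; omega
  | reg r => 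
    have hr := reg_addr_lt (n := n) h
    cases ℓ' with
    | zero => simp only [addr] at heq; omega
    | reg r' =>
      simp only [addr] at heq
      have := Nat.eq_of_mul_eq_mul_right (Nat.succ_pos n) (Nat.add_left_cancel heq)
      rw [Reg.idx_injective this]
    | arr j x y => simp only [addr] at heq; have := arr_ge j x y; omega
    | inp x y => exact absurd heq (inp_ne_diag h'.2 _)
    | out i c => exact absurd heq (reg_out r h i h'.2 c)
  | arr j x y =>
    have hj := arr_ge j x y
    have hp := pair_lt x y
    cases ℓ' with
    | zero => simp only [addr] at heq; omega
    | reg r => have := reg_addr_lt (n := n) h'; simp only [addr] at heq; omega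
    | arr j' x' y' =>
      have hp' := pair_lt x' y'
      simp only [addr] at heq
      have key : ∀ j j' p p' : ℕ, p < n * n → j < j' →
          (j + 1) * arrayBase n + p ≠ (j' + 1) * arrayBase n + p' := by
        intro j j' p p' hp hjj h
        have : (j + 2) * arrayBase n ≤ (j' + 1) * arrayBase n :=
          Nat.mul_le_mul_right _ (by omega)
        have h2 : (j + 2) * arrayBase n = (j + 1) * arrayBase n + arrayBase n := by ring
        omega
      rcases lt_trichotomy j j' with hjj | rfl | hjj
      · exact absurd heq (key _ _ _ _ hp hjj)
      · obtain ⟨rfl, rfl⟩ := pair_inj (Nat.add_left_cancel heq)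
        rfl
      · exact absurd heq.symm (key _ _ _ _ hp' hjj)
    | inp x' y' => have := pair_lt x' y'; simp only [addr] at heq; omega
    | out i c => have := h'.2; have := c.2; simp only [addr] at heq; omega
  | inp x y =>
    have hp := pair_lt x y
    cases ℓ' with
    | zero => simp only [addr] at heq; omega
    | reg r => exact absurd heq.symm (inp_ne_diag h.2 _)
    | arr j x' y' => have := arr_ge j x' y'; simp only [addr] at heq; omega
    | inp x' y' =>
      obtain ⟨rfl, rfl⟩ := pair_inj (Nat.add_left_cancel heq)
      rfl
    | out i c => exact absurd (h.1.symm.trans h'.1) (by decide)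
  | out i c =>
    have hi := h.2
    have hc := c.2
    cases ℓ' with
    | zero => simp only [addr] at heq; omega
    | reg r => exact absurd heq.symm (reg_out r h' i hi c)
    | arr j x y => have := arr_ge j x y; simp only [addr] at heq; omega
    | inp x y => exact absurd (h.1.symm.trans h'.1) (by decide)
    | out i' c' =>
      have := c'.2
      simp only [addr] at heq
      obtain rfl : i = i' := by omega
      obtain rfl : c = c' := Fin.ext (by omega)
      rfl

/-- The memory `M` represents the state `σ`. -/
structure Rep (I : Fin n → Fin n → ℕ) (b : Bool) (Γ : List ℕ) (env : ℕ → Fin n) (σ : State n)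
    (M : Mem) : Prop where
  length_le : σ.out.length ≤ n
  cell : ∀ ℓ : Loc n, ℓ.Valid b Γ σ.out.length → M ℓ.addr = ℓ.val I env σ

variable {I : Fin n → Fin n → ℕ} {b : Bool} {Γ : List ℕ} {env env' : ℕ → Fin n} {σ σ' : State n}
  {M : Mem}

/-- Writing one cell. -/
theorem Rep.update (h : Rep I b Γ env σ M) {Γ' : List ℕ} (hlen : σ'.out.length ≤ n) (ℓ : Loc n)
    (hℓ : ℓ.Valid b Γ' σ'.out.length) {v : ℕ} (hv : v = ℓ.val I env' σ')
    (hval : ∀ ℓ' : Loc n, ℓ'.Valid b Γ' σ'.out.length → ℓ' ≠ ℓ →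
      ℓ'.Valid b Γ σ.out.length ∧ ℓ'.val I env' σ' = ℓ'.val I env σ) :
    Rep I b Γ' env' σ' (Function.update M ℓ.addr v) := by
  refine ⟨hlen, fun ℓ' hℓ' => ?_⟩
  by_cases heq : ℓ' = ℓ
  · rw [heq, Function.update_self, hv]
  · rw [Function.update_of_ne fun ha => heq (Loc.addr_injective hlen hℓ' hℓ ha)]
    obtain ⟨h1, h2⟩ := hval ℓ' hℓ' heq
    rw [h.cell ℓ' h1, h2]

theorem Rep.setSc (h : Rep I b Γ env σ M) {i : ℕ} (hi : i < numVars) (v : ℕ) :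
    Rep I b Γ env { σ with sc := Function.update σ.sc i v }
      (Function.update M (Loc.reg (n := n) (.sc i)).addr v) := by
  refine h.update (σ' := { σ with sc := Function.update σ.sc i v }) h.length_le (.reg (.sc i)) hi
    (by simp [Loc.val, Reg.val]) fun ℓ hℓ hne => ⟨hℓ, ?_⟩
  cases ℓ with
  | reg r => cases r with
    | sc j =>
      have : j ≠ i := by rintro rfl; exact hne rfl
      simp [Loc.val, Reg.val, this]
    | _ => rfl
  | _ => rfl

theorem Rep.setArr (h : Rep I b Γ env σ M) (j : ℕ) (x y : Fin n) (v : ℕ) :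
    Rep I b Γ env (σ.setArr j x y v)
      (Function.update M (Loc.arr j x y).addr v) := by
  refine h.update (σ' := σ.setArr j x y v) h.length_le (.arr j x y) trivial
    (by simp [Loc.val, State.setArr]) fun ℓ hℓ hne => ⟨hℓ, ?_⟩
  cases ℓ with
  | arr j' x' y' =>
    have : ¬ (j' = j ∧ x' = x ∧ y' = y) := by rintro ⟨rfl, rfl, rfl⟩; exact hne rfl
    simp only [Loc.val, State.setArr, if_neg this]
  | _ => rfl

/-- The two registers of a loop variable are set one after the other. -/
theorem Rep.setVar (h : Rep I b Γ env σ M) {k : ℕ} (hk : k < numVars) (hkΓ : k ∉ Γ) (x : Fin n) :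
    Rep I b (k :: Γ) (Function.update env k x) σ
      (Function.update (Function.update M (Loc.reg (n := n) (.var k)).addr x)
        (Loc.reg (n := n) (.mul k)).addr (n * x)) := by
  refine ⟨h.length_le, fun ℓ hℓ => ?_⟩
  have hv : (Loc.reg (n := n) (.var k)).Valid b (k :: Γ) σ.out.length := ⟨by simp, hk⟩
  have hm : (Loc.reg (n := n) (.mul k)).Valid b (k :: Γ) σ.out.length := ⟨by simp, hk⟩
  by_cases h1 : ℓ = .reg (.mul k)
  · rw [h1, Function.update_self]; simp [Loc.val, Reg.val]
  rw [Function.update_of_ne fun ha => h1 (Loc.addr_injective h.length_le hℓ hm ha)]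
  by_cases h2 : ℓ = .reg (.var k)
  · rw [h2, Function.update_self]; simp [Loc.val, Reg.val]
  rw [Function.update_of_ne fun ha => h2 (Loc.addr_injective h.length_le hℓ hv ha)]
  have : ℓ.Valid b Γ σ.out.length ∧ ℓ.val I (Function.update env k x) σ = ℓ.val I env σ := by
    cases ℓ with
    | reg r => cases r with
      | var l =>
        have : l ≠ k := by rintro rfl; exact h2 rfl
        simp only [Loc.Valid, Reg.Valid, List.mem_cons, this, false_or] at hℓ
        exact ⟨hℓ, by simp [Loc.val, Reg.val, this]⟩
      | mul l =>
        have : l ≠ k := by rintro rfl; exact h1 rfl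
        simp only [Loc.Valid, Reg.Valid, List.mem_cons, this, false_or] at hℓ
        exact ⟨hℓ, by simp [Loc.val, Reg.val, this]⟩
      | _ => exact ⟨hℓ, rfl⟩
    | _ => exact ⟨hℓ, rfl⟩
  rw [h.cell ℓ this.1, this.2]

/-- A loop variable goes out of scope, and its two registers are free. -/
theorem Rep.dropVar (h : Rep I b Γ env σ M) {k : ℕ} (hk : k < numVars) (hkΓ : k ∉ Γ) (v w : ℕ) :
    Rep I b Γ env σ
      (Function.update (Function.update M (Loc.reg (n := n) (.var k)).addr v)
        (Loc.reg (n := n) (.mul k)).addr w) := by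
  refine ⟨h.length_le, fun ℓ hℓ => ?_⟩
  have hv : (Loc.reg (n := n) (.var k)).Valid b (k :: Γ) σ.out.length := ⟨by simp, hk⟩
  have hm : (Loc.reg (n := n) (.mul k)).Valid b (k :: Γ) σ.out.length := ⟨by simp, hk⟩
  have hℓ' : ℓ.Valid b (k :: Γ) σ.out.length := by
    cases ℓ with
    | reg r => cases r with
      | var l => exact ⟨List.mem_cons_of_mem _ hℓ.1, hℓ.2⟩
      | mul l => exact ⟨List.mem_cons_of_mem _ hℓ.1, hℓ.2⟩
      | _ => exact hℓ
    | _ => exact hℓ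
  rw [Function.update_of_ne, Function.update_of_ne, h.cell ℓ hℓ]
  · intro ha
    rw [Loc.addr_injective h.length_le hℓ' hv ha] at hℓ
    exact hkΓ hℓ.1
  · intro ha
    rw [Loc.addr_injective h.length_le hℓ' hm ha] at hℓ
    exact hkΓ hℓ.1

theorem Rep.weaken {k : ℕ} {x : Fin n} (h : Rep I b (k :: Γ) (Function.update env k x) σ M)
    (hkΓ : k ∉ Γ) : Rep I b Γ env σ M := by
  refine ⟨h.length_le, fun ℓ hℓ => ?_⟩
  have : ℓ.Valid b (k :: Γ) σ.out.length ∧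
      ℓ.val I (Function.update env k x) σ = ℓ.val I env σ := by
    cases ℓ with
    | reg r => cases r with
      | var l =>
        have : l ≠ k := by rintro rfl; exact hkΓ hℓ.1
        exact ⟨⟨List.mem_cons_of_mem _ hℓ.1, hℓ.2⟩, by simp [Loc.val, Reg.val, this]⟩
      | mul l =>
        have : l ≠ k := by rintro rfl; exact hkΓ hℓ.1
        exact ⟨⟨List.mem_cons_of_mem _ hℓ.1, hℓ.2⟩, by simp [Loc.val, Reg.val, this]⟩
      | _ => exact ⟨hℓ, rfl⟩
    | _ => exact ⟨hℓ, rfl⟩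
  rw [h.cell ℓ this.1, this.2]

/-- The output will overwrite the input matrix, whose cells are given up here. As long as nothing is
emitted, no output cell is constrained. -/
theorem Rep.startOutput (h : Rep I true Γ env σ M) (hout : σ.out = []) :
    Rep I false Γ env σ M := by
  refine ⟨h.length_le, fun ℓ hℓ => h.cell ℓ ?_⟩
  cases ℓ with
  | inp x y => exact absurd hℓ.1 (by decide)
  | out i c => rw [hout] at hℓ; exact absurd hℓ.2 (Nat.not_lt_zero i)
  | _ => exact hℓ

/-! ### Compilation -/

/-- The address of register `i`. -/
def regAddr : ℕ → Expr
  | 0 => .lit 1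
  | i + 1 => .add (regAddr i) (.add (.cell (.lit 0)) (.lit 1))

/-- The content of a register. -/
def Reg.read (r : Reg) : Expr := .cell (regAddr r.idx)

/-- The base address of array `j`. -/
def arrBase : ℕ → Expr
  | 0 => Reg.base.read
  | j + 1 => .add (arrBase j) Reg.base.read

/-- The address of an array entry. -/
def arrAddr (j k l : ℕ) : Expr :=
  .add (arrBase j) (.add (Reg.mul k).read (Reg.var l).read)

/-- The compiled expression. Diagonal entries of the input are read as `0`. -/
def HExpr.compile : HExpr → Expr
  | lit c => .lit c
  | size => .cell (.lit 0)
  | var k => (Reg.var k).read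
  | sc i => (Reg.sc i).read
  | inp k l =>
    -- Diagonal cells hold registers. With `d` the distance of the two indices, `a - (a - d)` is the
    -- minimum of `a` and `d`: it is `0` on the diagonal and `a` elsewhere, as entries are at most
    -- `1`.
    let a := Expr.cell (.add (.lit 1) (.add (Reg.mul k).read (Reg.var l).read))
    .sub a (.sub a (.add (.sub (Reg.var k).read (Reg.var l).read)
      (.sub (Reg.var l).read (Reg.var k).read)))
  | arr j k l => .cell (arrAddr j k l)
  | add a b => .add a.compile b.compile
  | sub a b => .sub a.compile b.compile

/-- The address of component `c` of the next triple of the output. -/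
def outAddr (c : ℕ) : Expr :=
  .add (.add (.lit 2) (.add (.add Reg.count.read Reg.count.read) Reg.count.read)) (.lit c)

/-- The compiled program. -/
def HProg.compile : HProg → Prog
  | setSc i e => .assign (regAddr (Reg.sc i).idx) e.compile
  | setArr j k l e => .assign (arrAddr j k l) e.compile
  | emit k l e =>
    .ite (.sub (.cell (.lit 0)) Reg.count.read)
      (.seq (.assign (outAddr 0) (Reg.var k).read)
        (.seq (.assign (outAddr 1) (Reg.var l).read)
          (.seq (.assign (outAddr 2) e.compile)
            (.assign (regAddr Reg.count.idx) (.add Reg.count.read (.lit 1)))))) .skip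
  | seq p q => .seq p.compile q.compile
  | cond c p => .ite c.compile p.compile .skip
  | loop k p =>
    .seq (.seq (.assign (regAddr (Reg.var k).idx) (.lit 0))
      (.assign (regAddr (Reg.mul k).idx) (.lit 0)))
      (.loop (.sub (.cell (.lit 0)) (Reg.var k).read)
        (.seq p.compile
          (.seq (.assign (regAddr (Reg.var k).idx) (.add (Reg.var k).read (.lit 1)))
            (.assign (regAddr (Reg.mul k).idx) (.add (Reg.mul k).read (.cell (.lit 0)))))))

theorem Rep.zero (h : Rep I b Γ env σ M) : M 0 = n := h.cell .zero trivial

/-- The machine cannot multiply, so the address is a sum of `i` copies of `n + 1`; its length does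
not depend on `n`. -/
theorem eval_regAddr (hM : M 0 = n) (i : ℕ) : (regAddr i).eval M = 1 + i * (n + 1) := by
  induction i with
  | zero => simp [regAddr, Expr.eval]
  | succ i ih => simp only [regAddr, Expr.eval, ih, hM]; ring

theorem Rep.eval_read (h : Rep I b Γ env σ M) {r : Reg} (hr : r.Valid Γ) :
    r.read.eval M = r.val env σ := by
  rw [Reg.read, Expr.eval, eval_regAddr h.zero]
  exact h.cell (.reg r) hr

theorem Rep.eval_arrAddr (h : Rep I b Γ env σ M) {k l : ℕ} (hk : (Reg.mul k).Valid Γ)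
    (hl : (Reg.var l).Valid Γ) (j : ℕ) :
    (arrAddr j k l).eval M = (Loc.arr j (env k) (env l)).addr := by
  have : ∀ j, (arrBase j).eval M = (j + 1) * arrayBase n := by
    intro j
    induction j with
    | zero => simp [arrBase, h.eval_read (r := .base) trivial, Reg.val]
    | succ j ih =>
      simp only [arrBase, Expr.eval, ih, h.eval_read (r := .base) trivial, Reg.val]; ring
  simp only [arrAddr, Expr.eval, this, h.eval_read hk, h.eval_read hl, Reg.val, Loc.addr]

/-- The input matrix has entries `0` and `1`, and zeros on the diagonal. -/
structure IsInput (I : Fin n → Fin n → ℕ) : Prop where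
  le_one : ∀ x y, I x y ≤ 1
  diag : ∀ x, I x x = 0

theorem Rep.eval_compile (hI : IsInput I) (h : Rep I b Γ env σ M) (hΓ : ∀ k ∈ Γ, k < numVars)
    {e : HExpr} (he : e.wf b Γ) : e.compile.eval M = e.eval I env σ := by
  have hv : ∀ k, k ∈ Γ → (Reg.var k).Valid Γ := fun k hk => ⟨hk, hΓ k hk⟩
  have hm : ∀ k, k ∈ Γ → (Reg.mul k).Valid Γ := fun k hk => ⟨hk, hΓ k hk⟩
  induction e with
  | lit c => rfl
  | size => exact h.zero
  | var k => exact h.eval_read (hv k (by simpa [HExpr.wf] using he))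
  | sc i => exact h.eval_read (r := .sc i) (by simpa [HExpr.wf, Reg.Valid] using he)
  | inp k l =>
    simp only [HExpr.wf, Bool.and_eq_true, decide_eq_true_eq] at he
    obtain ⟨⟨hb, hk⟩, hl⟩ := he
    simp only [HExpr.compile, Expr.eval, h.eval_read (hv k hk), h.eval_read (hv l hl),
      h.eval_read (hm k hk), Reg.val, HExpr.eval]
    by_cases hkl : env k = env l
    · rw [hkl, hI.diag]; omega
    · have h1 := h.cell (.inp (env k) (env l)) ⟨hb, hkl⟩
      simp only [Loc.addr, Loc.val] at h1
      rw [h1]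
      have h2 := hI.le_one (env k) (env l)
      have h3 : (env k : ℕ) ≠ env l := fun h => hkl (Fin.ext h)
      omega
  | arr j k l =>
    simp only [HExpr.wf, Bool.and_eq_true, decide_eq_true_eq] at he
    rw [HExpr.compile, Expr.eval, h.eval_arrAddr (hm k he.1) (hv l he.2)]
    exact h.cell (.arr j (env k) (env l)) trivial
  | add a b iha ihb =>
    simp only [HExpr.wf, Bool.and_eq_true] at he
    simp only [HExpr.compile, Expr.eval, HExpr.eval, iha he.1, ihb he.2]
  | sub a b iha ihb =>
    simp only [HExpr.wf, Bool.and_eq_true] at he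
    simp only [HExpr.compile, Expr.eval, HExpr.eval, iha he.1, ihb he.2]

end RAM
end CRS

/-! ### Simulation and running time of compiled programs -/

namespace CRS
namespace RAM

variable {n : ℕ} {I : Fin n → Fin n → ℕ} {b : Bool} {Γ : List ℕ} {env env' : ℕ → Fin n}
  {σ σ' : State n} {M : Mem}

/-- A bound for the running time of the compiled program. -/
noncomputable def HProg.time : HProg → Polynomial ℕ
  | setSc i e => .C ((regAddr (Reg.sc i).idx).cost + e.compile.cost + 1)
  | setArr j k l e => .C ((arrAddr j k l).cost + e.compile.cost + 1)
  | emit k l e => .C ((Expr.sub (.cell (.lit 0)) Reg.count.read).cost + 1 +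
      (((outAddr 0).cost + (Reg.var k).read.cost + 1) +
      (((outAddr 1).cost + (Reg.var l).read.cost + 1) +
      (((outAddr 2).cost + e.compile.cost + 1) +
      ((regAddr Reg.count.idx).cost + (Expr.add Reg.count.read (.lit 1)).cost + 1)))) + 1)
  | seq p q => p.time + q.time
  | cond c p => .C (c.compile.cost + 2) + p.time
  | loop k p => .C ((regAddr (Reg.var k).idx).cost + (regAddr (Reg.mul k).idx).cost + 4 +
      ((Expr.sub (.cell (.lit 0)) (Reg.var k).read).cost + 1)) +
      .X * (.C ((Expr.sub (.cell (.lit 0)) (Reg.var k).read).cost + 1 +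
        (((regAddr (Reg.var k).idx).cost + (Expr.add (Reg.var k).read (.lit 1)).cost + 1) +
        ((regAddr (Reg.mul k).idx).cost + (Expr.add (Reg.mul k).read (.cell (.lit 0))).cost + 1))) +
        p.time)

theorem exec_loop_of_eval_eq_zero {c : Expr} {p : Prog} {M : Mem} (h : c.eval M = 0) :
    Exec (.loop c p) M M (c.cost + 1) := by
  constructor
  exact h

theorem exec_assign {a e : Expr} {x v : ℕ} (ha : a.eval M = x) (he : e.eval M = v) :
    Exec (.assign a e) M (Function.update M x v) (a.cost + e.cost + 1) := by
  subst ha he; exact .assign a e M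

theorem Rep.eval_outAddr (h : Rep I b Γ env σ M) (c : ℕ) :
    (outAddr c).eval M = 2 + 3 * σ.out.length + c := by
  simp only [outAddr, Expr.eval, h.eval_read (r := .count) trivial, Reg.val]; ring

/-- Appending a triple to the output. -/
theorem Rep.push (h : Rep I false Γ env σ M) (hlt : σ.out.length < n) (e : Fin n × Fin n × ℕ) :
    Rep I false Γ env { σ with out := σ.out ++ [e] }
      (Function.update (Function.update (Function.update (Function.update M
        (2 + 3 * σ.out.length + 0) e.1) (2 + 3 * σ.out.length + 1) e.2.1)
        (2 + 3 * σ.out.length + 2) e.2.2) (Loc.reg (n := n) .count).addr (σ.out.length + 1)) := by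
  set m := σ.out.length with hm
  set σ' : State n := { σ with out := σ.out ++ [e] } with hσ'
  have hlen : σ'.out.length = m + 1 := by simp [hσ', hm]
  have hle : σ'.out.length ≤ n := by omega
  have vout : ∀ c, (Loc.out (n := n) m c).Valid false Γ σ'.out.length :=
    fun c => ⟨rfl, by omega⟩
  have vcount : (Loc.reg (n := n) .count).Valid false Γ σ'.out.length := trivial
  have step : ∀ (ℓ ℓ' : Loc n), ℓ.Valid false Γ σ'.out.length → ℓ'.Valid false Γ σ'.out.length →
      ℓ ≠ ℓ' → ℓ.addr ≠ ℓ'.addr := fun ℓ ℓ' h h' hne ha => hne (Loc.addr_injective hle h h' ha)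
  have a0 : 2 + 3 * m + 0 = (Loc.out (n := n) m 0).addr := rfl
  have a1 : 2 + 3 * m + 1 = (Loc.out (n := n) m 1).addr := rfl
  have a2 : 2 + 3 * m + 2 = (Loc.out (n := n) m 2).addr := rfl
  have hget : σ'.out[m]? = some e := by simp [hσ', hm]
  refine ⟨hle, fun ℓ hℓ => ?_⟩
  rw [a0, a1, a2]
  by_cases hc : ℓ = .reg .count
  · rw [hc, Function.update_self]; simp only [Loc.val, Reg.val, hlen]
  rw [Function.update_of_ne (step _ _ hℓ vcount hc)]
  by_cases h2 : ℓ = .out m 2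
  · rw [h2, Function.update_self]; simp only [Loc.val, hget]
  rw [Function.update_of_ne (step _ _ hℓ (vout 2) h2)]
  by_cases h1 : ℓ = .out m 1
  · rw [h1, Function.update_self]; simp only [Loc.val, hget]
  rw [Function.update_of_ne (step _ _ hℓ (vout 1) h1)]
  by_cases h0 : ℓ = .out m 0
  · rw [h0, Function.update_self]; simp only [Loc.val, hget]
  rw [Function.update_of_ne (step _ _ hℓ (vout 0) h0)]
  cases ℓ with
  | zero => exact h.cell .zero trivial
  | reg r => cases r with
    | count => exact absurd rfl hc
    | base => exact h.cell (.reg .base) trivial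
    | var k => exact h.cell (.reg (.var k)) hℓ
    | mul k => exact h.cell (.reg (.mul k)) hℓ
    | sc i => exact h.cell (.reg (.sc i)) hℓ
  | arr j x y => exact h.cell (.arr j x y) trivial
  | inp x y => exact absurd hℓ.1 (by decide)
  | out i c =>
    have him : i ≠ m := by
      rintro rfl
      fin_cases c
      exacts [h0 rfl, h1 rfl, h2 rfl]
    have hi : i < m := by have := hℓ.2; omega
    rw [h.cell (.out i c) ⟨rfl, hi⟩]
    simp only [Loc.val, hσ', List.getElem?_append_left (hm ▸ hi)]

/-- The hypothesis `he` ranges over all memories for `σ`, because `e` is evaluated after two cells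
have been written. The triple joins the output only with the final assignment to the counter. -/
theorem exec_emit (h : Rep I false Γ env σ M) {k l : ℕ} {e : HExpr}
    (hlt : σ.out.length < n) (hk : (Reg.var k).Valid Γ) (hl : (Reg.var l).Valid Γ)
    (he : ∀ M', Rep I false Γ env σ M' → e.compile.eval M' = e.eval I env σ) :
    ∃ M', Exec (.seq (.assign (outAddr 0) (Reg.var k).read)
        (.seq (.assign (outAddr 1) (Reg.var l).read)
          (.seq (.assign (outAddr 2) e.compile)
            (.assign (regAddr Reg.count.idx) (.add Reg.count.read (.lit 1)))))) M M'
        (((outAddr 0).cost + (Reg.var k).read.cost + 1) +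
        (((outAddr 1).cost + (Reg.var l).read.cost + 1) +
        (((outAddr 2).cost + e.compile.cost + 1) +
        ((regAddr Reg.count.idx).cost + (Expr.add Reg.count.read (.lit 1)).cost + 1)))) ∧
      Rep I false Γ env { σ with out := σ.out ++ [(env k, env l, e.eval I env σ)] } M' := by
  set m := σ.out.length with hm
  -- Cells of the next triple are not in use yet.
  have free : ∀ (M : Mem) (c : Fin 3) (v : ℕ), Rep I false Γ env σ M →
      Rep I false Γ env σ (Function.update M (2 + 3 * m + c) v) := by
    intro M c v h
    refine ⟨h.length_le, fun ℓ hℓ => ?_⟩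
    rw [Function.update_of_ne, h.cell ℓ hℓ]
    intro ha
    have hv : ℓ.Valid false Γ (m + 1) := by
      cases ℓ with
      | out i c => exact ⟨rfl, hℓ.2.trans (Nat.lt_succ_self _)⟩
      | _ => exact hℓ
    have := Loc.addr_injective (ℓ' := .out m c) hlt hv ⟨rfl, Nat.lt_succ_self _⟩ ha
    rw [this] at hℓ
    exact lt_irrefl _ hℓ.2
  have h1 := free M 0 (env k) h
  have h2 := free _ 1 (env l) h1
  have h3 := free _ 2 (e.eval I env σ) h2
  refine ⟨_, .seq (exec_assign (h.eval_outAddr 0) (h.eval_read hk))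
    (.seq (exec_assign (h1.eval_outAddr 1) (h1.eval_read hl))
    (.seq (exec_assign (h2.eval_outAddr 2) (he _ h2))
    (exec_assign (x := (Loc.reg (n := n) .count).addr) (v := m + 1)
      (eval_regAddr h3.zero _) ?_))), h.push hlt (env k, env l, e.eval I env σ)⟩
  have := h3.eval_read (r := .count) trivial
  simp only [Expr.eval]
  exact congrArg (· + 1) this

/-- The compiled program simulates the program. -/
theorem HProg.exec_compile (hI : IsInput I) (p : HProg) :
    ∀ (Γ : List ℕ) (env : ℕ → Fin n) (σ : State n) (M : Mem), (∀ k ∈ Γ, k < numVars) →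
      p.wf b Γ → Rep I b Γ env σ M →
      ∃ M' t, Exec p.compile M M' t ∧ t ≤ p.time.eval n ∧ Rep I b Γ env (p.eval I env σ) M' := by
  induction p with
  | setSc i e =>
    intro Γ env σ M hΓ hw h
    simp only [HProg.wf, Bool.and_eq_true, decide_eq_true_eq] at hw
    exact ⟨_, _, exec_assign (x := (Loc.reg (n := n) (.sc i)).addr) (eval_regAddr h.zero _)
      (h.eval_compile hI hΓ hw.2), by simp [HProg.time], h.setSc hw.1 _⟩
  | setArr j k l e =>
    intro Γ env σ M hΓ hw h
    simp only [HProg.wf, Bool.and_eq_true, decide_eq_true_eq] at hw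
    exact ⟨_, _, exec_assign (h.eval_arrAddr ⟨hw.1.1, hΓ k hw.1.1⟩ ⟨hw.1.2, hΓ l hw.1.2⟩ j)
      (h.eval_compile hI hΓ hw.2), by simp [HProg.time], h.setArr _ _ _ _⟩
  | emit k l e =>
    intro Γ env σ M hΓ hw h
    simp only [HProg.wf, Bool.and_eq_true, decide_eq_true_eq, Bool.not_eq_true'] at hw
    obtain ⟨⟨⟨rfl, hk⟩, hl⟩, he⟩ := hw
    have hc : (Expr.sub (.cell (.lit 0)) Reg.count.read).eval M = n - σ.out.length := by
      simp only [Expr.eval, h.zero, h.eval_read (r := .count) trivial, Reg.val]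
    by_cases hlt : σ.out.length < n
    · obtain ⟨M', hM', hrep⟩ := exec_emit h hlt ⟨hk, hΓ k hk⟩ ⟨hl, hΓ l hl⟩
        (fun M' h' => h'.eval_compile hI hΓ he)
      refine ⟨M', _, .ite_true (by rw [hc]; omega) hM', ?_, ?_⟩
      · simp [HProg.time]
      · simpa only [HProg.eval, if_pos hlt] using hrep
    · refine ⟨M, _, .ite_false (by rw [hc]; omega) (.skip M), ?_, ?_⟩
      · simp [HProg.time]
      · simpa only [HProg.eval, if_neg hlt] using h
  | seq p q ihp ihq =>
    intro Γ env σ M hΓ hw h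
    simp only [HProg.wf, Bool.and_eq_true] at hw
    obtain ⟨M₁, t₁, e₁, l₁, h₁⟩ := ihp Γ env σ M hΓ hw.1 h
    obtain ⟨M₂, t₂, e₂, l₂, h₂⟩ := ihq Γ env _ M₁ hΓ hw.2 h₁
    exact ⟨M₂, _, .seq e₁ e₂, by simpa [HProg.time] using Nat.add_le_add l₁ l₂, h₂⟩
  | cond c p ih =>
    intro Γ env σ M hΓ hw h
    simp only [HProg.wf, Bool.and_eq_true] at hw
    have hc := h.eval_compile hI hΓ hw.1
    by_cases hc0 : c.eval I env σ = 0
    · refine ⟨M, _, .ite_false (hc.trans hc0) (.skip M), ?_, ?_⟩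
      · simp only [HProg.time, Polynomial.eval_add, Polynomial.eval_C]; omega
      · simpa [HProg.eval, hc0] using h
    · obtain ⟨M', t, e, l, h'⟩ := ih Γ env σ M hΓ hw.2 h
      refine ⟨M', _, .ite_true (by rwa [hc]) e, ?_, ?_⟩
      · simp only [HProg.time, Polynomial.eval_add, Polynomial.eval_C]; omega
      · simpa [HProg.eval, hc0] using h'
  | loop k p ih =>
    intro Γ env σ M hΓ hw h
    simp only [HProg.wf, Bool.and_eq_true, decide_eq_true_eq] at hw
    obtain ⟨⟨hk, hkΓ⟩, hp⟩ := hw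
    have hΓ' : ∀ l ∈ k :: Γ, l < numVars := by
      intro l hl
      rcases List.mem_cons.1 hl with rfl | hl
      exacts [hk, hΓ l hl]
    set f : Fin n → State n → State n := fun x => p.eval I (Function.update env k x) with hf
    set vk := (Loc.reg (n := n) (.var k)).addr with hvk
    set mk := (Loc.reg (n := n) (.mul k)).addr with hmk
    have hne : vk ≠ mk := fun ha => by
      simp [hvk, hmk, Loc.addr, Reg.idx] at ha
    have h0 : 0 ≠ vk := by simp only [hvk, Loc.addr]; omega
    -- Two consecutive assignments to the registers of the loop variable.
    have set2 : ∀ (M : Mem) (τ : State n) (a a' : Expr) (v w : ℕ), Rep I b Γ env τ M →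
        a.eval M = v → (∀ v, a'.eval (Function.update M vk v) = w) →
        Exec (.seq (.assign (regAddr (Reg.var k).idx) a) (.assign (regAddr (Reg.mul k).idx) a')) M
          (Function.update (Function.update M vk v) mk w)
          (((regAddr (Reg.var k).idx).cost + a.cost + 1) +
            ((regAddr (Reg.mul k).idx).cost + a'.cost + 1)) := by
      intro M τ a a' v w h ha ha'
      refine .seq (exec_assign (eval_regAddr h.zero _) ha) (exec_assign (eval_regAddr ?_ _) (ha' v))
      change Function.update M vk v 0 = n
      rw [Function.update_of_ne h0]
      exact h.zero
    -- Induction on the number `m` of passes that remain; before pass `i` the two registers of the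
    -- loop variable hold `i` and `n * i`.
    have main : ∀ m i, i + m = n → ∀ M, Rep I b Γ env (iterFin f σ i) M → M vk = i →
        M mk = n * i → ∃ M' t, Exec (.loop (.sub (.cell (.lit 0)) (Reg.var k).read)
        (.seq p.compile
          (.seq (.assign (regAddr (Reg.var k).idx) (.add (Reg.var k).read (.lit 1)))
            (.assign (regAddr (Reg.mul k).idx) (.add (Reg.mul k).read (.cell (.lit 0))))))) M M' t ∧
          t ≤ ((Expr.sub (.cell (.lit 0)) (Reg.var k).read).cost + 1) + m *
            ((Expr.sub (.cell (.lit 0)) (Reg.var k).read).cost + 1 +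
            (((regAddr (Reg.var k).idx).cost + (Expr.add (Reg.var k).read (.lit 1)).cost + 1) +
            ((regAddr (Reg.mul k).idx).cost + (Expr.add (Reg.mul k).read (.cell (.lit 0))).cost + 1))
            + p.time.eval n) ∧
          Rep I b Γ env (iterFin f σ n) M' := by
      have hread : ∀ {M : Mem} {τ : State n}, Rep I b Γ env τ M → ∀ r : Reg,
          r.read.eval M = M (Loc.reg (n := n) r).addr := by
        intro M τ h r
        rw [Reg.read, Expr.eval, eval_regAddr h.zero]; rfl
      intro m
      induction m with
      | zero =>
        rintro i hi M hM hv hmul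
        obtain rfl : i = n := by omega
        refine ⟨M, _, exec_loop_of_eval_eq_zero ?_, by omega, hM⟩
        simp only [Expr.eval, hM.zero, hread hM, ← hvk, hv]; omega
      | succ m ihm =>
        rintro i hi M hM hv hmul
        have hin : i < n := by omega
        -- The registers already hold these values, so bringing the variable into scope does not
        -- change the memory.
        have hM' := hM.setVar hk hkΓ ⟨i, hin⟩
        rw [← hvk, ← hmk, show ((⟨i, hin⟩ : Fin n) : ℕ) = M vk from hv.symm, Function.update_eq_self,
          hv, ← hmul, Function.update_eq_self] at hM'
        obtain ⟨M₁, t₁, e₁, l₁, h₁⟩ := ih (k :: Γ) _ _ M hΓ' hp hM'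
        have hv₁ : M₁ vk = i := by
          have := h₁.cell (.reg (.var k)) ⟨by simp, hk⟩
          simpa [Loc.val, Reg.val] using this
        have hm₁ : M₁ mk = n * i := by
          have := h₁.cell (.reg (.mul k)) ⟨by simp, hk⟩
          simpa [Loc.val, Reg.val] using this
        have h₁' : Rep I b Γ env (iterFin f σ (i + 1)) M₁ := by
          have := h₁.weaken hkΓ
          simpa only [iterFin, dif_pos hin] using this
        have e₂ := set2 M₁ _ (.add (Reg.var k).read (.lit 1))
          (.add (Reg.mul k).read (.cell (.lit 0))) (i + 1) (n * (i + 1)) h₁'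
          (by simp only [Expr.eval, hread h₁', ← hvk, hv₁])
          (fun v => by
            have hz : (Function.update M₁ vk v) 0 = n := by
              rw [Function.update_of_ne h0]
              exact h₁'.zero
            simp only [Expr.eval, Reg.read, eval_regAddr hz, hz]
            change Function.update M₁ vk v mk + n = _
            rw [Function.update_of_ne hne.symm, hm₁]
            ring)
        -- After the last pass the register holds `n`, which is no vertex, so it is incremented only
        -- when the variable is out of scope.
        have h₂ := h₁'.dropVar hk hkΓ (i + 1) (n * (i + 1))
        rw [← hvk, ← hmk] at h₂
        obtain ⟨M₃, t₃, e₃, l₃, h₃⟩ := ihm (i + 1) (by omega) _ h₂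
          (by rw [Function.update_of_ne hne, Function.update_self]) (by rw [Function.update_self])
        refine ⟨M₃, _, .loop_step ?_ (.seq e₁ e₂) e₃, ?_, h₃⟩
        · simp only [Expr.eval, hM.zero, hread hM, ← hvk, hv]; omega
        · rw [Nat.succ_mul]; omega
    have e₀ := set2 M σ (.lit 0) (.lit 0) 0 0 h rfl (fun _ => rfl)
    have h₀ := h.dropVar hk hkΓ 0 0
    rw [← hvk, ← hmk] at h₀
    obtain ⟨M', t, e, l, h'⟩ := main n 0 (by omega) _ h₀
      (by rw [Function.update_of_ne hne, Function.update_self]) (by rw [Function.update_self]; omega)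
    refine ⟨M', _, .seq e₀ e, ?_, h'⟩
    simp only [HProg.time, Polynomial.eval_add, Polynomial.eval_C, Polynomial.eval_mul,
      Polynomial.eval_X]
    simp only [Expr.cost] at l ⊢
    omega

/-! ### Initialization -/

/-- Sets up the array base and the output length. -/
def prelude : Prog :=
  .seq (.assign (regAddr 3) (regAddr (8 + 3 * numVars)))
    (.seq (.assign (regAddr 4) (.lit 0))
      (.seq (.loop (.sub (.cell (.lit 0)) (.cell (regAddr 4)))
        (.seq (.assign (regAddr 3) (.add (.cell (regAddr 3)) (.add (.cell (.lit 0)) (.lit 1))))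
          (.assign (regAddr 4) (.add (.cell (regAddr 4)) (.lit 1)))))
        (.assign (regAddr 4) (.lit 0))))

/-- A bound for the running time of `prelude`. -/
noncomputable def preludeTime : Polynomial ℕ :=
  .C (((regAddr 3).cost + (regAddr (8 + 3 * numVars)).cost + 1) + (((regAddr 4).cost + 2) +
    (((Expr.sub (.cell (.lit 0)) (.cell (regAddr 4))).cost + 1) + ((regAddr 4).cost + 2)))) +
  .X * .C ((Expr.sub (.cell (.lit 0)) (.cell (regAddr 4))).cost + 1 +
    (((regAddr 3).cost + (Expr.add (.cell (regAddr 3)) (.add (.cell (.lit 0)) (.lit 1))).cost + 1) +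
    ((regAddr 4).cost + (Expr.add (.cell (regAddr 4)) (.lit 1)).cost + 1)))

/-- The product in `arrayBase n` is obtained by adding `n + 1` in a loop of `n` passes. Register
`4`, later the output length, serves as the loop counter and is cleared at the end. -/
theorem exec_prelude (hM : M 0 = n) : ∃ M' t, Exec prelude M M' t ∧ t ≤ preludeTime.eval n ∧
    M' (1 + 3 * (n + 1)) = arrayBase n ∧ M' (1 + 4 * (n + 1)) = 0 ∧
    ∀ a, a ≠ 1 + 3 * (n + 1) → a ≠ 1 + 4 * (n + 1) → M' a = M a := by
  have hne : 1 + 3 * (n + 1) ≠ 1 + 4 * (n + 1) := by omega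
  have main : ∀ m i, i + m = n → ∀ M : Mem, M 0 = n →
      M (1 + 3 * (n + 1)) = 1 + (8 + 3 * numVars + i) * (n + 1) → M (1 + 4 * (n + 1)) = i →
      ∃ M' t, Exec (.loop (.sub (.cell (.lit 0)) (.cell (regAddr 4)))
        (.seq (.assign (regAddr 3) (.add (.cell (regAddr 3)) (.add (.cell (.lit 0)) (.lit 1))))
          (.assign (regAddr 4) (.add (.cell (regAddr 4)) (.lit 1))))) M M' t ∧
        t ≤ ((Expr.sub (.cell (.lit 0)) (.cell (regAddr 4))).cost + 1) + m *
          ((Expr.sub (.cell (.lit 0)) (.cell (regAddr 4))).cost + 1 +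
          (((regAddr 3).cost + (Expr.add (.cell (regAddr 3)) (.add (.cell (.lit 0)) (.lit 1))).cost
          + 1) + ((regAddr 4).cost + (Expr.add (.cell (regAddr 4)) (.lit 1)).cost + 1))) ∧
        M' (1 + 3 * (n + 1)) = arrayBase n ∧
        ∀ a, a ≠ 1 + 3 * (n + 1) → a ≠ 1 + 4 * (n + 1) → M' a = M a := by
    intro m
    induction m with
    | zero =>
      intro i hi M h0 h3 h4
      obtain rfl : i = n := by omega
      refine ⟨M, _, exec_loop_of_eval_eq_zero ?_, by omega, h3, fun _ _ _ => rfl⟩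
      simp only [Expr.eval, h0, eval_regAddr h0, h4]; omega
    | succ m ih =>
      intro i hi M h0 h3 h4
      have h0' : ∀ v, Function.update M (1 + 3 * (n + 1)) v 0 = n := fun v => by
        rw [Function.update_of_ne (by omega), h0]
      obtain ⟨M', t, e, l, hB, hr⟩ := ih (i + 1) (by omega)
        (Function.update (Function.update M (1 + 3 * (n + 1))
          (1 + (8 + 3 * numVars + (i + 1)) * (n + 1))) (1 + 4 * (n + 1)) (i + 1))
        (by rw [Function.update_of_ne (by omega), h0'])
        (by rw [Function.update_of_ne hne, Function.update_self])
        (by rw [Function.update_self])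
      refine ⟨M', _, .loop_step ?_ (.seq (exec_assign (eval_regAddr h0 3) ?_)
        (exec_assign (eval_regAddr (h0' _) 4) ?_)) e, ?_, hB, fun a h1 h2 => ?_⟩
      · simp only [Expr.eval, h0, eval_regAddr h0, h4]; omega
      · simp only [Expr.eval, h0, eval_regAddr h0, h3]; ring
      · simp only [Expr.eval, eval_regAddr (h0' _), Function.update_of_ne hne.symm, h4]
      · rw [Nat.succ_mul]; omega
      · rw [hr a h1 h2, Function.update_of_ne h2, Function.update_of_ne h1]
  have h1 : ∀ v, Function.update M (1 + 3 * (n + 1)) v 0 = n := fun v => by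
    rw [Function.update_of_ne (by omega), hM]
  have h2 : ∀ v w, Function.update (Function.update M (1 + 3 * (n + 1)) v) (1 + 4 * (n + 1)) w 0
      = n := fun v w => by rw [Function.update_of_ne (by omega), h1]
  obtain ⟨M', t, e, l, hB, hr⟩ := main n 0 (by omega) (Function.update (Function.update M
    (1 + 3 * (n + 1)) (1 + (8 + 3 * numVars) * (n + 1))) (1 + 4 * (n + 1)) 0) (h2 _ _)
    (by rw [Function.update_of_ne hne, Function.update_self]; rfl) (by rw [Function.update_self])
  have h0 : M' 0 = n := by rw [hr 0 (by omega) (by omega), h2]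
  refine ⟨Function.update M' (1 + 4 * (n + 1)) 0, _, .seq (exec_assign (eval_regAddr hM 3)
    (eval_regAddr hM _)) (.seq (exec_assign (eval_regAddr (h1 _) 4) rfl) (.seq e
    (exec_assign (eval_regAddr h0 4) rfl))), ?_, ?_, ?_, fun a k1 k2 => ?_⟩
  · simp only [preludeTime, Polynomial.eval_add, Polynomial.eval_C, Polynomial.eval_mul,
      Polynomial.eval_X]
    simp only [Expr.cost] at l ⊢
    omega
  · rw [Function.update_of_ne hne, hB]
  · rw [Function.update_self]
  · rw [Function.update_of_ne k2, hr a k1 k2, Function.update_of_ne k2, Function.update_of_ne k1]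

open Classical in
/-- The adjacency matrix without its diagonal. -/
noncomputable def matrix (R : Digraph (Fin n)) (x y : Fin n) : ℕ :=
  if x ≠ y ∧ R.Adj x y then 1 else 0

theorem isInput_matrix (R : Digraph (Fin n)) : IsInput (matrix R) :=
  ⟨fun x y => by unfold matrix; split_ifs <;> simp, fun x => by simp [matrix]⟩

theorem input_inp (R : Digraph (Fin n)) {x y : Fin n} (hxy : x ≠ y) :
    input R (1 + (n * x + y)) = matrix R x y := by
  unfold input matrix
  rw [if_neg (by omega)]
  congr 1
  refine propext ⟨?_, fun h => ⟨x, y, by ring, h.2⟩⟩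
  rintro ⟨x', y', h, hR⟩
  obtain ⟨rfl, rfl⟩ := pair_inj (show n * x + y = n * x' + y' by omega)
  exact ⟨hxy, hR⟩

/-- After the initialization the memory represents a state without output. -/
theorem exec_prelude_input (R : Digraph (Fin n)) (env : ℕ → Fin n) :
    ∃ M t σ, Exec prelude (input R) M t ∧ t ≤ preludeTime.eval n ∧ σ.out = [] ∧
      Rep (matrix R) true [] env σ M := by
  obtain ⟨M, t, e, l, h3, h4, hr⟩ := exec_prelude (M := input R) (n := n) (by simp [input])
  -- Scalars and arrays are not initialized: the state takes whatever the memory holds.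
  refine ⟨M, t, ⟨fun i => M (Loc.reg (n := n) (.sc i)).addr, fun j x y => M (Loc.arr j x y).addr, []⟩,
    e, l, rfl, Nat.zero_le _, fun ℓ hℓ => ?_⟩
  cases ℓ with
  | zero =>
    rw [Loc.addr, hr 0 (by omega) (by omega)]
    simp [input, Loc.val]
  | reg r => cases r with
    | base => exact h3
    | count => exact h4
    | var k => exact absurd hℓ.1 (by simp)
    | mul k => exact absurd hℓ.1 (by simp)
    | sc i => rfl
  | arr j x y => rfl
  | inp x y =>
    rw [Loc.addr, hr _ (inp_ne_diag hℓ.2 3).symm (inp_ne_diag hℓ.2 4).symm, input_inp R hℓ.2]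
    rfl
  | out i c => exact absurd hℓ.1 (by decide)

end RAM
end CRS

/-! ### Reasoning about structured programs -/

namespace CRS
namespace RAM

variable {n : ℕ} {I : Fin n → Fin n → ℕ} {env : ℕ → Fin n} {σ τ : State n}

/-! ### Boolean expressions -/

namespace HExpr

/-- Negation. -/
def not (a : HExpr) : HExpr := .sub (.lit 1) a

/-- Conjunction. -/
def and (a b : HExpr) : HExpr := (HExpr.add a.not b.not).not

/-- Disjunction. -/
def or (a b : HExpr) : HExpr := (HExpr.add a b).not.not

/-- The test for equality. -/
def eq (a b : HExpr) : HExpr := (HExpr.add (.sub a b) (.sub b a)).not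

/-- The test for `<`. -/
def lt (a b : HExpr) : HExpr := (HExpr.sub b a).not.not

-- Truncated subtraction makes every nonzero value count as true, and a double negation normalizes
-- it to `1`, so that truth values can be summed to count.
@[simp] theorem eval_not (a : HExpr) :
    a.not.eval I env σ = if a.eval I env σ = 0 then 1 else 0 := by
  simp only [not, eval]; split_ifs <;> omega

@[simp] theorem eval_and (a b : HExpr) : (a.and b).eval I env σ =
    if a.eval I env σ ≠ 0 ∧ b.eval I env σ ≠ 0 then 1 else 0 := by
  simp only [and, not, eval]; split_ifs <;> omega

@[simp] theorem eval_or (a b : HExpr) : (a.or b).eval I env σ =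
    if a.eval I env σ ≠ 0 ∨ b.eval I env σ ≠ 0 then 1 else 0 := by
  simp only [or, not, eval]; split_ifs <;> omega

@[simp] theorem eval_eq (a b : HExpr) : (a.eq b).eval I env σ =
    if a.eval I env σ = b.eval I env σ then 1 else 0 := by
  simp only [eq, not, eval]; split_ifs <;> omega

@[simp] theorem eval_lt (a b : HExpr) : (a.lt b).eval I env σ =
    if a.eval I env σ < b.eval I env σ then 1 else 0 := by
  simp only [lt, not, eval]; split_ifs <;> omega

end HExpr

/-! ### Frames and loop invariants -/

namespace HProg

/-- The arrays that a program may change. -/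
def arrs : HProg → List ℕ
  | setSc _ _ => []
  | setArr j _ _ _ => [j]
  | emit _ _ _ => []
  | seq p q => p.arrs ++ q.arrs
  | cond _ p => p.arrs
  | loop _ p => p.arrs

/-- The scalars that a program may change. -/
def scs : HProg → List ℕ
  | setSc i _ => [i]
  | setArr _ _ _ _ => []
  | emit _ _ _ => []
  | seq p q => p.scs ++ q.scs
  | cond _ p => p.scs
  | loop _ p => p.scs

/-- The program has no output. -/
def silent : HProg → Bool
  | setSc _ _ => true
  | setArr _ _ _ _ => true
  | emit _ _ _ => false
  | seq p q => p.silent && q.silent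
  | cond _ p => p.silent
  | loop _ p => p.silent

theorem iterFin_induction {α : Type*} {f : Fin n → α → α} {a : α} {P : α → Prop} (h0 : P a)
    (hs : ∀ x b, P b → P (f x b)) (k : ℕ) : P (iterFin f a k) := by
  induction k with
  | zero => exact h0
  | succ k ih => unfold iterFin; split_ifs; exacts [hs _ _ ih, ih]

/-- A property preserved by the body is preserved by the loop. -/
theorem eval_loop_const {p : HProg} {k : ℕ} {P : State n → Prop} (h0 : P σ)
    (hs : ∀ x τ, P τ → P (p.eval I (Function.update env k x) τ)) :
    P ((loop k p).eval I env σ) :=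
  iterFin_induction h0 hs n

/-- A frame rule with a purely syntactic side condition, which `decide` settles for concrete
programs. -/
theorem eval_arr {p : HProg} {j : ℕ} (hj : j ∉ p.arrs) : (p.eval I env σ).arr j = σ.arr j := by
  induction p generalizing env σ with
  | setSc i e => rfl
  | setArr j' k l e =>
    have : j ≠ j' := by simpa [arrs] using hj
    simp [eval, State.setArr, this]
  | emit k l e => simp only [eval]; split_ifs <;> rfl
  | seq p q ihp ihq =>
    simp only [arrs, List.mem_append, not_or] at hj
    rw [eval, ihq hj.2, ihp hj.1]
  | cond c p ih => simp only [eval]; split_ifs; exacts [ih hj, rfl]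
  | loop k p ih =>
    exact eval_loop_const (P := fun τ => τ.arr j = σ.arr j) rfl
      fun x τ h => (ih hj).trans h

theorem eval_sc {p : HProg} {i : ℕ} (hi : i ∉ p.scs) : (p.eval I env σ).sc i = σ.sc i := by
  induction p generalizing env σ with
  | setSc i' e =>
    have : i ≠ i' := by simpa [scs] using hi
    simp [eval, this]
  | setArr j' k l e => rfl
  | emit k l e => simp only [eval]; split_ifs <;> rfl
  | seq p q ihp ihq =>
    simp only [scs, List.mem_append, not_or] at hi
    rw [eval, ihq hi.2, ihp hi.1]
  | cond c p ih => simp only [eval]; split_ifs; exacts [ih hi, rfl]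
  | loop k p ih =>
    exact eval_loop_const (P := fun τ => τ.sc i = σ.sc i) rfl
      fun x τ h => (ih hi).trans h

theorem eval_out {p : HProg} (hp : p.silent = true) : (p.eval I env σ).out = σ.out := by
  induction p generalizing env σ with
  | setSc i e => rfl
  | setArr j k l e => rfl
  | emit k l e => exact absurd hp (by simp [silent])
  | seq p q ihp ihq =>
    simp only [silent, Bool.and_eq_true] at hp
    rw [eval, ihq hp.2, ihp hp.1]
  | cond c p ih => simp only [eval]; split_ifs; exacts [ih hp, rfl]
  | loop k p ih =>
    exact eval_loop_const (P := fun τ => τ.out = σ.out) rfl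
      fun x τ h => (ih hp).trans h

/-- An invariant of a loop, indexed by the set of values that have been treated. -/
theorem eval_loop_inv {p : HProg} {k : ℕ} (P : Finset (Fin n) → State n → Prop) (h0 : P ∅ σ)
    (hs : ∀ s x τ, x ∉ s → P s τ → P (insert x s) (p.eval I (Function.update env k x) τ)) :
    P Finset.univ ((loop k p).eval I env σ) := by
  have key : ∀ m ≤ n, P (Finset.univ.filter fun x : Fin n => (x : ℕ) < m)
      (iterFin (fun x => p.eval I (Function.update env k x)) σ m) := by
    intro m
    induction m with
    | zero => intro _; simpa [iterFin] using h0
    | succ m ih =>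
      intro hm
      have := hs _ ⟨m, hm⟩ _ (by simp) (ih (by omega))
      rw [iterFin, dif_pos (show m < n from hm)]
      convert this using 1
      ext x
      simp only [Finset.mem_filter_univ, Finset.mem_insert, Fin.ext_iff]
      omega
  have := key n le_rfl
  rwa [Finset.filter_true_of_mem fun x _ => x.2] at this

/-- An invariant of two nested loops. -/
theorem eval_loop2_inv {p : HProg} {k l : ℕ} (P : Finset (Fin n × Fin n) → State n → Prop)
    (h0 : P ∅ σ)
    (hs : ∀ s x y τ, (x, y) ∉ s → P s τ →
      P (insert (x, y) s) (p.eval I (Function.update (Function.update env k x) l y) τ)) :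
    P Finset.univ ((loop k (loop l p)).eval I env σ) := by
  have := eval_loop_inv (I := I) (env := env) (σ := σ) (p := loop l p) (k := k)
    (fun s τ => P (s ×ˢ Finset.univ) τ) (by simpa using h0) (fun s x τ hx h => by
      have := eval_loop_inv (I := I) (env := Function.update env k x) (σ := τ) (p := p) (k := l)
        (fun t τ => P (s ×ˢ Finset.univ ∪ {x} ×ˢ t) τ) (by simpa using h) (fun t y τ hy h => by
          have := hs _ x y τ (by simp [hx, hy]) h
          convert this using 1
          ext ⟨a, b⟩
          simp only [Finset.mem_union, Finset.mem_product, Finset.mem_univ, and_true,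
            Finset.mem_singleton, Finset.mem_insert, Prod.mk.injEq]
          tauto)
      convert this using 1
      ext ⟨a, b⟩
      simp only [Finset.mem_union, Finset.mem_product, Finset.mem_univ, and_true,
        Finset.mem_singleton, Finset.mem_insert]
      tauto)
  simpa using this

/-- Filling an array with values that do not depend on it. -/
theorem eval_fill {w k l : ℕ} {e : HExpr} {g : Fin n → Fin n → ℕ} (hkl : k ≠ l)
    (he : ∀ x y τ, (∀ j ≠ w, τ.arr j = σ.arr j) → τ.sc = σ.sc →
      e.eval I (Function.update (Function.update env k x) l y) τ = g x y) :
    ((loop k (loop l (setArr w k l e))).eval I env σ).arr w = g := by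
  have := eval_loop2_inv (I := I) (env := env) (σ := σ) (p := setArr w k l e) (k := k) (l := l)
    (fun s τ => (∀ j ≠ w, τ.arr j = σ.arr j) ∧ τ.sc = σ.sc ∧ ∀ q ∈ s, τ.arr w q.1 q.2 = g q.1 q.2)
    (by simp) (fun s x y τ _ ⟨h1, h2, h3⟩ => by
      refine ⟨fun j hj => ?_, h2, fun q hq => ?_⟩
      · rw [eval_arr (by simpa [arrs] using hj), h1 j hj]
      · simp only [eval, State.setArr, Function.update_self, Function.update_of_ne hkl,
          he x y τ h1 h2, true_and]
        split_ifs with hxy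
        · rw [hxy.1, hxy.2]
        · rcases Finset.mem_insert.1 hq with rfl | hq
          · exact absurd ⟨rfl, rfl⟩ hxy
          · exact h3 q hq)
  funext x y
  exact this.2.2 (x, y) (Finset.mem_univ _)

/-- Summation in a scalar. -/
theorem eval_sum {i k : ℕ} {e : HExpr} {g : Fin n → ℕ}
    (he : ∀ x τ, τ.arr = σ.arr → (∀ i' ≠ i, τ.sc i' = σ.sc i') →
      e.eval I (Function.update env k x) τ = g x) :
    ((loop k (setSc i (.add (.sc i) e))).eval I env σ).sc i = σ.sc i + ∑ x, g x := by
  have := eval_loop_inv (I := I) (env := env) (σ := σ) (p := setSc i (.add (.sc i) e)) (k := k)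
    (fun s τ => τ.arr = σ.arr ∧ (∀ i' ≠ i, τ.sc i' = σ.sc i') ∧ τ.sc i = σ.sc i + ∑ x ∈ s, g x)
    (by simp) (fun s x τ hx ⟨h1, h2, h3⟩ => by
      refine ⟨h1, fun i' hi' => ?_, ?_⟩
      · rw [eval_sc (by simpa [scs] using hi'), h2 i' hi']
      · simp only [eval, HExpr.eval, Function.update_self, he x τ h1 h2, h3,
          Finset.sum_insert hx]
        ring)
  exact this.2.2

theorem eval_sum2 {i k l : ℕ} {e : HExpr} {g : Fin n → Fin n → ℕ}
    (he : ∀ x y τ, τ.arr = σ.arr → (∀ i' ≠ i, τ.sc i' = σ.sc i') →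
      e.eval I (Function.update (Function.update env k x) l y) τ = g x y) :
    ((loop k (loop l (setSc i (.add (.sc i) e)))).eval I env σ).sc i =
      σ.sc i + ∑ q : Fin n × Fin n, g q.1 q.2 := by
  have := eval_loop2_inv (I := I) (env := env) (σ := σ) (p := setSc i (.add (.sc i) e)) (k := k)
    (l := l)
    (fun s τ => τ.arr = σ.arr ∧ (∀ i' ≠ i, τ.sc i' = σ.sc i') ∧
      τ.sc i = σ.sc i + ∑ q ∈ s, g q.1 q.2)
    (by simp) (fun s x y τ hx ⟨h1, h2, h3⟩ => by
      refine ⟨h1, fun i' hi' => ?_, ?_⟩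
      · rw [eval_sc (by simpa [scs] using hi'), h2 i' hi']
      · simp only [eval, HExpr.eval, Function.update_self, he x y τ h1 h2, h3,
          Finset.sum_insert hx]
        ring)
  exact this.2.2

/-! ### Reachability -/

/-- The transitive closure of the relation in array `w`. Array `3` is meant to hold, for related
pairs, the difference of a potential, shifted by scalar `2`. -/
def warshall (w : ℕ) : HProg :=
  loop 5 (loop 3 (loop 4 (cond (((HExpr.arr w 3 5).and (.arr w 5 4)).and (HExpr.arr w 3 4).not)
    (seq (setArr w 3 4 (.lit 1))
      (setArr 3 3 4 (.sub (.add (.arr 3 3 5) (.arr 3 5 4)) (.sc 2)))))))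

theorem warshall_body {w : ℕ} (hw : w ≠ 3) (k a b : Fin n) :
    (HProg.eval I (cond (((HExpr.arr w 3 5).and (.arr w 5 4)).and (HExpr.arr w 3 4).not)
    (seq (setArr w 3 4 (.lit 1))
      (setArr 3 3 4 (.sub (.add (.arr 3 3 5) (.arr 3 5 4)) (.sc 2)))))
      (Function.update (Function.update (Function.update env 5 k) 3 a) 4 b) σ) =
    if (σ.arr w a k ≠ 0 ∧ σ.arr w k b ≠ 0) ∧ σ.arr w a b = 0 then
      (σ.setArr w a b 1).setArr 3 a b (σ.arr 3 a k + σ.arr 3 k b - σ.sc 2) else σ := by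
  simp [eval, HExpr.eval, State.setArr, hw.symm, and_assoc]

/-- Phase `k` adds the compositions through `k`. Updating in place is harmless, since row and column
`k` do not change as relations during this phase. The invariant is that the relation stays within
the transitive closure and is closed under composition through all treated vertices. -/
theorem eval_warshall {w : ℕ} (hw : w ≠ 3) (a b : Fin n) :
    ((warshall w).eval I env σ).arr w a b ≠ 0 ↔
      Relation.TransGen (fun a b => σ.arr w a b ≠ 0) a b := by
  have phase : ∀ (k : Fin n) (σ : State n) (a b : Fin n),
      ((loop 3 (loop 4 (cond (((HExpr.arr w 3 5).and (.arr w 5 4)).and (HExpr.arr w 3 4).not)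
        (seq (setArr w 3 4 (.lit 1)) (setArr 3 3 4
          (.sub (.add (.arr 3 3 5) (.arr 3 5 4)) (.sc 2))))))).eval I
          (Function.update env 5 k) σ).arr w a b ≠ 0 ↔
        σ.arr w a b ≠ 0 ∨ σ.arr w a k ≠ 0 ∧ σ.arr w k b ≠ 0 := by
    intro k σ
    have := eval_loop2_inv (I := I) (env := Function.update env 5 k) (σ := σ)
      (p := cond (((HExpr.arr w 3 5).and (.arr w 5 4)).and (HExpr.arr w 3 4).not)
        (seq (setArr w 3 4 (.lit 1)) (setArr 3 3 4
          (.sub (.add (.arr 3 3 5) (.arr 3 5 4)) (.sc 2))))) (k := 3) (l := 4)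
      (fun s τ => ∀ x y, (τ.arr w x y ≠ 0 → σ.arr w x y ≠ 0 ∨ σ.arr w x k ≠ 0 ∧ σ.arr w k y ≠ 0) ∧
        (σ.arr w x y ≠ 0 → τ.arr w x y ≠ 0) ∧
        ((x, y) ∈ s → σ.arr w x k ≠ 0 → σ.arr w k y ≠ 0 → τ.arr w x y ≠ 0))
      (fun x y => ⟨.inl, id, by simp⟩) (fun s x y τ _ h => by
        rw [warshall_body hw]
        have hxk := (h x k).1
        have hky := (h k y).1
        split_ifs with hc
        · intro x' y'
          simp only [State.setArr, hw, false_and, if_false, Finset.mem_insert, Prod.mk.injEq,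
            true_and]
          by_cases hxy : x' = x ∧ y' = y
          · obtain ⟨rfl, rfl⟩ := hxy
            have h1 : σ.arr w x' k ≠ 0 := (hxk hc.1.1).elim id (·.1)
            have h2 : σ.arr w k y' ≠ 0 := (hky hc.1.2).elim id (·.2)
            simp [h1, h2]
          · simpa only [hxy, if_false, false_or] using h x' y'
        · intro x' y'
          refine ⟨(h x' y').1, (h x' y').2.1, fun hm h1 h2 => ?_⟩
          rcases Finset.mem_insert.1 hm with heq | hm
          · obtain ⟨rfl, rfl⟩ := Prod.mk.inj heq
            intro h0
            exact hc ⟨⟨(h x' k).2.1 h1, (h k y').2.1 h2⟩, h0⟩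
          · exact (h x' y').2.2 hm h1 h2)
    exact fun a b => ⟨(this a b).1, fun h => h.elim (this a b).2.1
      fun h => (this a b).2.2 (Finset.mem_univ _) h.1 h.2⟩
  have := eval_loop_inv (I := I) (env := env) (σ := σ) (k := 5)
    (p := loop 3 (loop 4 (cond (((HExpr.arr w 3 5).and (.arr w 5 4)).and (HExpr.arr w 3 4).not)
        (seq (setArr w 3 4 (.lit 1)) (setArr 3 3 4
          (.sub (.add (.arr 3 3 5) (.arr 3 5 4)) (.sc 2)))))))
    (fun s τ => (∀ x y, τ.arr w x y ≠ 0 → Relation.TransGen (fun a b => σ.arr w a b ≠ 0) x y) ∧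
      (∀ x y, σ.arr w x y ≠ 0 → τ.arr w x y ≠ 0) ∧
      ∀ k ∈ s, ∀ x y, τ.arr w x k ≠ 0 → τ.arr w k y ≠ 0 → τ.arr w x y ≠ 0)
    ⟨fun x y h => .single h, fun _ _ h => h, by simp⟩ (fun s k τ _ ⟨h1, h2, h3⟩ => by
      simp only [phase]
      refine ⟨?_, fun x y h => .inl (h2 x y h), fun i hi x y hx hy => ?_⟩
      · rintro x y (h | h)
        exacts [h1 x y h, (h1 x k h.1).trans (h1 k y h.2)]
      · rcases Finset.mem_insert.1 hi with rfl | hi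
        · have e1 : τ.arr w x i ≠ 0 := hx.elim id (·.1)
          have e2 : τ.arr w i y ≠ 0 := hy.elim id (·.2)
          exact .inr ⟨e1, e2⟩
        · rcases hx with hx | hx
          · rcases hy with hy | hy
            · exact .inl (h3 i hi x y hx hy)
            · exact .inr ⟨h3 i hi x k hx hy.1, hy.2⟩
          · rcases hy with hy | hy
            · exact .inr ⟨hx.1, h3 i hi k y hx.2 hy⟩
            · exact .inr ⟨hx.1, hy.2⟩)
  obtain ⟨h1, h2, h3⟩ := this
  refine ⟨h1 a b, fun h => ?_⟩
  induction h with
  | single h => exact h2 _ _ h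
  | tail _ h ih => exact h3 _ (Finset.mem_univ _) _ _ ih (h2 _ _ h)

/-- The potential differences stay correct. -/
theorem eval_warshall_potential {w : ℕ} (hw : w ≠ 3) {c : Fin n → ℕ} (hc : ∀ x, c x ≤ σ.sc 2)
    (h : ∀ a b, σ.arr w a b ≠ 0 → σ.arr 3 a b + c a = σ.sc 2 + c b) (a b : Fin n)
    (hab : ((warshall w).eval I env σ).arr w a b ≠ 0) :
    ((warshall w).eval I env σ).arr 3 a b + c a = σ.sc 2 + c b := by
  have := eval_loop_const (I := I) (env := env) (σ := σ) (k := 5)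
    (p := loop 3 (loop 4 (cond (((HExpr.arr w 3 5).and (.arr w 5 4)).and (HExpr.arr w 3 4).not)
        (seq (setArr w 3 4 (.lit 1)) (setArr 3 3 4
          (.sub (.add (.arr 3 3 5) (.arr 3 5 4)) (.sc 2)))))))
    (P := fun τ => τ.sc 2 = σ.sc 2 ∧ ∀ a b, τ.arr w a b ≠ 0 → τ.arr 3 a b + c a = σ.sc 2 + c b)
    ⟨rfl, h⟩ (fun k τ hτ => eval_loop_const (P := fun τ => τ.sc 2 = σ.sc 2 ∧ ∀ a b,
      τ.arr w a b ≠ 0 → τ.arr 3 a b + c a = σ.sc 2 + c b) hτ fun x τ hτ =>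
        eval_loop_const (P := fun τ => τ.sc 2 = σ.sc 2 ∧ ∀ a b,
          τ.arr w a b ≠ 0 → τ.arr 3 a b + c a = σ.sc 2 + c b) hτ fun y τ hτ => by
        rw [warshall_body hw]
        split_ifs with hcond
        · refine ⟨hτ.1, fun x' y' hxy' => ?_⟩
          simp only [State.setArr, hw, hw.symm, false_and, if_false, true_and] at hxy' ⊢
          by_cases hxy : x' = x ∧ y' = y
          · obtain ⟨rfl, rfl⟩ := hxy
            have h1 := hτ.2 _ _ hcond.1.1
            have h2 := hτ.2 _ _ hcond.1.2
            -- This bound makes the truncated subtraction of the shift exact.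
            have h3 := hc x'
            have h4 := hτ.1
            simp only [and_self, if_true]
            omega
          · rw [if_neg hxy] at hxy' ⊢
            exact hτ.2 _ _ hxy'
        · exact hτ)
  exact this.2 a b hab

/-- Array `A` holds the arcs of `R`, apart from loops. -/
def Matches (A : Fin n → Fin n → ℕ) (R : Digraph (Fin n)) : Prop :=
  ∀ x y, A x y ≠ 0 ↔ x ≠ y ∧ R.Adj x y

/-- Computes into array `w` the reachability relation of the digraph in array `0` without the
vertex `z`. -/
def reachAvoiding (w z : ℕ) : HProg :=
  seq (loop 3 (loop 4 (setArr w 3 4 (((HExpr.var 3).eq (.var z)).not.and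
    (((HExpr.var 4).eq (.var z)).not.and (((HExpr.var 3).eq (.var 4)).or (.arr 0 3 4)))))))
    (warshall w)

/-- Warshall's method gives a transitive closure without the reflexive pairs. Entering the diagonal
off `z` by hand turns it into reachability. -/
theorem transGen_avoiding_iff {R : Digraph (Fin n)} (z a b : Fin n) :
    Relation.TransGen (fun a b => a ≠ z ∧ b ≠ z ∧ (a = b ∨ a ≠ b ∧ R.Adj a b)) a b ↔
      a ≠ z ∧ b ≠ z ∧ ReachIn R {z}ᶜ a b := by
  constructor
  · intro h
    induction h with
    | single h =>
      refine ⟨h.1, h.2.1, ?_⟩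
      rcases h.2.2 with rfl | h'
      exacts [.refl, .single h'.2 h.1 h.2.1]
    | tail _ h ih =>
      refine ⟨ih.1, h.2.1, ih.2.2.trans ?_⟩
      rcases h.2.2 with rfl | h'
      exacts [.refl, .single h'.2 h.1 h.2.1]
  · rintro ⟨ha, hb, h⟩
    induction h with
    | refl => exact .single ⟨ha, ha, .inl rfl⟩
    | @tail y w _ h ih =>
      refine (ih h.2.1).tail ⟨h.2.1, h.2.2, ?_⟩
      by_cases hyw : y = w
      exacts [.inl hyw, .inr ⟨hyw, h.1⟩]

theorem eval_reachAvoiding {w z : ℕ} (hw : w ≠ 3) (hw0 : w ≠ 0) (hz3 : z ≠ 3) (hz4 : z ≠ 4)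
    {R : Digraph (Fin n)} (hA : Matches (σ.arr 0) R) (a b : Fin n) :
    ((reachAvoiding w z).eval I env σ).arr w a b ≠ 0 ↔
      a ≠ env z ∧ b ≠ env z ∧ ReachIn R {env z}ᶜ a b := by
  classical
  rw [reachAvoiding, eval, eval_warshall hw, ← transGen_avoiding_iff]
  rw [eval_fill (σ := σ) (g := fun x y => if x ≠ env z ∧ y ≠ env z ∧ (x = y ∨ x ≠ y ∧ R.Adj x y)
    then 1 else 0) (by decide)]
  · simp only [ite_ne_right_iff, ne_eq, one_ne_zero, not_false_eq_true, and_true]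
  · intro x y τ h1 _
    have : τ.arr 0 x y ≠ 0 ↔ _ := h1 0 hw0.symm ▸ hA x y
    simp only [ne_eq] at this
    simp [HExpr.eval, hz3, hz4, this, Fin.ext_iff]
    exact if_congr (by tauto) rfl rfl

end HProg

end RAM
end CRS

namespace CRS
namespace RAM
namespace HProg

variable {n : ℕ} {I : Fin n → Fin n → ℕ} {env : ℕ → Fin n} {σ τ : State n} {R : Digraph (Fin n)}

open HExpr (var lit arr sc size)

theorem sum_ite_ne_zero {α : Type*} [Fintype α] (p : α → Prop) [DecidablePred p] :
    (∑ x, if p x then 1 else 0) ≠ 0 ↔ ∃ x, p x := by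
  simp

/-! ### The greedy closure -/

/-- Adds the arcs between the values of the loop variables `0` and `1` if they are authorized. -/
def authorizePair : HProg :=
  seq (reachAvoiding 1 1) (seq (reachAvoiding 2 0) (seq (setSc 1 (lit 0))
    (seq (loop 2 (setSc 1 (.add (sc 1)
        (((arr 1 0 2).and (arr 1 2 0)).and ((arr 2 1 2).and (arr 2 2 1))))))
      (cond (((var 0).eq (var 1)).not.and (sc 1).not)
        (seq (setArr 0 0 1 (lit 1)) (setArr 0 1 0 (lit 1)))))))

theorem setArr_symm_ne_zero (σ : State n) (u v x y : Fin n) :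
    ((σ.setArr 0 u v 1).setArr 0 v u 1).arr 0 x y ≠ 0 ↔
      (x = u ∧ y = v) ∨ (x = v ∧ y = u) ∨ σ.arr 0 x y ≠ 0 := by
  simp only [State.setArr, true_and]
  split_ifs with h1 h2
  · simp [h1]
  · simp [h2]
  · simp only [h1, h2, false_or]

/-- The added inequalities are those recorded by `reachAvoiding`; they follow from reachability
without the forbidden vertex. -/
theorem isAuthorized_iff {u v : Fin n} : IsAuthorized R u v ↔ u ≠ v ∧ ∀ x,
    ¬ (((u ≠ v ∧ x ≠ v ∧ ReachIn R {v}ᶜ u x) ∧ x ≠ v ∧ u ≠ v ∧ ReachIn R {v}ᶜ x u) ∧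
      (v ≠ u ∧ x ≠ u ∧ ReachIn R {u}ᶜ v x) ∧ x ≠ u ∧ v ≠ u ∧ ReachIn R {u}ᶜ x v) := by
  refine and_congr_right fun huv => forall_congr' fun x => not_congr ?_
  rw [closedWalkAvoiding_iff huv, closedWalkAvoiding_iff huv.symm]
  constructor
  · rintro ⟨⟨h1, h2⟩, h3, h4⟩
    have hxv : x ≠ v := h1.mem_right huv
    have hxu : x ≠ u := h3.mem_right huv.symm
    exact ⟨⟨⟨huv, hxv, h1⟩, hxv, huv, h2⟩, ⟨huv.symm, hxu, h3⟩, hxu, huv.symm, h4⟩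
  · rintro ⟨⟨h1, h2⟩, h3, h4⟩
    exact ⟨⟨h1.2.2, h2.2.2⟩, h3.2.2, h4.2.2⟩

theorem Matches.addArcs {A A' : Fin n → Fin n → ℕ} {u v : Fin n} (h : Matches A R) (huv : u ≠ v)
    (hA' : ∀ x y, A' x y ≠ 0 ↔ (x = u ∧ y = v) ∨ (x = v ∧ y = u) ∨ A x y ≠ 0) :
    Matches A' (addArcs R u v) := by
  intro x y
  rw [hA', h x y]
  constructor
  · rintro (⟨rfl, rfl⟩ | ⟨rfl, rfl⟩ | ⟨h1, h2⟩)
    exacts [⟨huv, .inr (.inl ⟨rfl, rfl⟩)⟩, ⟨huv.symm, .inr (.inr ⟨rfl, rfl⟩)⟩, ⟨h1, .inl h2⟩]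
  · rintro ⟨h1, h2 | h2 | h2⟩
    exacts [.inr (.inr ⟨h1, h2⟩), .inl h2, .inr (.inl h2)]

/-- Scalar `1` counts the obstructing vertices `x`. The program does not test which arcs are
present: if both are, nothing changes, and if only `(v, u)` is missing, the pass is a greedy step
for that arc, since authorization is symmetric. -/
theorem eval_authorizePair (hA : Matches (σ.arr 0) R) :
    ∃ R', Relation.ReflTransGen GreedyStep R R' ∧
      Matches ((authorizePair.eval I env σ).arr 0) R' ∧
      (IsAuthorized R' (env 0) (env 1) → R'.Adj (env 0) (env 1)) := by
  classical
  set u := env 0 with hu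
  set v := env 1 with hv
  set σ₁ := (reachAvoiding 1 1).eval I env σ with hσ₁
  set σ₂ := (reachAvoiding 2 0).eval I env σ₁ with hσ₂
  set σ₃ := (setSc 1 (lit 0)).eval I env σ₂ with hσ₃
  set σ₄ := (loop 2 (setSc 1 (.add (sc 1)
        (((arr 1 0 2).and (arr 1 2 0)).and ((arr 2 1 2).and (arr 2 2 1)))))).eval I env σ₃ with hσ₄
  have hA₁ : σ₁.arr 0 = σ.arr 0 := eval_arr (by decide)
  have hA₂ : σ₂.arr 0 = σ.arr 0 := (eval_arr (by decide)).trans hA₁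
  have hA₄ : σ₄.arr 0 = σ.arr 0 := (eval_arr (by decide)).trans hA₂
  have h1 : ∀ a b, σ₂.arr 1 a b ≠ 0 ↔ a ≠ v ∧ b ≠ v ∧ ReachIn R {v}ᶜ a b := by
    have : σ₂.arr 1 = σ₁.arr 1 := eval_arr (by decide)
    rw [this]
    exact eval_reachAvoiding (by decide) (by decide) (by decide) (by decide) hA
  have h2 : ∀ a b, σ₂.arr 2 a b ≠ 0 ↔ a ≠ u ∧ b ≠ u ∧ ReachIn R {u}ᶜ a b :=
    eval_reachAvoiding (by decide) (by decide) (by decide) (by decide) (hA₁ ▸ hA)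
  have hsum : σ₄.sc 1 = σ₃.sc 1 + ∑ x, if ((u ≠ v ∧ x ≠ v ∧ ReachIn R {v}ᶜ u x) ∧ x ≠ v ∧ u ≠ v ∧
      ReachIn R {v}ᶜ x u) ∧ (v ≠ u ∧ x ≠ u ∧ ReachIn R {u}ᶜ v x) ∧ x ≠ u ∧ v ≠ u ∧
      ReachIn R {u}ᶜ x v then 1 else 0 := by
    refine eval_sum fun x τ hτ _ => ?_
    have e1 : τ.arr 1 = σ₂.arr 1 := congrFun hτ 1
    have e2 : τ.arr 2 = σ₂.arr 2 := congrFun hτ 2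
    simp only [HExpr.eval_and, HExpr.eval, ite_ne_right_iff, ne_eq, one_ne_zero, not_false_eq_true,
      and_true, e1, e2]
    simp only [← ne_eq, h1, h2]
    simp [← hu, ← hv]
  have hzero : σ₃.sc 1 = 0 := by simp [hσ₃, eval, HExpr.eval]
  rw [hzero, zero_add] at hsum
  have hauth : IsAuthorized R u v ↔ u ≠ v ∧ σ₄.sc 1 = 0 := by
    rw [isAuthorized_iff, hsum]
    refine and_congr_right fun _ => ?_
    rw [← not_iff_not, ← ne_eq (Finset.sum _ _), sum_ite_ne_zero, not_forall]
    simp only [not_not]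
  have heval : authorizePair.eval I env σ = if u ≠ v ∧ σ₄.sc 1 = 0 then
      (σ₄.setArr 0 u v 1).setArr 0 v u 1 else σ₄ := by
    have : authorizePair.eval I env σ = (cond (((var 0).eq (var 1)).not.and (sc 1).not)
        (seq (setArr 0 0 1 (lit 1)) (setArr 0 1 0 (lit 1)))).eval I env σ₄ := rfl
    rw [this]
    clear_value σ₄
    clear hsum hauth
    by_cases h1 : u = v <;> by_cases h2 : σ₄.sc 1 = 0 <;>
      simp [eval, HExpr.eval, ← hu, ← hv, h1, h2, ← Fin.ext_iff]
  rw [heval]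
  split_ifs with hc
  · have auth := hauth.2 hc
    have hM : Matches (((σ₄.setArr 0 u v 1).setArr 0 v u 1).arr 0) (addArcs R u v) := by
      refine Matches.addArcs (A := σ₄.arr 0) (hA₄ ▸ hA) hc.1 fun x y => ?_
      exact setArr_symm_ne_zero σ₄ u v x y
    by_cases hboth : R.Adj u v ∧ R.Adj v u
    · have : addArcs R u v = R := by
        refine Digraph.ext (funext fun a => funext fun b => propext ⟨?_, .inl⟩)
        rintro (h | ⟨rfl, rfl⟩ | ⟨rfl, rfl⟩)
        exacts [h, hboth.1, hboth.2]
      rw [this] at hM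
      exact ⟨R, .refl, hM, fun _ => hboth.1⟩
    · refine ⟨addArcs R u v, .single ?_, hM, fun _ => .inr (.inl ⟨rfl, rfl⟩)⟩
      by_cases h : R.Adj u v
      · refine ⟨v, u, auth.symm, fun h' => hboth ⟨h, h'⟩, ?_⟩
        refine Digraph.ext (funext fun a => funext fun b => propext ?_)
        simp only [CRS.addArcs]
        tauto
      · exact ⟨u, v, auth, h, rfl⟩
  · exact ⟨R, .refl, hA₄ ▸ hA, fun h => absurd (hauth.1 h) hc⟩

/-- Adds the arcs between all pairs that are authorized when they are treated. -/
def greedy : HProg := loop 0 (loop 1 authorizePair)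

/-- A single sweep suffices: a pair authorized at the end was authorized when it was treated, by
`IsAuthorized.anti`, and received its arcs then. -/
theorem eval_greedy (hA : Matches (σ.arr 0) R) :
    ∃ R', Relation.ReflTransGen GreedyStep R R' ∧ Matches ((greedy.eval I env σ).arr 0) R' ∧
      ∀ u v, IsAuthorized R' u v → R'.Adj u v := by
  obtain ⟨R', h1, h2, h3⟩ := eval_loop2_inv (I := I) (env := env) (σ := σ) (p := authorizePair)
    (k := 0) (l := 1)
    (fun s τ => ∃ R', Relation.ReflTransGen GreedyStep R R' ∧ Matches (τ.arr 0) R' ∧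
      ∀ u v, (u, v) ∈ s → IsAuthorized R' u v → R'.Adj u v) ⟨R, .refl, hA, by simp⟩
    (fun s x y τ _ ⟨R', h1, h2, h3⟩ => by
      obtain ⟨R'', k1, k2, k3⟩ := eval_authorizePair (I := I)
        (env := Function.update (Function.update env 0 x) 1 y) h2
      refine ⟨R'', h1.trans k1, k2, fun u v huv auth => ?_⟩
      rcases Finset.mem_insert.1 huv with heq | huv
      · obtain ⟨rfl, rfl⟩ := Prod.mk.inj heq
        simpa using k3 (by simpa using auth)
      · exact le_of_greedySteps k1 u v (h3 u v huv (auth.anti (le_of_greedySteps k1))))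
  exact ⟨R', h1, h2, fun u v => h3 u v (Finset.mem_univ _)⟩

end HProg
end RAM
end CRS

namespace CRS
namespace RAM
namespace HProg

variable {n : ℕ} {I : Fin n → Fin n → ℕ} {env : ℕ → Fin n} {σ τ : State n} {R : Digraph (Fin n)}

open HExpr (var lit arr sc size)

/-- Copies the input matrix into array `0`. -/
def copyInput : HProg := loop 0 (loop 1 (setArr 0 0 1 (.inp 0 1)))

theorem eval_copyInput : (copyInput.eval I env σ).arr 0 = I :=
  eval_fill (by decide) fun x y τ _ _ => by simp [HExpr.eval]

theorem matches_matrix : Matches (matrix R) R := fun x y => by simp [matrix]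

/-! ### Ranks and local acyclicity -/

/-- The test whether two vertices are joined by a forced edge. -/
def forced (k l : ℕ) : HExpr := (arr 0 k l).and (arr 0 l k)

theorem Matches.forced_iff {A : Fin n → Fin n → ℕ} (h : Matches A R) (x y : Fin n) :
    A x y ≠ 0 ∧ A y x ≠ 0 ↔ (forcedGraph R).Adj x y := by
  rw [h x y, h y x]
  exact ⟨fun h => ⟨h.1.1, h.1.2, h.2.2⟩, fun h => ⟨⟨h.1, h.2.1⟩, h.1.symm, h.2.2⟩⟩

open Classical in
theorem eval_forced (hA : Matches (τ.arr 0) R) (k l : ℕ) :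
    (forced k l).eval I env τ = if (forcedGraph R).Adj (env k) (env l) then 1 else 0 := by
  rw [forced, HExpr.eval_and]
  exact if_congr (hA.forced_iff _ _) rfl rfl

/-- Row `x` of the ranks, for the value `x` of the loop variable `0`. -/
def rankRow : HProg :=
  loop 1 (seq (setSc 0 (lit 0)) (seq
    (loop 2 (setSc 0 (.add (sc 0)
      ((forced 0 2).and (((var 2).eq (var 1)).not.and (arr 1 2 1))))))
    (setArr 4 0 1 (sc 0))))

theorem rank_eq_sum [DecidableRel (forcedGraph R).Adj] {x y : Fin n} {A : Fin n → Fin n → ℕ}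
    (h : ∀ a b, A a b ≠ 0 ↔ a ≠ x ∧ b ≠ x ∧ ReachIn R {x}ᶜ a b) :
    rank R x y = ∑ z, if (forcedGraph R).Adj x z ∧ z ≠ y ∧ A z y ≠ 0 then 1 else 0 := by
  rw [Finset.sum_boole, Nat.cast_id, rank, ← Set.ncard_coe_finset]
  congr 1
  ext z
  simp only [Set.mem_ofPred_eq, Finset.coe_filter, Finset.mem_univ, true_and, h]
  refine and_congr_right fun hz => and_congr_right fun _ => ⟨fun hr => ?_, fun hr => hr.2.2⟩
  exact ⟨hz.ne.symm, hr.mem_right (show z ∈ ({x}ᶜ : Set (Fin n)) from hz.ne.symm), hr⟩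

theorem eval_rankRow (hA : Matches (σ.arr 0) R)
    (h1 : ∀ a b, σ.arr 1 a b ≠ 0 ↔ a ≠ env 0 ∧ b ≠ env 0 ∧ ReachIn R {env 0}ᶜ a b) :
    (∀ y, (rankRow.eval I env σ).arr 4 (env 0) y = rank R (env 0) y) ∧
      ∀ x ≠ env 0, ∀ y, (rankRow.eval I env σ).arr 4 x y = σ.arr 4 x y := by
  classical
  have := eval_loop_inv (I := I) (env := env) (σ := σ) (k := 1)
    (p := seq (setSc 0 (lit 0)) (seq
      (loop 2 (setSc 0 (.add (sc 0)
        ((forced 0 2).and (((var 2).eq (var 1)).not.and (arr 1 2 1))))))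
      (setArr 4 0 1 (sc 0))))
    (fun s τ => τ.arr 0 = σ.arr 0 ∧ τ.arr 1 = σ.arr 1 ∧
      (∀ y ∈ s, τ.arr 4 (env 0) y = rank R (env 0) y) ∧
      ∀ x ≠ env 0, ∀ y, τ.arr 4 x y = σ.arr 4 x y)
    (by simp) (fun s y τ hy ⟨e0, e1, h4, h4'⟩ => by
      refine ⟨(eval_arr (by decide)).trans e0, (eval_arr (by decide)).trans e1, ?_⟩
      have hsum := eval_sum (I := I) (env := Function.update env 1 y)
        (σ := HProg.eval I (setSc 0 (lit 0)) (Function.update env 1 y) τ) (i := 0) (k := 2)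
        (e := (forced 0 2).and (((var 2).eq (var 1)).not.and (arr 1 2 1)))
        (g := fun z => if (forcedGraph R).Adj (env 0) z ∧ z ≠ y ∧ σ.arr 1 z y ≠ 0 then 1 else 0)
        (fun z ρ hρ _ => by
          have hρ1 : ρ.arr 1 = σ.arr 1 := (congrFun hρ 1).trans e1
          have hρ0 : ρ.arr 0 = σ.arr 0 := (congrFun hρ 0).trans e0
          simp [HExpr.eval, eval_forced (hρ0 ▸ hA), hρ1, Fin.ext_iff])
      rw [← rank_eq_sum h1] at hsum
      have hz : (HProg.eval I (setSc 0 (lit 0)) (Function.update env 1 y) τ).sc 0 = 0 := by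
        simp [eval, HExpr.eval]
      rw [hz, zero_add] at hsum
      set ρ := HProg.eval I (loop 2 _) _ _ with hρ
      have h5 : ρ.arr 4 = τ.arr 4 := by rw [hρ, eval_arr (by decide), eval_arr (by decide)]
      have step : HProg.eval I (seq (setSc 0 (lit 0)) (seq (loop 2 (setSc 0 (.add (sc 0)
          ((forced 0 2).and (((var 2).eq (var 1)).not.and (arr 1 2 1)))))) (setArr 4 0 1 (sc 0))))
          (Function.update env 1 y) τ = ρ.setArr 4 (env 0) y (ρ.sc 0) := rfl
      rw [step]
      simp only [State.setArr, hsum, h5, true_and]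
      refine ⟨fun y' hy' => ?_, fun x hx y' => ?_⟩
      · split_ifs with h
        · rw [h]
        · exact h4 y' ((Finset.mem_insert.1 hy').resolve_left h)
      · rw [if_neg fun h => hx h.1, h4' x hx])
  exact ⟨fun y => this.2.2.1 y (Finset.mem_univ y), this.2.2.2⟩

/-- Adds to scalar `1` the number of pairs of distinct forced neighbours of the loop variable `0`
that are mutually reachable in the sense of array `1`. -/
def countCycles : HProg :=
  loop 1 (loop 2 (setSc 1 (.add (sc 1) (((forced 0 1).and (forced 0 2)).and
    (((var 1).eq (var 2)).not.and ((arr 1 1 2).and (arr 1 2 1)))))))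

theorem eval_countCycles (hA : Matches (σ.arr 0) R)
    (h1 : ∀ a b, σ.arr 1 a b ≠ 0 ↔ a ≠ env 0 ∧ b ≠ env 0 ∧ ReachIn R {env 0}ᶜ a b) :
    (countCycles.eval I env σ).sc 1 = 0 ↔ σ.sc 1 = 0 ∧
      ∀ y z, (forcedGraph R).Adj (env 0) y → (forcedGraph R).Adj (env 0) z → y ≠ z →
        ¬ (ReachIn R {env 0}ᶜ y z ∧ ReachIn R {env 0}ᶜ z y) := by
  classical
  rw [countCycles, eval_sum2 (g := fun y z => if ((forcedGraph R).Adj (env 0) y ∧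
    (forcedGraph R).Adj (env 0) z) ∧ y ≠ z ∧ σ.arr 1 y z ≠ 0 ∧ σ.arr 1 z y ≠ 0 then 1 else 0)]
  · rw [Nat.add_eq_zero_iff, ← not_iff_not (b := _ ∧ _)]
    refine not_congr (and_congr_right fun _ => ?_)
    rw [← not_iff_not, ← ne_eq (Finset.sum _ _), sum_ite_ne_zero
      fun q : Fin n × Fin n => ((forcedGraph R).Adj (env 0) q.1 ∧
    (forcedGraph R).Adj (env 0) q.2) ∧ q.1 ≠ q.2 ∧ σ.arr 1 q.1 q.2 ≠ 0 ∧ σ.arr 1 q.2 q.1 ≠ 0]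
    simp only [h1, Prod.exists]
    push Not
    refine exists_congr fun y => exists_congr fun z => ?_
    constructor
    · rintro ⟨⟨hy, hz⟩, hne, h2, h3⟩
      exact ⟨hy, hz, hne, h2.2.2, h3.2.2⟩
    · rintro ⟨hy, hz, hne, h2, h3⟩
      exact ⟨⟨hy, hz⟩, hne, ⟨hy.ne.symm, hz.ne.symm, h2⟩, hz.ne.symm, hy.ne.symm, h3⟩
  · intro y z τ hτ _
    have hτ1 : τ.arr 1 = σ.arr 1 := congrFun hτ 1
    have hτ0 : τ.arr 0 = σ.arr 0 := congrFun hτ 0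
    simp [HExpr.eval, eval_forced (hτ0 ▸ hA), hτ1, Fin.ext_iff]

/-- Computes the ranks into array `4`; scalar `1` becomes `0` if the digraph in array `0` is
locally acyclic. -/
def ranks : HProg :=
  seq (setSc 1 (lit 0)) (loop 0 (seq (reachAvoiding 1 0) (seq rankRow countCycles)))

theorem eval_ranks (hA : Matches (σ.arr 0) R) :
    (ranks.eval I env σ).arr 4 = rank R ∧
      ((ranks.eval I env σ).sc 1 = 0 ↔ IsLocallyAcyclic R) := by
  have := eval_loop_inv (I := I) (env := env) (k := 0)
    (σ := HProg.eval I (setSc 1 (lit 0)) env σ)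
    (p := seq (reachAvoiding 1 0) (seq rankRow countCycles))
    (fun s τ => τ.arr 0 = σ.arr 0 ∧ (∀ x ∈ s, ∀ y, τ.arr 4 x y = rank R x y) ∧
      (τ.sc 1 = 0 ↔ ∀ x ∈ s, ∀ y z, (forcedGraph R).Adj x y → (forcedGraph R).Adj x z → y ≠ z →
        ¬ (ReachIn R {x}ᶜ y z ∧ ReachIn R {x}ᶜ z y)))
    (by simp [eval, HExpr.eval]) (fun s x τ hx ⟨e0, h4, hsc⟩ => by
      refine ⟨(eval_arr (by decide)).trans e0, ?_⟩
      rw [eval, eval]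
      set e := Function.update env 0 x with he
      have hx' : e 0 = x := by simp [he]
      set τ₁ := HProg.eval I (reachAvoiding 1 0) e τ with hτ₁
      have h0 : τ₁.arr 0 = σ.arr 0 := (eval_arr (by decide)).trans e0
      have h1 : ∀ a b, τ₁.arr 1 a b ≠ 0 ↔ a ≠ e 0 ∧ b ≠ e 0 ∧ ReachIn R {e 0}ᶜ a b :=
        eval_reachAvoiding (by decide) (by decide) (by decide) (by decide) (e0 ▸ hA)
      have h4₁ : τ₁.arr 4 = τ.arr 4 := eval_arr (by decide)
      have hsc₁ : τ₁.sc 1 = τ.sc 1 := eval_sc (by decide)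
      obtain ⟨k1, k2⟩ := eval_rankRow (I := I) (h0 ▸ hA) h1
      set τ₂ := HProg.eval I rankRow e τ₁ with hτ₂
      have h0₂ : τ₂.arr 0 = σ.arr 0 := (eval_arr (by decide)).trans h0
      have h1₂ : τ₂.arr 1 = τ₁.arr 1 := eval_arr (by decide)
      have hsc₂ : τ₂.sc 1 = τ.sc 1 := (eval_sc (by decide)).trans hsc₁
      constructor
      · intro x' hmem y
        rw [eval_arr (by decide)]
        by_cases hxx : x' = x
        · rw [hxx, ← hx', k1]
        · rw [k2 x' (hx' ▸ hxx), h4₁]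
          exact h4 x' ((Finset.mem_insert.1 hmem).resolve_left hxx) y
      · rw [eval_countCycles (h0₂ ▸ hA) (h1₂ ▸ h1), hsc₂, hsc, hx', Finset.forall_mem_insert,
          and_comm])
  exact ⟨funext fun x => funext fun y => this.2.1 x (Finset.mem_univ x) y,
    this.2.2.trans ⟨fun h x => h x (Finset.mem_univ x), fun h x _ => h x⟩⟩

end HProg
end RAM
end CRS

namespace CRS

/-- The ordered pairs of adjacent vertices correspond to the edges. -/
theorem card_edgeSet_eq_card_filter {n : ℕ} (T : SimpleGraph (Fin n)) [DecidableRel T.Adj] :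
    Nat.card T.edgeSet =
      (Finset.univ.filter fun q : Fin n × Fin n => T.Adj q.1 q.2 ∧ q.1 < q.2).card := by
  rw [Nat.card_coe_set_eq, ← Set.ncard_coe_finset]
  symm
  refine Set.ncard_congr (fun q _ => s(q.1, q.2)) ?_ ?_ ?_
  · rintro q hq
    simpa using (by simpa using hq : T.Adj q.1 q.2 ∧ q.1 < q.2).1
  · rintro ⟨a, b⟩ ⟨c, d⟩ h1 h2 h
    simp only [Finset.coe_filter, Finset.mem_univ, true_and, Set.mem_ofPred_eq] at h1 h2
    rcases Sym2.eq_iff.1 h with ⟨rfl, rfl⟩ | ⟨rfl, rfl⟩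
    · rfl
    · exact absurd h1.2 h2.2.asymm
  · intro e he
    induction e with
    | _ a b =>
      have hab : T.Adj a b := he
      rcases hab.ne.lt_or_gt with h | h
      · exact ⟨(a, b), by simp [hab, h], rfl⟩
      · exact ⟨(b, a), by simp [hab.symm, h], Sym2.eq_swap⟩

namespace RAM
namespace HProg

variable {n : ℕ} {I : Fin n → Fin n → ℕ} {env : ℕ → Fin n} {σ τ : State n} {R : Digraph (Fin n)}

open HExpr (var lit arr sc size)

/-! ### The tree of forced edges -/

/-- Sets scalar `2` to the square of the size. -/
def setSquare : HProg := seq (setSc 2 (lit 0)) (loop 0 (setSc 2 (.add (sc 2) size)))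

/-- Computes the connectivity of the forced edges into array `1`, and differences of a potential
into array `3`. -/
def connect : HProg :=
  seq (loop 3 (loop 4 (setArr 1 3 4 (((var 3).eq (var 4)).or (forced 3 4)))))
    (seq (loop 3 (loop 4 (setArr 3 3 4 (.sub (.add (sc 2) (arr 4 3 4)) (arr 4 4 3)))))
      (warshall 1))

/-- Adds to scalar `1` the number of pairs that are not related in array `1`. -/
def countDisconnected : HProg := loop 3 (loop 4 (setSc 1 (.add (sc 1) (arr 1 3 4).not)))

/-- Adds `1` to scalar `1` unless the number of forced edges is one less than the size. -/
def checkEdges : HProg :=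
  seq (setSc 3 (lit 0)) (seq
    (loop 3 (loop 4 (setSc 3 (.add (sc 3) ((forced 3 4).and ((var 3).lt (var 4)))))))
    (setSc 1 (.add (sc 1) ((HExpr.add (sc 3) (lit 1)).eq size).not)))

/-- Computes the labels into array `5`. -/
def labels : HProg :=
  loop 0 (loop 3 (loop 4 (setArr 5 3 4 (.add (.add (arr 3 0 3) (arr 4 3 4)) (lit 1)))))

/-- With `n` vertices and ranks at most `n`, this is the bound of `exists_bounded_potential`. It
serves as the shift that keeps potential differences nonnegative. -/
theorem eval_setSquare : (setSquare.eval I env σ).sc 2 = n * n := by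
  rw [setSquare, eval, eval_sum (g := fun _ => n) (fun _ _ _ _ => rfl)]
  simp [eval, HExpr.eval]

/-- Along a forced edge the difference of the potential is known from array `4` alone, and
Warshall's method extends it to all connected pairs. The potential `c` itself occurs only in the
proof. -/
theorem eval_connect (hA : Matches (σ.arr 0) R) :
    (∀ x y, (connect.eval I env σ).arr 1 x y ≠ 0 ↔ (forcedGraph R).Reachable x y) ∧
    ∀ c : Fin n → ℕ, (∀ x, c x ≤ σ.sc 2) → (∀ x y, σ.arr 4 x y ≤ σ.sc 2) →
      (∀ x y, (forcedGraph R).Adj x y → c x + σ.arr 4 x y = c y + σ.arr 4 y x) → ∀ x y,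
      (forcedGraph R).Reachable x y → (connect.eval I env σ).arr 3 x y + c x = σ.sc 2 + c y := by
  classical
  set σ₁ := HProg.eval I (loop 3 (loop 4 (setArr 1 3 4 (((var 3).eq (var 4)).or (forced 3 4)))))
    env σ with hσ₁
  set σ₂ := HProg.eval I (loop 3 (loop 4 (setArr 3 3 4 (.sub (.add (sc 2) (arr 4 3 4))
    (arr 4 4 3))))) env σ₁ with hσ₂
  have h4 : σ₁.arr 4 = σ.arr 4 := eval_arr (by decide)
  have hs₁ : σ₁.sc 2 = σ.sc 2 := eval_sc (by decide)
  have hs₂ : σ₂.sc 2 = σ.sc 2 := (eval_sc (by decide)).trans hs₁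
  have e1 : σ₂.arr 1 = fun x y => if x = y ∨ (forcedGraph R).Adj x y then 1 else 0 := by
    rw [hσ₂, eval_arr (by decide)]
    refine eval_fill (by decide) fun x y τ hτ _ => ?_
    simp [HExpr.eval, eval_forced (hτ 0 (by decide) ▸ hA), Fin.ext_iff]
  have e3 : σ₂.arr 3 = fun x y => σ.sc 2 + σ.arr 4 x y - σ.arr 4 y x := by
    refine eval_fill (by decide) fun x y τ hτ hsc => ?_
    simp [HExpr.eval, hτ 4 (by decide), hsc, h4, hs₁]
  have hreach : ∀ x y, ((warshall 1).eval I env σ₂).arr 1 x y ≠ 0 ↔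
      (forcedGraph R).Reachable x y := by
    intro x y
    rw [eval_warshall (by decide), SimpleGraph.reachable_iff_reflTransGen, e1]
    simp only [ne_eq, ite_eq_right_iff, one_ne_zero, imp_false, not_not]
    constructor
    · intro h
      induction h with
      | single h => exact h.elim (fun h => h ▸ .refl) .single
      | tail _ h ih => exact h.elim (fun h => h ▸ ih) ih.tail
    · intro h
      induction h with
      | refl => exact .single (.inl rfl)
      | tail _ h ih => exact ih.tail (.inr h)
  refine ⟨hreach, fun c hc hle hadj x y hxy => ?_⟩
  have := eval_warshall_potential (I := I) (env := env) (σ := σ₂) (w := 1) (by decide) (c := c)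
    (fun x => hs₂ ▸ hc x) (fun a b hab => by
      rw [e3, hs₂]
      dsimp only
      have l1 := hle a b
      have l2 := hle b a
      rw [e1] at hab
      simp only [ne_eq, ite_eq_right_iff, one_ne_zero, imp_false, not_not] at hab
      rcases hab with rfl | hab
      · omega
      · have := hadj a b hab
        omega) x y ((hreach x y).2 hxy)
  rwa [hs₂] at this

theorem eval_countDisconnected : (countDisconnected.eval I env σ).sc 1 = 0 ↔
    σ.sc 1 = 0 ∧ ∀ x y, σ.arr 1 x y ≠ 0 := by
  rw [countDisconnected, eval_sum2 (g := fun x y => if σ.arr 1 x y = 0 then 1 else 0)]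
  · rw [Nat.add_eq_zero_iff, ← not_iff_not (b := _ ∧ _)]
    refine not_congr (and_congr_right fun _ => ?_)
    rw [← not_iff_not, ← ne_eq (Finset.sum _ _),
      sum_ite_ne_zero fun q : Fin n × Fin n => σ.arr 1 q.1 q.2 = 0]
    simp
  · intro x y τ hτ _
    simp [HExpr.eval, congrFun hτ 1]

theorem eval_checkEdges (hA : Matches (σ.arr 0) R) : (checkEdges.eval I env σ).sc 1 = 0 ↔
    σ.sc 1 = 0 ∧ Nat.card (forcedGraph R).edgeSet + 1 = n := by
  classical
  have hsum := eval_sum2 (I := I) (env := env) (σ := HProg.eval I (setSc 3 (lit 0)) env σ) (i := 3)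
    (k := 3) (l := 4) (e := (forced 3 4).and ((var 3).lt (var 4)))
    (g := fun x y => if (forcedGraph R).Adj x y ∧ x < y then 1 else 0) (fun x y τ hτ _ => by
      have hτ0 : τ.arr 0 = σ.arr 0 := congrFun hτ 0
      simp [HExpr.eval, eval_forced (hτ0 ▸ hA)])
  have hz : (HProg.eval I (setSc 3 (lit 0)) env σ).sc 3 = 0 := by simp [eval, HExpr.eval]
  rw [hz, zero_add, Finset.sum_boole, Nat.cast_id, ← card_edgeSet_eq_card_filter] at hsum
  set ρ := HProg.eval I (loop 3 _) _ _ with hρ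
  have h1 : ρ.sc 1 = σ.sc 1 := by rw [hρ, eval_sc (by decide), eval_sc (by decide)]
  have step : checkEdges.eval I env σ =
    HProg.eval I (setSc 1 (.add (sc 1) ((HExpr.add (sc 3) (lit 1)).eq size).not)) env ρ := rfl
  rw [step]
  clear_value ρ
  simp [eval, HExpr.eval, h1, hsum]

/-- The language has no constant vertices, so a root is obtained by looping over all of them. Each
pass overwrites the previous labels, and which root survives is irrelevant. -/
theorem eval_labels (hn : 0 < n) : ∃ r, ∀ x y,
    (labels.eval I env σ).arr 5 x y = σ.arr 3 r x + σ.arr 4 x y + 1 := by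
  have := eval_loop_inv (I := I) (env := env) (σ := σ) (k := 0)
    (p := loop 3 (loop 4 (setArr 5 3 4 (.add (.add (arr 3 0 3) (arr 4 3 4)) (lit 1)))))
    (fun s τ => τ.arr 3 = σ.arr 3 ∧ τ.arr 4 = σ.arr 4 ∧
      (s.Nonempty → ∃ r, ∀ x y, τ.arr 5 x y = σ.arr 3 r x + σ.arr 4 x y + 1))
    (by simp) (fun s r τ _ ⟨h3, h4, _⟩ => by
      refine ⟨(eval_arr (by decide)).trans h3, (eval_arr (by decide)).trans h4, fun _ => ⟨r, ?_⟩⟩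
      intro x y
      rw [eval_fill (g := fun x y => σ.arr 3 r x + σ.arr 4 x y + 1) (by decide)]
      intro x y ρ hρ _
      simp [HExpr.eval, hρ 3 (by decide), hρ 4 (by decide), h3, h4])
  exact this.2.2 ⟨⟨0, hn⟩, Finset.mem_univ _⟩

/-- Computes the labels of the forced edges into array `5`. Scalar `1` stays `0` if the forced edges
form a tree. -/
def labelTree : HProg :=
  seq setSquare (seq connect (seq countDisconnected (seq checkEdges labels)))

theorem eval_labelTree (hn : 0 < n) (hA : Matches (σ.arr 0) R) (h4 : σ.arr 4 = rank R) :
    ((labelTree.eval I env σ).sc 1 = 0 ↔ σ.sc 1 = 0 ∧ (forcedGraph R).IsTree) ∧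
    ((forcedGraph R).IsTree → ∃ c : Fin n → ℕ,
      (∀ x y, (forcedGraph R).Adj x y → c x + rank R x y = c y + rank R y x) ∧
      ∀ x y, (labelTree.eval I env σ).arr 5 x y = c x + rank R x y + 1) := by
  have : Nonempty (Fin n) := ⟨⟨0, hn⟩⟩
  rw [labelTree, eval, eval, eval, eval]
  set σ₁ := setSquare.eval I env σ with hσ₁
  have a0 : σ₁.arr 0 = σ.arr 0 := eval_arr (by decide)
  have a4 : σ₁.arr 4 = rank R := (eval_arr (by decide)).trans h4
  have s1 : σ₁.sc 1 = σ.sc 1 := eval_sc (by decide)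
  have s2 : σ₁.sc 2 = n * n := eval_setSquare
  obtain ⟨hreach, hpot⟩ := eval_connect (I := I) (env := env) (a0 ▸ hA)
  set σ₂ := connect.eval I env σ₁ with hσ₂
  have b0 : σ₂.arr 0 = σ.arr 0 := (eval_arr (by decide)).trans a0
  have b4 : σ₂.arr 4 = rank R := (eval_arr (by decide)).trans a4
  have t1 : σ₂.sc 1 = σ.sc 1 := (eval_sc (by decide)).trans s1
  set σ₃ := countDisconnected.eval I env σ₂ with hσ₃
  have c0 : σ₃.arr 0 = σ.arr 0 := (eval_arr (by decide)).trans b0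
  have hdis : σ₃.sc 1 = 0 ↔ _ := eval_countDisconnected
  set σ₄ := checkEdges.eval I env σ₃ with hσ₄
  have d3 : σ₄.arr 3 = σ₂.arr 3 := (eval_arr (by decide)).trans (eval_arr (by decide))
  have d4 : σ₄.arr 4 = rank R := (eval_arr (by decide)).trans ((eval_arr (by decide)).trans b4)
  have hedge : σ₄.sc 1 = 0 ↔ _ := eval_checkEdges (c0 ▸ hA)
  constructor
  · rw [eval_sc (by decide), hedge, hdis, t1, SimpleGraph.isTree_iff_connected_and_card,
      SimpleGraph.connected_iff]
    simp only [hreach, Nat.card_eq_fintype_card (α := Fin n), Fintype.card_fin]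
    exact ⟨fun h => ⟨h.1.1, ⟨h.1.2, this⟩, h.2⟩, fun h => ⟨⟨h.1, h.2.1.1⟩, h.2.2⟩⟩
  · intro hT
    obtain ⟨c, hc, hadj⟩ := exists_bounded_potential hT (rank R) _ fun x y => rank_le
    rw [Fintype.card_fin] at hc
    obtain ⟨r, hr⟩ := eval_labels (I := I) (env := env) (σ := σ₄) hn
    -- Row `r` of array `3` differs from `c` by a constant, so it is a potential as well.
    have hD : ∀ x, σ₂.arr 3 r x + c r = n * n + c x := fun x => s2 ▸ hpot c (s2 ▸ hc)
      (fun x y => by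
        rw [a4, s2]
        exact (rank_le.trans (Fintype.card_fin n).le).trans (Nat.le_mul_self n))
      (a4 ▸ hadj) r x (hT.connected.preconnected r x)
    refine ⟨σ₂.arr 3 r, fun x y hxy => ?_, fun x y => by rw [hr, d3, d4]⟩
    have h1 := hD x
    have h2 := hD y
    have h3 := hadj x y hxy
    omega

/-! ### Output -/

/-- Emits the forced edges with their labels. -/
def emitEdges : HProg :=
  loop 3 (loop 4 (cond ((forced 3 4).and ((var 3).lt (var 4))) (emit 3 4 (arr 5 3 4))))

/-- The condition `x < y` selects each edge once. By `hcard` there is still room whenever an edge is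
emitted, so the capacity test never drops a triple. -/
theorem eval_emitEdges (hA : Matches (σ.arr 0) R) (hout : σ.out = [])
    (hcard : Nat.card (forcedGraph R).edgeSet ≤ n) :
    (emitEdges.eval I env σ).out.Nodup ∧ ∀ e, e ∈ (emitEdges.eval I env σ).out ↔
      ((forcedGraph R).Adj e.1 e.2.1 ∧ e.1 < e.2.1) ∧ e.2.2 = σ.arr 5 e.1 e.2.1 := by
  classical
  rw [card_edgeSet_eq_card_filter] at hcard
  have := eval_loop2_inv (I := I) (env := env) (σ := σ) (k := 3) (l := 4)
    (p := cond ((forced 3 4).and ((var 3).lt (var 4))) (emit 3 4 (arr 5 3 4)))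
    (fun s τ => τ.arr = σ.arr ∧
      τ.out.length = (s.filter fun q => (forcedGraph R).Adj q.1 q.2 ∧ q.1 < q.2).card ∧
      τ.out.Nodup ∧ ∀ e, e ∈ τ.out ↔ (e.1, e.2.1) ∈ s ∧
        ((forcedGraph R).Adj e.1 e.2.1 ∧ e.1 < e.2.1) ∧ e.2.2 = σ.arr 5 e.1 e.2.1)
    (by simp [hout]) (fun s x y τ hs ⟨h1, h2, h3, h4⟩ => by
      have hτ0 : τ.arr 0 = σ.arr 0 := congrFun h1 0
      have step : HProg.eval I (cond ((forced 3 4).and ((var 3).lt (var 4))) (emit 3 4 (arr 5 3 4)))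
          (Function.update (Function.update env 3 x) 4 y) τ =
          if (forcedGraph R).Adj x y ∧ x < y then
            if τ.out.length < n then { τ with out := τ.out ++ [(x, y, σ.arr 5 x y)] } else τ
          else τ := by
        simp [eval, HExpr.eval, eval_forced (hτ0 ▸ hA), h1]
      rw [step]
      split_ifs with hc hlt
      · refine ⟨h1, ?_, ?_, fun e => ?_⟩
        · rw [Finset.filter_insert, if_pos hc, Finset.card_insert_of_notMem (by simp [hs])]
          simp [h2]
        · refine List.nodup_append.2 ⟨h3, by simp, fun e he e' he' => ?_⟩
          rintro rfl
          rw [List.mem_singleton] at he'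
          subst he'
          exact hs ((h4 _).1 he).1
        · obtain ⟨a, b, t⟩ := e
          simp only [List.mem_append, List.mem_singleton, h4, Finset.mem_insert, Prod.mk.injEq]
          constructor
          · rintro (h | ⟨rfl, rfl, rfl⟩)
            exacts [⟨.inr h.1, h.2⟩, ⟨.inl ⟨rfl, rfl⟩, hc, rfl⟩]
          · rintro ⟨⟨rfl, rfl⟩ | h, h'⟩
            exacts [.inr ⟨rfl, rfl, h'.2⟩, .inl ⟨h, h'⟩]
      · refine absurd (lt_of_lt_of_le ?_ hcard) hlt
        rw [h2]
        refine Finset.card_lt_card (Finset.ssubset_iff_of_subset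
          (Finset.filter_subset_filter _ (Finset.subset_univ s)) |>.2 ⟨(x, y), ?_, ?_⟩)
        · simpa using hc
        · simp [hs]
      · refine ⟨h1, ?_, h3, fun e => ?_⟩
        · rw [Finset.filter_insert, if_neg hc, h2]
        · obtain ⟨a, b, t⟩ := e
          rw [h4, Finset.mem_insert, Prod.mk.injEq]
          refine ⟨fun h => ⟨.inr h.1, h.2⟩, ?_⟩
          rintro ⟨⟨rfl, rfl⟩ | h, h'⟩
          exacts [absurd h'.1 hc, ⟨h, h'⟩])
  exact ⟨this.2.2.1, fun e => (this.2.2.2 e).trans (by simp)⟩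

end HProg
end RAM
end CRS

/-! ### The complete program -/

namespace CRS
namespace RAM

variable {n : ℕ} {I : Fin n → Fin n → ℕ} {env : ℕ → Fin n} {σ τ : State n} {R : Digraph (Fin n)}

namespace HProg

/-- The greedy algorithm without the output. Scalar `1` becomes `0` if there is a solution. -/
def solve : HProg := seq copyInput (seq greedy (seq ranks labelTree))

theorem eval_solve (hn : 0 < n) : ∃ R', Relation.ReflTransGen GreedyStep R R' ∧
    (∀ u v, IsAuthorized R' u v → R'.Adj u v) ∧
    Matches ((solve.eval (matrix R) env σ).arr 0) R' ∧
    ((solve.eval (matrix R) env σ).sc 1 = 0 ↔ IsLocallyAcyclic R' ∧ (forcedGraph R').IsTree) ∧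
    ((forcedGraph R').IsTree → ∃ c : Fin n → ℕ,
      (∀ x y, (forcedGraph R').Adj x y → c x + rank R' x y = c y + rank R' y x) ∧
      ∀ x y, (solve.eval (matrix R) env σ).arr 5 x y = c x + rank R' x y + 1) := by
  rw [solve, eval, eval, eval]
  set σ₁ := copyInput.eval (matrix R) env σ with hσ₁
  have h1 : Matches (σ₁.arr 0) R := by rw [hσ₁, eval_copyInput]; exact matches_matrix
  obtain ⟨R', hR', h2, closed⟩ := eval_greedy (I := matrix R) (env := env) h1
  set σ₂ := greedy.eval (matrix R) env σ₁ with hσ₂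
  obtain ⟨h4, hsc⟩ := eval_ranks (I := matrix R) (env := env) h2
  have h3 : Matches ((ranks.eval (matrix R) env σ₂).arr 0) R' := by
    rwa [eval_arr (by decide)]
  obtain ⟨k1, k2⟩ := eval_labelTree (I := matrix R) (env := env) hn h3 h4
  refine ⟨R', hR', closed, ?_, k1.trans (and_congr_left' hsc), k2⟩
  rwa [eval_arr (by decide)]

end HProg

open HProg

/-- Writes the answer into cells `0` and `1`. -/
def writeAnswer : Prog :=
  .ite (Reg.sc 1).read (.assign (.lit 0) (.lit 0))
    (.seq (.assign (.lit 1) Reg.count.read) (.assign (.lit 0) (.lit 1)))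

/-- A bound for the running time of `writeAnswer`. -/
def writeAnswerTime : ℕ := (Reg.sc 1).read.cost + Reg.count.read.cost + 10

/-- The output length is copied before cell `0` is overwritten, because register addresses are
computed from the value `n` stored there. -/
theorem exec_writeAnswer {M : Mem} (h : Rep I false [] env σ M) :
    ∃ M' t, Exec writeAnswer M M' t ∧ t ≤ writeAnswerTime ∧
      (σ.sc 1 ≠ 0 → M' 0 = 0) ∧
      (σ.sc 1 = 0 → M' 0 = 1 ∧ M' 1 = σ.out.length ∧ ∀ a, 2 ≤ a → M' a = M a) := by
  have hsc : (Reg.sc 1).read.eval M = σ.sc 1 := h.eval_read (r := .sc 1) (show 1 < numVars by decide)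
  have hcount : Reg.count.read.eval M = σ.out.length := h.eval_read (r := .count) trivial
  by_cases h0 : σ.sc 1 = 0
  · refine ⟨_, _, .ite_false (by rw [hsc, h0]) (.seq (exec_assign (x := 1) rfl hcount)
      (exec_assign (x := 0) (v := 1) rfl rfl)), ?_, fun h => absurd h0 h, fun _ => ⟨?_, ?_, ?_⟩⟩
    · simp only [writeAnswerTime, Expr.cost]; omega
    · simp
    · simp
    · intro a ha
      rw [Function.update_of_ne (by omega), Function.update_of_ne (by omega)]
  · refine ⟨_, _, .ite_true (by rwa [hsc]) (exec_assign (x := 0) (v := 0) rfl rfl), ?_,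
      fun _ => ?_, fun h => absurd h h0⟩
    · simp only [writeAnswerTime, Expr.cost]; omega
    · simp

/-- A program that carries out the greedy algorithm. -/
def greedyProg : Prog :=
  .seq prelude (.seq solve.compile (.seq emitEdges.compile writeAnswer))

/-- A bound for the running time of `greedyProg`. -/
noncomputable def greedyProgTime : Polynomial ℕ :=
  preludeTime + solve.time + emitEdges.time + .C writeAnswerTime

theorem holdsOutput_some {M M' : Mem} {T : SimpleGraph (Fin n)} {L : Fin n → Fin n → ℕ}
    (hL : ∀ x y, T.Adj x y → L x y = L y x) (h : Rep I false [] env σ M) (h0 : M' 0 = 1)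
    (h1 : M' 1 = σ.out.length) (hM : ∀ a, 2 ≤ a → M' a = M a) (hnodup : σ.out.Nodup)
    (hout : ∀ e, e ∈ σ.out ↔ (T.Adj e.1 e.2.1 ∧ e.1 < e.2.1) ∧ e.2.2 = L e.1 e.2.1 + 1) :
    HoldsOutput M' (some (labelGraph T L)) := by
  refine ⟨h0, σ.out, h1, fun i hi => ⟨?_, ?_, ?_⟩, ?_, ?_⟩
  · rw [hM _ (by omega)]
    simpa [Loc.addr, Loc.val, hi] using h.cell (.out i 0) ⟨rfl, hi⟩
  · rw [hM _ (by omega), show 3 + 3 * i = 2 + 3 * i + 1 by omega]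
    simpa [Loc.addr, Loc.val, hi] using h.cell (.out i 1) ⟨rfl, hi⟩
  · rw [hM _ (by omega), show 4 + 3 * i = 2 + 3 * i + 2 by omega]
    simpa [Loc.addr, Loc.val, hi] using h.cell (.out i 2) ⟨rfl, hi⟩
  · refine List.Nodup.map_on ?_ hnodup
    rintro ⟨a, b, t⟩ he ⟨a', b', t'⟩ he' heq
    have h2 := (hout _).1 he
    have h3 := (hout _).1 he'
    simp only [Prod.mk.injEq, Sym2.eq_iff] at heq h2 h3
    obtain ⟨⟨rfl, rfl⟩ | ⟨rfl, rfl⟩, rfl⟩ := heq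
    · rfl
    · exact absurd h2.1.2 h3.1.2.asymm
  · rintro ⟨e, t⟩
    induction e with
    | _ a b =>
      rw [mem_labelGraph_edges, List.mem_map]
      constructor
      · rintro ⟨x, y, hxy, heq⟩
        rcases hxy.ne.lt_or_gt with hlt | hlt
        · exact ⟨(x, y, L x y + 1), (hout _).2 ⟨⟨hxy, hlt⟩, rfl⟩, heq⟩
        · refine ⟨(y, x, L x y + 1), (hout _).2 ⟨⟨hxy.symm, hlt⟩, ?_⟩, ?_⟩
          · rw [hL x y hxy]
          · rw [← heq, Sym2.eq_swap]
      · rintro ⟨⟨x, y, t'⟩, he, heq⟩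
        obtain ⟨⟨hxy, -⟩, ht⟩ := (hout _).1 he
        exact ⟨x, y, hxy, by rw [← heq, ht]⟩

theorem exec_greedyProg (R : Digraph (Fin n)) (hn : 0 < n) :
    ∃ M t out, Exec greedyProg (input R) M t ∧ t ≤ greedyProgTime.eval n ∧ HoldsOutput M out ∧
      IsGreedyOutput R out := by
  obtain ⟨M₁, t₁, σ, e₁, l₁, hout, r₁⟩ := exec_prelude_input R fun _ => ⟨0, hn⟩
  obtain ⟨M₂, t₂, e₂, l₂, r₂⟩ := exec_compile (isInput_matrix R) solve [] _ σ M₁ (by simp)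
    (by decide) r₁
  obtain ⟨R', hR', closed, hA, hsc, hc⟩ := eval_solve (R := R) (σ := σ)
    (env := fun _ => ⟨0, hn⟩) hn
  have hout₂ : (solve.eval (matrix R) (fun _ => ⟨0, hn⟩) σ).out = [] :=
    (eval_out (by decide)).trans hout
  set σ₂ := solve.eval (matrix R) (fun _ => ⟨0, hn⟩) σ with hσ₂
  obtain ⟨M₃, t₃, e₃, l₃, r₃⟩ := exec_compile (isInput_matrix R) emitEdges [] _ σ₂ M₂ (by simp)
    (by decide) (r₂.startOutput hout₂)
  have hsc₃ : (emitEdges.eval (matrix R) (fun _ => ⟨0, hn⟩) σ₂).sc 1 = σ₂.sc 1 :=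
    eval_sc (by decide)
  obtain ⟨M₄, t₄, e₄, l₄, hno, hyes⟩ := exec_writeAnswer r₃
  have hexec := Exec.seq e₁ (.seq e₂ (.seq e₃ e₄))
  have htime : t₁ + (t₂ + (t₃ + t₄)) ≤ greedyProgTime.eval n := by
    simp only [greedyProgTime, Polynomial.eval_add, Polynomial.eval_C]
    omega
  rw [hsc₃] at hno hyes
  by_cases h0 : σ₂.sc 1 = 0
  · obtain ⟨hloc, hT⟩ := hsc.1 h0
    obtain ⟨c, hadj, h5⟩ := hc hT
    obtain ⟨y0, y1, yM⟩ := hyes h0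
    have hcard := (SimpleGraph.isTree_iff_connected_and_card.1 hT).2
    rw [Nat.card_eq_fintype_card (α := Fin n), Fintype.card_fin] at hcard
    obtain ⟨hnodup, hmem⟩ := eval_emitEdges (I := matrix R) (env := fun _ => ⟨0, hn⟩) hA hout₂
      (by omega)
    simp only [h5] at hmem
    exact ⟨_, _, _, hexec, htime, holdsOutput_some hadj r₃ y0 y1 yM hnodup hmem,
      R', hR', closed, hT, hloc.isLabelisation hT c hadj⟩
  · refine ⟨_, _, none, hexec, htime, hno h0, R', hR', closed, ?_⟩
    rintro ⟨hT, hG⟩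
    exact h0 (hsc.2 ⟨(exists_isLabelisation_iff hT).1 hG, hT⟩)

end RAM
end CRS

/-! ### The main theorem -/

theorem theorem2 :
    -- walk-Helly and tree representations, for connected request graphs
    (∀ (V : Type u) [Finite V] (R : Digraph V), CRS.IsConnected R →
      (CRS.IsWalkHelly R ↔ ∃ T : SimpleGraph V, CRS.IsTreeRepresentation R T)) ∧
    -- the three equivalent statements, for strongly connected request graphs
    (∀ (V : Type u) [Finite V] [Nonempty V] (R : Digraph V), CRS.IsStronglyConnected R →
      [CRS.IsWalkHelly R,
        ∃ T : SimpleGraph V, CRS.IsTreeRepresentation R T,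
        ∃ G : CRS.TemporalGraph V, CRS.IsTreeSolution R G].TFAE) ∧
    -- every output of the greedy algorithm is correct, whatever arcs it chooses
    (∀ (V : Type u) [Finite V] [Nonempty V] (R : Digraph V), CRS.IsStronglyConnected R →
      ∀ out : Option (CRS.TemporalGraph V), CRS.IsGreedyOutput R out →
        CRS.IsCorrectAnswer R out) ∧
    -- one program carries out the greedy algorithm in a number of steps polynomial in `n`
    (∃ (prog : CRS.RAM.Prog) (p : Polynomial ℕ),
      ∀ (n : ℕ) (R : Digraph (Fin n)), 0 < n → CRS.IsStronglyConnected R →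
        ∃ (M : CRS.RAM.Mem) (t : ℕ) (out : Option (CRS.TemporalGraph (Fin n))),
          CRS.RAM.Exec prog (CRS.RAM.input R) M t ∧ t ≤ p.eval n ∧
          CRS.RAM.HoldsOutput M out ∧ CRS.IsGreedyOutput R out ∧
          CRS.IsCorrectAnswer R out) := by
  refine ⟨fun V _ R hR => ?_, fun V _ _ R hR => ?_, fun V _ _ R hR out => ?_,
    CRS.RAM.greedyProg, CRS.RAM.greedyProgTime, fun n R hn hR => ?_⟩
  · have := hR.nonempty
    exact CRS.isWalkHelly_iff_exists_isTreeRepresentation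
  · tfae_have 1 ↔ 2 := CRS.isWalkHelly_iff_exists_isTreeRepresentation
    tfae_have 1 → 3 := fun h => h.exists_isTreeSolution hR
    tfae_have 3 → 1 := fun ⟨_, hG⟩ => hG.isWalkHelly
    tfae_finish
  · exact fun h => h.isCorrectAnswer hR
  · have : Nonempty (Fin n) := ⟨⟨0, hn⟩⟩
    obtain ⟨M, t, out, h1, h2, h3, h4⟩ := CRS.RAM.exec_greedyProg R hn
    exact ⟨M, t, out, h1, h2, h3, h4, h4.isCorrectAnswer hR⟩
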